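/- Let $n,p,d$ be non-negative integers with $d\ge 1$, let $X\in\mathbb R^{n\times p}$ (rows $x_i^T$), $y\in\mathbb R^{n\times d}$ (rows $y_i^T$) and $a\in\mathbb R$, and assume that the $n\times(p+d)$ matrix $(X:y)$ has rank $p+d$ and that $n>p+2d-2a$. Let $\mathcal S_d\subset\mathbb R^{d(d+1)/2}$ be the set of positive definite $d\times d$ matrices and $\mathsf X=\mathbb R^{p\times d}\times\mathcal S_d$, with Lebesgue measure $d\beta\,d\Sigma$. Let $h$ be one of the following probability densities on $(0,\infty)$, where $b$ denotes the normalizing constant: - generalized inverse Gaussian: $h(u)=b\,u^{v-1}\exp\{-\tfrac12(\alpha u+\gamma/u)\}$ with $v\in\mathbb R$, $\alpha,\gamma>0$; - log-normal: $h(u)=\tfrac bu\exp\{-\tfrac1{2\gamma}(\log u-\mu)^2\}$ with $\mu\in\mathbb R$, $\gamma>0$; - Fréchet: $h(u)=b\,u^{-(\alpha+1)}e^{-\gamma^\alpha/u^\alpha}$ with $\alpha>d/2$, $\gamma>0$; - inverted gamma: $h(u)=b\,u^{-\alpha-1}e^{-\gamma/u}$ with $\alpha>d/2$, $\gamma>0$.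 For $(\beta,\Sigma)\in\mathsf X$ let $r_i(\beta,\Sigma)=(\beta^Tx_i-y_i)^T\Sigma^{-1}(\beta^Tx_i-y_i)$, let $$f(y|\beta,\Sigma)=\prod_{i=1}^n\int_0^\infty\frac{u^{d/2}}{(2\pi)^{d/2}|\Sigma|^{1/2}}\,e^{-\frac u2 r_i(\beta,\Sigma)}\,h(u)\,du,$$ let $m(y)=\int_{\mathsf X}f(y|\beta,\Sigma)\,|\Sigma|^{-a}\,d\beta\,d\Sigma$, and let $\pi(\beta,\Sigma|y)=f(y|\beta,\Sigma)\,|\Sigma|^{-a}/m(y)$ be the posterior density. For $z\in(0,\infty)^n$ let $D_z$ be the diagonal matrix with diagonal $z$, and put $\Omega=(X^TD_zX)^{-1}$, $M=\Omega X^TD_zy$, $\Theta=(y^TD_zy-M^T\Omega^{-1}M)^{-1}$. Let $\pi(\beta|\Sigma,z,y)$ be the matrix normal density $$\frac{1}{(2\pi)^{pd/2}|\Omega|^{d/2}|\Sigma|^{p/2}}\exp\Big[-\tfrac12\mathrm{tr}\{\Omega^{-1}(\beta-M)\Sigma^{-1}(\beta-M)^T\}\Big],$$ let $\pi(\Sigma|z,y)$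 be the inverse Wishart density $$\frac{|\Sigma|^{-\frac{q+d+1}{2}}\exp\{-\frac12\mathrm{tr}(\Theta^{-1}\Sigma^{-1})\}}{2^{qd/2}\,\pi^{d(d-1)/4}\,|\Theta|^{q/2}\prod_{i=1}^d\Gamma(\frac{q+1-i}{2})},\qquad q=n-p+2a-d-1,$$ and let $\pi(z|\beta,\Sigma,y)=\prod_{i=1}^n\psi(z_i;r_i(\beta,\Sigma))$, where $\psi(\cdot\,;s)$ is the probability density on $(0,\infty)$ proportional to $u^{d/2}e^{-su/2}h(u)$. The data augmentation (DA) Markov chain on $\mathsf X$ has transition density $$k\big((\beta',\Sigma')\,|\,(\beta,\Sigma)\big)=\int_{(0,\infty)^n}\pi(\beta'|\Sigma',z,y)\,\pi(\Sigma'|z,y)\,\pi(z|\beta,\Sigma,y)\,dz .$$ Then $h$ is a probability density satisfying $\int_0^\infty u^{d/2}h(u)\,du<\infty$ and $\int_0^\infty u^{-\frac{n-p+2a-2d-1}{2}}h(u)\,du<\infty$; the posterior $\pi(\cdot|y)$ is a (proper) probability density; and the DA Markov operator $$(Kf)(\beta,\Sigma)=\int_{\mathsf X}f(\beta',\Sigma')\,k\big((\beta',\Sigma')\,|\,(\beta,\Sigma)\big)\,d\beta'\,d\Sigma'$$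 is a well-defined bounded operator on the real Hilbert space $L^2_0$ of functions that are square integrable and of mean zero with respect to $\pi(\cdot|y)$ (the integral converging for almost every $(\beta,\Sigma)$), and it is self-adjoint, positive and trace-class, that is, compact with summable eigenvalues (counted with multiplicity). -/

import Mathlib

open MeasureTheory Set

noncomputable section

/-! ### Mixing densities

A mixing density is a probability density on `(0, ∞)`.  It is represented by a function `ℝ → ℝ` of
which only the values on `(0, ∞)` are ever used. -/

/-- `h` is a probability density on `(0, ∞)`. -/
structure IsMixingDensity (h : ℝ → ℝ) : Prop where
  nonneg : ∀ u ∈ Ioi (0 : ℝ), 0 ≤ h u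
  integrable : IntegrableOn h (Ioi 0)
  integral_eq_one : ∫ u in Ioi (0 : ℝ), h u = 1

/-- The function `g`, multiplied by the normalizing constant that makes it integrate to one over
`(0, ∞)`. -/
def normalized (g : ℝ → ℝ) : ℝ → ℝ := fun u => (∫ v in Ioi (0 : ℝ), g v)⁻¹ * g u

/-- The generalized inverse Gaussian density `GIG(v, α, γ)`. -/
def gigDensity (v α γ : ℝ) : ℝ → ℝ :=
  normalized fun u => u ^ (v - 1) * Real.exp (-(1 / 2) * (α * u + γ / u))

/-- The log-normal density with parameters `μ` and `γ` (mean and variance of the logarithm). -/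
def logNormalDensity (μ γ : ℝ) : ℝ → ℝ :=
  normalized fun u => 1 / u * Real.exp (-(1 / (2 * γ)) * (Real.log u - μ) ^ 2)

/-- The Fréchet density with shape `α` and scale `γ`. -/
def frechetDensity (α γ : ℝ) : ℝ → ℝ :=
  normalized fun u => u ^ (-(α + 1)) * Real.exp (-(γ ^ α / u ^ α))

/-- The inverted gamma density with shape `α` and scale `γ`. -/
def invGammaDensity (α γ : ℝ) : ℝ → ℝ :=
  normalized fun u => u ^ (-α - 1) * Real.exp (-(γ / u))

/-! ### The parameter space -/

/-- Index set of the `d (d + 1) / 2` free entries of a symmetric `d × d` matrix. -/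
abbrev SymIndex (d : ℕ) : Type := {ij : Fin d × Fin d // ij.1 ≤ ij.2}

/-- The symmetric matrix with given entries on and above the diagonal. -/
def symMatrix {d : ℕ} (v : SymIndex d → ℝ) : Matrix (Fin d) (Fin d) ℝ :=
  Matrix.of fun i j => v ⟨(min i j, max i j), min_le_max⟩

/-- Ambient Euclidean space of the pairs `(β, Σ)`: the entries of the `p × d` matrix `β`, and the
entries on and above the diagonal of the symmetric `d × d` matrix `Σ`. -/
abbrev Param (p d : ℕ) : Type := (Fin p → Fin d → ℝ) × (SymIndex d → ℝ)

/-- The matrix `β` of regression coefficients. -/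
def Param.beta {p d : ℕ} (x : Param p d) : Matrix (Fin p) (Fin d) ℝ := Matrix.of x.1

/-- The scale matrix `Σ`. -/
def Param.sigma {p d : ℕ} (x : Param p d) : Matrix (Fin d) (Fin d) ℝ := symMatrix x.2

/-- The state space: all `(β, Σ)` with `Σ` positive definite. -/
def stateSpace (p d : ℕ) : Set (Param p d) := {x | x.sigma.PosDef}

/-- Lebesgue measure `dβ dΣ` on the state space. -/
def stateMeasure (p d : ℕ) : Measure (Param p d) := volume.restrict (stateSpace p d)

/-! ### The posterior distribution -/

/-- The squared residual `(βᵀ xᵢ - yᵢ)ᵀ Σ⁻¹ (βᵀ xᵢ - yᵢ)` of the `i`-th observation. -/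
def sqResidual {n p d : ℕ} (X : Matrix (Fin n) (Fin p) ℝ) (y : Matrix (Fin n) (Fin d) ℝ)
    (x : Param p d) (i : Fin n) : ℝ :=
  (x.beta.transpose.mulVec (X i) - y i) ⬝ᵥ
    x.sigma⁻¹.mulVec (x.beta.transpose.mulVec (X i) - y i)

/-- The likelihood `f(y | β, Σ)`. -/
def likelihood {n p d : ℕ} (X : Matrix (Fin n) (Fin p) ℝ) (y : Matrix (Fin n) (Fin d) ℝ)
    (h : ℝ → ℝ) (x : Param p d) : ℝ :=
  ∏ i : Fin n, ∫ u in Ioi (0 : ℝ),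
    u ^ ((d : ℝ) / 2) / ((2 * Real.pi) ^ ((d : ℝ) / 2) * x.sigma.det ^ (1 / 2 : ℝ)) *
      Real.exp (-(u / 2) * sqResidual X y x i) * h u

/-- The improper prior density `|Σ|⁻ᵃ`. -/
def priorDensity {p d : ℕ} (a : ℝ) (x : Param p d) : ℝ := x.sigma.det ^ (-a)

/-- The integral `m(y)` of likelihood times prior; the posterior is proper when it is finite. -/
def marginal {n p d : ℕ} (X : Matrix (Fin n) (Fin p) ℝ) (y : Matrix (Fin n) (Fin d) ℝ)
    (a : ℝ) (h : ℝ → ℝ) : ENNReal :=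
  ∫⁻ x, ENNReal.ofReal (likelihood X y h x * priorDensity a x) ∂(stateMeasure p d)

/-- The posterior distribution of `(β, Σ)`, with density `f(y | β, Σ) |Σ|⁻ᵃ / m(y)`. -/
def posterior {n p d : ℕ} (X : Matrix (Fin n) (Fin p) ℝ) (y : Matrix (Fin n) (Fin d) ℝ)
    (a : ℝ) (h : ℝ → ℝ) : Measure (Param p d) :=
  (stateMeasure p d).withDensity fun x =>
    ENNReal.ofReal (likelihood X y h x * priorDensity a x) / marginal X y a h

/-! ### The data augmentation Markov chain -/

/-- The density at `Z` of the matrix normal distribution `N_{r,c}(θ, A, B)`. -/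
def matrixNormalDensity {r c : ℕ} (θ : Matrix (Fin r) (Fin c) ℝ) (A : Matrix (Fin r) (Fin r) ℝ)
    (B : Matrix (Fin c) (Fin c) ℝ) (Z : Matrix (Fin r) (Fin c) ℝ) : ℝ :=
  1 / ((2 * Real.pi) ^ ((r : ℝ) * c / 2) * A.det ^ ((c : ℝ) / 2) * B.det ^ ((r : ℝ) / 2)) *
    Real.exp (-(1 / 2) * (A⁻¹ * (Z - θ) * B⁻¹ * (Z - θ).transpose).trace)

/-- The density at the positive definite matrix `W` of the inverse Wishart distribution
`IW_r(m, Θ)`. -/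
def inverseWishartDensity {r : ℕ} (m : ℝ) (Θ W : Matrix (Fin r) (Fin r) ℝ) : ℝ :=
  W.det ^ (-((m + r + 1) / 2)) * Real.exp (-(1 / 2) * (Θ⁻¹ * W⁻¹).trace) /
    ((2 : ℝ) ^ (m * r / 2) * Real.pi ^ ((r : ℝ) * (r - 1) / 4) * Θ.det ^ (m / 2) *
      ∏ i ∈ Finset.Icc 1 r, Real.Gamma (1 / 2 * (m + 1 - i)))

/-- The density `ψ(u; s)` on `(0, ∞)`, proportional to `u ^ (d / 2) * exp (- s u / 2) * h u`. -/
def latentDensity (d : ℕ) (h : ℝ → ℝ) (s : ℝ) : ℝ → ℝ :=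
  normalized fun u => u ^ ((d : ℝ) / 2) * Real.exp (-(s * u / 2)) * h u

/-- `Ω = (Xᵀ Q⁻¹ X)⁻¹`, where `Q⁻¹` is the diagonal matrix with entries `zᵢ`. -/
def omegaMatrix {n p : ℕ} (X : Matrix (Fin n) (Fin p) ℝ) (z : Fin n → ℝ) :
    Matrix (Fin p) (Fin p) ℝ :=
  (X.transpose * Matrix.diagonal z * X)⁻¹

/-- `μ = (Xᵀ Q⁻¹ X)⁻¹ Xᵀ Q⁻¹ y`. -/
def muMatrix {n p d : ℕ} (X : Matrix (Fin n) (Fin p) ℝ) (y : Matrix (Fin n) (Fin d) ℝ)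
    (z : Fin n → ℝ) : Matrix (Fin p) (Fin d) ℝ :=
  (X.transpose * Matrix.diagonal z * X)⁻¹ * X.transpose * Matrix.diagonal z * y

/-- The inverse Wishart parameter `(yᵀ Q⁻¹ y - μᵀ Ω⁻¹ μ)⁻¹`. -/
def thetaMatrix {n p d : ℕ} (X : Matrix (Fin n) (Fin p) ℝ) (y : Matrix (Fin n) (Fin d) ℝ)
    (z : Fin n → ℝ) : Matrix (Fin d) (Fin d) ℝ :=
  (y.transpose * Matrix.diagonal z * y -
    (muMatrix X y z).transpose * (omegaMatrix X z)⁻¹ * muMatrix X y z)⁻¹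

/-- The transition density `k(x' | x)` of the data augmentation chain, from `x = (β, Σ)` to
`x' = (β', Σ')`: draw `zᵢ ∼ ψ(·; rᵢ)` independently, then
`Σ' ∼ IW_d(n - p + 2a - d - 1, (yᵀ Q⁻¹ y - μᵀ Ω⁻¹ μ)⁻¹)`, then `β' ∼ N_{p,d}(μ, Ω, Σ')`. -/
def transitionDensity {n p d : ℕ} (X : Matrix (Fin n) (Fin p) ℝ) (y : Matrix (Fin n) (Fin d) ℝ)
    (a : ℝ) (h : ℝ → ℝ) (x' x : Param p d) : ℝ :=
  ∫ z in {z : Fin n → ℝ | ∀ i, 0 < z i},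
    matrixNormalDensity (muMatrix X y z) (omegaMatrix X z) x'.sigma x'.beta *
      inverseWishartDensity ((n : ℝ) - p + 2 * a - d - 1) (thetaMatrix X y z) x'.sigma *
      ∏ i : Fin n, latentDensity d h (sqResidual X y x i) (z i)

/-! ### The Markov operator -/

/-- The space `L²₀(π)` of square integrable real functions with mean zero.  (Integrability is
automatic when `π` is a finite measure.) -/
def meanZeroL2 {E : Type*} [MeasurableSpace E] (π : Measure E) : Submodule ℝ (Lp ℝ 2 π) where
  carrier := {f | Integrable f π ∧ ∫ x, f x ∂π = 0}
  zero_mem' := by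
    refine ⟨(integrable_zero E ℝ π).congr (Lp.coeFn_zero ℝ 2 π).symm, ?_⟩
    rw [integral_congr_ae (Lp.coeFn_zero ℝ 2 π)]
    simp
  add_mem' := by
    rintro f g ⟨hf, hf0⟩ ⟨hg, hg0⟩
    refine ⟨(hf.add hg).congr (Lp.coeFn_add f g).symm, ?_⟩
    rw [integral_congr_ae (Lp.coeFn_add f g), integral_add' hf hg, hf0, hg0, add_zero]
  smul_mem' := by
    rintro c f ⟨hf, hf0⟩
    refine ⟨(hf.smul c).congr (Lp.coeFn_smul c f).symm, ?_⟩
    rw [integral_congr_ae (Lp.coeFn_smul c f)]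
    simp [integral_const_mul, hf0]

/-- `K` is the Markov operator of the data augmentation chain on `L²₀` of the posterior: for every
`f`, the integral `∫ f(x') k(x' | x) dx'` converges and equals `(K f)(x)` for almost all `x`. -/
def IsDAOperator {n p d : ℕ} (X : Matrix (Fin n) (Fin p) ℝ) (y : Matrix (Fin n) (Fin d) ℝ)
    (a : ℝ) (h : ℝ → ℝ)
    (K : meanZeroL2 (posterior X y a h) →L[ℝ] meanZeroL2 (posterior X y a h)) : Prop :=
  ∀ f : meanZeroL2 (posterior X y a h), ∀ᵐ x ∂(posterior X y a h),
    Integrable (fun x' => (f : Lp ℝ 2 (posterior X y a h)) x' * transitionDensity X y a h x' x)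
      (stateMeasure p d) ∧
    (K f : Lp ℝ 2 (posterior X y a h)) x =
      ∫ x', (f : Lp ℝ 2 (posterior X y a h)) x' * transitionDensity X y a h x' x
        ∂(stateMeasure p d)

/-- `T` is self-adjoint, positive and trace-class, that is, compact with summable eigenvalues, each
eigenvalue being repeated according to the dimension of its eigenspace.  (The eigenspaces of nonzero
eigenvalues of a compact operator are finite-dimensional; a real number that is not an eigenvalue
contributes zero to the sum.) -/
structure IsPositiveTraceClass {H : Type*} [NormedAddCommGroup H] [InnerProductSpace ℝ H]
    (T : H →L[ℝ] H) : Prop where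
  positive : T.IsPositive
  compact : IsCompactOperator T
  summable_eigenvalues : Summable fun c : ℝ =>
    (Module.finrank ℝ (Module.End.eigenspace (T : H →ₗ[ℝ] H) c) : ℝ) * |c|

end

open MeasureTheory Set

noncomputable section

/-! Write T(x) for the product of the normalizing constants of the latent densities, w(z) = ∏
zᵢ^(d/2) h(zᵢ), e(z,x) = exp(-½ Σ zᵢ rᵢ(x)), and N(z) for the integral of |Σ|^(-(n/2+a)) e(z,·). The
posterior density π is proportional to |Σ|^(-(n/2+a)) T, so the transition density factors as π(x')
∫ κ(x,z) κ(x',z) dz with κ(x,z) = √(const · w(z)/N(z)) · e(z,x)/T(x) (`rootKernel`). Thus the Markov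
operator is A*A, where A : L²(π) → L²(dz) has kernel κ. Once κ is square integrable, A is
Hilbert–Schmidt; by Bessel's inequality Σ ⟨A*A eᵢ, eᵢ⟩ ≤ ‖κ‖² for every finite orthonormal family,
and this one bound yields both compactness and summable eigenvalues
(`exists_isPositiveTraceClass_kernel`).

Square integrability of κ (`memLp_rootKernel`) is the heart. Each of the four families satisfies
h(u) ≤ C u^ε h(ut) for u ≤ 1 and t ∈ [5/4, 3/2]. Averaging over t gives ψ(u;s) ≤ B(u) e^(su/4) with
B integrable and independent of s (`exists_tilted_bound`). The product of the factors e^(su/4) only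
replaces z by z/2 inside e(z,x), and N is homogeneous, so N(z/2) is a constant multiple of N(z);
hence ∬ κ² is at most a constant times (∫ B)ⁿ.

N is found by completing the square in β, which leaves a Gaussian integral and an inverse Wishart
integral (`lintegral_condKernel`). Their constants are never evaluated: only that they are finite
and nonzero matters, which follows from linear changes of variables and an induction that borders
the matrix Σ. The posterior is proper because N is decreasing and homogeneous, hence bounded by a
sum of negative powers of the zᵢ, and h has all negative moments. -/

/-! ### Positive operators with bounded trace sums on finite orthonormal families -/

theorem exists_orthonormal_fin_finrank (V : Type*) [NormedAddCommGroup V] [InnerProductSpace ℝ V] :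
    ∃ e : Fin (Module.finrank ℝ V) → V, Orthonormal ℝ e := by
  by_cases hV : FiniteDimensional ℝ V
  · exact ⟨stdOrthonormalBasis ℝ V, (stdOrthonormalBasis ℝ V).orthonormal⟩
  -- In infinite dimension `finrank` is 0 and the empty family does.
  · rw [Module.finrank_of_not_finite hV]
    exact ⟨Fin.elim0, by constructor <;> intro i <;> exact i.elim0⟩

/-- Eigenspaces of a symmetric operator are mutually orthogonal, so orthonormal bases of finitely
many of them form one orthonormal family; its trace sum is the partial sum of the eigenvalues, which
are nonnegative by positivity. -/
theorem summable_eigenvalues_of_sum_inner_le {H : Type*} [NormedAddCommGroup H]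
    [InnerProductSpace ℝ H] {T : H →L[ℝ] H} (hT : T.IsPositive) {B : ℝ}
    (hB : ∀ (ι : Type) [Fintype ι] (e : ι → H), Orthonormal ℝ e →
      ∑ i, inner ℝ (T (e i)) (e i) ≤ B) :
    Summable fun c : ℝ =>
      (Module.finrank ℝ (Module.End.eigenspace (T : H →ₗ[ℝ] H) c) : ℝ) * |c| := by
  refine summable_of_sum_le (c := B) (fun c => by positivity) fun s => ?_
  choose e he using fun c : ℝ =>
    exists_orthonormal_fin_finrank (Module.End.eigenspace (T : H →ₗ[ℝ] H) c)
  have hfam : OrthogonalFamily ℝ (fun c : s => Module.End.eigenspace (T : H →ₗ[ℝ] H) c)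
      fun c => (Module.End.eigenspace (T : H →ₗ[ℝ] H) c).subtypeₗᵢ :=
    (LinearMap.IsSymmetric.orthogonalFamily_eigenspaces hT.isSymmetric).comp
      Subtype.coe_injective
  have hon := hfam.orthonormal_sigma_orthonormal (fun c : s => he c)
  refine le_trans (le_of_eq ?_) (hB _ _ hon)
  rw [Fintype.sum_sigma, ← Finset.sum_coe_sort]
  refine Finset.sum_congr rfl fun c _ => ?_
  have key : ∀ i : Fin (Module.finrank ℝ (Module.End.eigenspace (T : H →ₗ[ℝ] H) (c : ℝ))),
      inner ℝ (T (e c i : H)) (e c i : H) = |(c : ℝ)| := by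
    intro i
    have h1 : T (e c i : H) = (c : ℝ) • (e c i : H) :=
      Module.End.mem_eigenspace_iff.1 (e c i).2
    have h2 : inner ℝ (e c i : H) (e c i : H) = 1 := by
      rw [real_inner_self_eq_norm_sq]
      have := (he c).1 i
      rw [Submodule.coe_norm] at this
      rw [this]; norm_num
    have h3 := hT.2 (e c i : H)
    have h4 : inner ℝ (T (e c i : H)) (e c i : H) = (c : ℝ) := by
      rw [h1, inner_smul_left, h2]; simp
    have h5 : (0 : ℝ) ≤ inner ℝ (T (e c i : H)) (e c i : H) := h3
    rw [h4] at h5 ⊢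
    rw [abs_of_nonneg h5]
  simp only [Submodule.coe_subtypeₗᵢ, Submodule.coe_subtype]
  rw [Finset.sum_congr rfl fun i _ => key i]
  simp

/-- Cauchy–Schwarz for the semi-inner product ⟨T·,·⟩, applied to v and w = Tv: ‖w‖⁴ ≤ ⟨Tv,v⟩⟨Tw,w⟩ ≤
⟨Tv,v⟩‖T‖‖w‖². The proof reads it off the discriminant of t ↦ ⟨T(tv+w), tv+w⟩. -/
theorem ContinuousLinearMap.IsPositive.norm_apply_sq_le {H : Type*} [NormedAddCommGroup H]
    [InnerProductSpace ℝ H] {T : H →L[ℝ] H} (hT : T.IsPositive) (v : H) :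
    ‖T v‖ ^ 2 ≤ ‖T‖ * inner ℝ (T v) v := by
  have hs : ∀ a b : H, inner ℝ (T a) b = inner ℝ a (T b) := hT.isSymmetric
  have hp : ∀ a : H, 0 ≤ inner ℝ (T a) a := fun a => hT.2 a
  set w := T v
  have h1 : ∀ t : ℝ, 0 ≤ inner ℝ (T v) v * (t * t) + (2 * ‖w‖ ^ 2) * t + inner ℝ (T w) w := by
    intro t
    have h := hp (t • v + w)
    rw [map_add, map_smul, inner_add_left, inner_add_right, inner_add_right, inner_smul_left,
      inner_smul_left, inner_smul_right, inner_smul_right, hs w v] at h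
    simp only [← real_inner_self_eq_norm_sq]
    simp only [conj_trivial] at h
    linarith
  have h2 := discrim_le_zero h1
  unfold discrim at h2
  have h3 : inner ℝ (T w) w ≤ ‖T‖ * ‖w‖ ^ 2 := by
    calc inner ℝ (T w) w ≤ ‖T w‖ * ‖w‖ := real_inner_le_norm _ _
      _ ≤ (‖T‖ * ‖w‖) * ‖w‖ := by gcongr; exact T.le_opNorm w
      _ = _ := by ring
  have h4 : ‖w‖ ^ 2 * ‖w‖ ^ 2 ≤ (‖T‖ * inner ℝ (T v) v) * ‖w‖ ^ 2 := by
    nlinarith [mul_le_mul_of_nonneg_left h3 (hp v)]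
  rcases (norm_nonneg w).eq_or_lt with h5 | h5
  · rw [← h5]; simpa using mul_nonneg (norm_nonneg T) (hp v)
  · exact le_of_mul_le_mul_right h4 (by positivity)

/-- Take a finite orthonormal family whose trace sum is nearly the supremum. On the orthogonal
complement of its span the quadratic form is small, hence so is T by `norm_apply_sq_le`, and T is a
norm limit of the finite-rank operators T ∘ (projection to the span). -/
theorem isCompactOperator_of_sum_inner_le {H : Type*} [NormedAddCommGroup H]
    [InnerProductSpace ℝ H] [CompleteSpace H] {T : H →L[ℝ] H} (hT : T.IsPositive) {B : ℝ}
    (hB : ∀ (ι : Type) [Fintype ι] (e : ι → H), Orthonormal ℝ e →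
      ∑ i, inner ℝ (T (e i)) (e i) ≤ B) : IsCompactOperator T := by
  have hp : ∀ a : H, 0 ≤ inner ℝ (T a) a := fun a => hT.2 a
  set S : Set ℝ := {r | ∃ (N : ℕ) (e : Fin N → H), Orthonormal ℝ e ∧
    r = ∑ i, inner ℝ (T (e i)) (e i)} with hS
  have hbdd : BddAbove S := ⟨B, by rintro r ⟨N, e, he, rfl⟩; exact hB _ e he⟩
  have hne : S.Nonempty :=
    ⟨_, 0, Fin.elim0, by constructor <;> intro i <;> exact i.elim0, rfl⟩
  have hclosed : IsClosed {f : H →L[ℝ] H | IsCompactOperator f} := isClosed_setOfPred_isCompactOperator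
  change T ∈ {f : H →L[ℝ] H | IsCompactOperator f}
  rw [← hclosed.closure_eq, Metric.mem_closure_iff]
  intro ε hε
  -- Chosen so that ‖T‖ δ ≤ (ε/2)²; the +1 avoids division by zero.
  set δ : ℝ := (ε / 2) ^ 2 / (‖T‖ + 1) with hδ
  have hδ0 : 0 < δ := by positivity
  obtain ⟨r, ⟨N, e, he, rfl⟩, hr⟩ := exists_lt_of_lt_csSup hne (sub_lt_self (sSup S) hδ0)
  set V : Submodule ℝ H := Submodule.span ℝ (Set.range e) with hV
  have : FiniteDimensional ℝ V := FiniteDimensional.span_of_finite ℝ (Set.finite_range e)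
  have horth : ∀ v ∈ Vᗮ, ‖v‖ = 1 → inner ℝ (T v) v ≤ δ := by
    intro v hv hv1
    -- A unit vector orthogonal to the family extends it, and the longer trace sum still cannot
    -- exceed the supremum.
    have hon : Orthonormal ℝ (Fin.cons v e : Fin (N + 1) → H) := by
      refine ⟨fun i => ?_, fun i j hij => ?_⟩
      · refine Fin.cases ?_ (fun i => ?_) i
        · simpa using hv1
        · simpa using he.1 i
      · have hve : ∀ k, inner ℝ (e k) v = 0 := fun k =>
          (Submodule.mem_orthogonal V v).1 hv (e k) (Submodule.subset_span ⟨k, rfl⟩)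
        revert hij
        refine Fin.cases ?_ (fun i => ?_) i <;> refine Fin.cases ?_ (fun j => ?_) j <;> intro hij
        · exact absurd rfl hij
        · simpa [real_inner_comm] using hve j
        · simpa using hve i
        · simpa using he.2 (fun h => hij (by rw [h]))
    have hle : ∑ i, inner ℝ (T ((Fin.cons v e : Fin (N + 1) → H) i))
        ((Fin.cons v e : Fin (N + 1) → H) i) ≤ sSup S := le_csSup hbdd ⟨N + 1, _, hon, rfl⟩
    rw [Fin.sum_univ_succ] at hle
    simp only [Fin.cons_zero, Fin.cons_succ] at hle
    linarith
  refine ⟨T ∘L V.starProjection, ?_, ?_⟩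
  · have : IsCompactOperator (V.starProjection : H →L[ℝ] H) := by
      have h1 : IsCompactOperator (V.subtypeL) :=
        isCompactOperator_of_locallyCompactSpace_rng V.subtypeL
      exact h1.comp_clm V.orthogonalProjectionOnto
    exact this.clm_comp T
  · rw [dist_eq_norm]
    refine lt_of_le_of_lt (ContinuousLinearMap.opNorm_le_bound _ (by positivity : 0 ≤ ε / 2)
      fun v => ?_) (half_lt_self hε)
    set u := v - V.starProjection v with hu
    have hu1 : u ∈ Vᗮ := V.sub_starProjection_mem_orthogonal v
    have hu2 : ‖u‖ ≤ ‖v‖ := by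
      have h := V.norm_sq_eq_add_norm_sq_starProjection v
      have h2 : u = Vᗮ.starProjection v := by
        rw [hu, Submodule.starProjection_orthogonal_val]
      rw [← h2] at h
      nlinarith [norm_nonneg u, norm_nonneg v, sq_nonneg ‖V.starProjection v‖]
    have hTv : (T - T ∘L V.starProjection) v = T u := by simp [hu]
    rw [hTv]
    refine le_trans ?_ (mul_le_mul_of_nonneg_left hu2 (by positivity))
    have hq : inner ℝ (T u) u ≤ δ * ‖u‖ ^ 2 := by
      rcases eq_or_ne u 0 with h0 | h0
      · simp [h0]
      · have h1 := horth (‖u‖⁻¹ • u) (Submodule.smul_mem _ _ hu1) (norm_smul_inv_norm h0)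
        rw [map_smul, inner_smul_left, inner_smul_right] at h1
        simp only [conj_trivial] at h1
        have hpos : 0 < ‖u‖ := norm_pos_iff.2 h0
        calc inner ℝ (T u) u = (‖u‖⁻¹ * (‖u‖⁻¹ * inner ℝ (T u) u)) * ‖u‖ ^ 2 := by
              field_simp
          _ ≤ _ := by gcongr
    have h2 := hT.norm_apply_sq_le u
    have h3 : ‖T u‖ ^ 2 ≤ (ε / 2 * ‖u‖) ^ 2 := by
      calc ‖T u‖ ^ 2 ≤ ‖T‖ * (δ * ‖u‖ ^ 2) := h2.trans (by gcongr)
        _ ≤ (‖T‖ + 1) * (δ * ‖u‖ ^ 2) := by gcongr; linarith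
        _ = _ := by rw [hδ]; field_simp
    exact le_of_sq_le_sq h3 (by positivity)

theorem isPositiveTraceClass_of_sum_inner_le {H : Type*} [NormedAddCommGroup H]
    [InnerProductSpace ℝ H] [CompleteSpace H] {T : H →L[ℝ] H} (hT : T.IsPositive) {B : ℝ}
    (hB : ∀ (ι : Type) [Fintype ι] (e : ι → H), Orthonormal ℝ e →
      ∑ i, inner ℝ (T (e i)) (e i) ≤ B) : IsPositiveTraceClass T :=
  ⟨hT, isCompactOperator_of_sum_inner_le hT hB, summable_eigenvalues_of_sum_inner_le hT hB⟩


/-! ### Hilbert–Schmidt kernels κ and the operator T*T on mean zero functions -/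

section KernelOperator

variable {E F : Type*} [MeasurableSpace E] [MeasurableSpace F]

theorem ae_memLp_section {μ : Measure E} {ν : Measure F} [SFinite μ] [SFinite ν] {κ : E → F → ℝ}
    (hm : Measurable (Function.uncurry κ)) (hκ : MemLp (Function.uncurry κ) 2 (μ.prod ν)) :
    ∀ᵐ z ∂ν, MemLp (fun x => κ x z) 2 μ := by
  filter_upwards [hκ.integrable_sq.prod_left_ae] with z hz
  exact (memLp_two_iff_integrable_sq
    (hm.comp measurable_prodMk_right).aestronglyMeasurable).2 hz

theorem norm_toLp_sq {μ : Measure E} {f : E → ℝ} (hf : MemLp f 2 μ) :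
    ‖hf.toLp f‖ ^ 2 = ∫ x, f x ^ 2 ∂μ := by
  rw [← real_inner_self_eq_norm_sq, L2.inner_def]
  refine integral_congr_ae ?_
  filter_upwards [hf.coeFn_toLp] with x hx
  simp [hx, sq]

theorem inner_toLp_left {μ : Measure E} {f : E → ℝ} (hf : MemLp f 2 μ) (g : Lp ℝ 2 μ) :
    inner ℝ (hf.toLp f) g = ∫ x, f x * g x ∂μ := by
  rw [L2.inner_def]
  refine integral_congr_ae ?_
  filter_upwards [hf.coeFn_toLp] with x hx
  simp [hx, mul_comm]

theorem sq_integral_mul_le {μ : Measure E} {f : E → ℝ} (hf : MemLp f 2 μ) (g : Lp ℝ 2 μ) :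
    (∫ x, f x * g x ∂μ) ^ 2 ≤ (∫ x, f x ^ 2 ∂μ) * ‖g‖ ^ 2 := by
  rw [← inner_toLp_left hf, ← norm_toLp_sq hf, ← mul_pow]
  exact sq_le_sq' (by linarith [neg_le_of_abs_le (abs_real_inner_le_norm (hf.toLp f) g)])
    (real_inner_le_norm _ _)

theorem memLp_integral_mul {μ : Measure E} {ν : Measure F} [SFinite μ] [SFinite ν]
    {κ : E → F → ℝ} (hm : Measurable (Function.uncurry κ))
    (hκ : MemLp (Function.uncurry κ) 2 (μ.prod ν)) (f : Lp ℝ 2 μ) :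
    MemLp (fun z => ∫ x, κ x z * f x ∂μ) 2 ν := by
  have hmeas : StronglyMeasurable (fun z => ∫ x, κ x z * f x ∂μ) :=
    StronglyMeasurable.integral_prod_left (f := fun x z => κ x z * f x)
      (hm.stronglyMeasurable.mul ((Lp.stronglyMeasurable f).comp_measurable measurable_fst))
  refine (memLp_two_iff_integrable_sq hmeas.aestronglyMeasurable).2 ?_
  have hint : Integrable (fun z => (∫ x, κ x z ^ 2 ∂μ) * ‖f‖ ^ 2) ν :=
    (hκ.integrable_sq.integral_prod_right).mul_const _
  refine hint.mono' (hmeas.pow 2).aestronglyMeasurable ?_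
  filter_upwards [ae_memLp_section hm hκ] with z hz
  rw [Real.norm_of_nonneg (sq_nonneg _)]
  exact sq_integral_mul_le hz f

/-- The Hilbert–Schmidt operator with a square integrable kernel. -/
theorem exists_kernel_operator {μ : Measure E} {ν : Measure F} [SFinite μ] [SFinite ν]
    {κ : E → F → ℝ} (hm : Measurable (Function.uncurry κ))
    (hκ : MemLp (Function.uncurry κ) 2 (μ.prod ν)) :
    ∃ T : Lp ℝ 2 μ →L[ℝ] Lp ℝ 2 ν, ∀ f, T f =ᵐ[ν] fun z => ∫ x, κ x z * f x ∂μ := by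
  have hsec := ae_memLp_section hm hκ
  refine ⟨LinearMap.mkContinuous
    { toFun := fun f => (memLp_integral_mul hm hκ f).toLp _
      map_add' := fun f g => ?_
      map_smul' := fun c f => ?_ } (Real.sqrt (∫ z, ∫ x, κ x z ^ 2 ∂μ ∂ν)) fun f => ?_,
    fun f => (memLp_integral_mul hm hκ f).coeFn_toLp⟩
  · rw [← MemLp.toLp_add, MemLp.toLp_eq_toLp_iff]
    filter_upwards [hsec] with z hz
    simp only [Pi.add_apply, ← inner_toLp_left hz, inner_add_right]
  · rw [RingHom.id_apply, ← MemLp.toLp_const_smul, MemLp.toLp_eq_toLp_iff]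
    filter_upwards [hsec] with z hz
    simp only [Pi.smul_apply, ← inner_toLp_left hz, inner_smul_right, smul_eq_mul]
  · refine le_of_sq_le_sq ?_ (by positivity)
    have h0 : 0 ≤ ∫ z, ∫ x, κ x z ^ 2 ∂μ ∂ν :=
      integral_nonneg fun z => integral_nonneg fun x => sq_nonneg _
    rw [mul_pow, Real.sq_sqrt h0]
    simp only [LinearMap.coe_mk, AddHom.coe_mk]
    rw [norm_toLp_sq, ← integral_mul_const]
    refine integral_mono_ae (memLp_integral_mul hm hκ f).integrable_sq
      ((hκ.integrable_sq.integral_prod_right).mul_const _) ?_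
    filter_upwards [hsec] with z hz
    exact sq_integral_mul_le hz f

theorem memLp_mul_prod {μ : Measure E} {ν : Measure F} [SFinite μ] [SFinite ν] {f : E → ℝ}
    {g : F → ℝ} (hf : MemLp f 2 μ) (hg : MemLp g 2 ν) :
    MemLp (fun q : E × F => f q.1 * g q.2) 2 (μ.prod ν) := by
  refine (memLp_two_iff_integrable_sq (hf.1.comp_fst.mul hg.1.comp_snd)).2 ?_
  exact (hf.integrable_sq.mul_prod hg.integrable_sq).congr
    (.of_forall fun q => (mul_pow (f q.1) (g q.2) 2).symm)

theorem integrable_kernel_mul_mul {μ : Measure E} {ν : Measure F} [SFinite μ] [SFinite ν]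
    {κ : E → F → ℝ} (hκ : MemLp (Function.uncurry κ) 2 (μ.prod ν)) {f : E → ℝ} {g : F → ℝ}
    (hf : MemLp f 2 μ) (hg : MemLp g 2 ν) :
    Integrable (fun q : E × F => κ q.1 q.2 * (f q.1 * g q.2)) (μ.prod ν) :=
  hκ.integrable_mul (memLp_mul_prod hf hg)

/-- The subspace is the orthogonal complement of the constant 1, hence closed. -/
theorem meanZeroL2_completeSpace (π : Measure E) [IsFiniteMeasure π] :
    CompleteSpace (meanZeroL2 π) := by
  have h1 : MemLp (fun _ : E => (1 : ℝ)) 2 π := memLp_const 1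
  have hset : (meanZeroL2 π : Set (Lp ℝ 2 π)) = {f | inner ℝ (h1.toLp _) f = 0} := by
    ext f
    have hf : Integrable f π := (Lp.memLp f).integrable (by norm_num)
    have h2 : inner ℝ (h1.toLp _) f = ∫ x, f x ∂π := by
      rw [inner_toLp_left h1]; simp
    simp only [Set.mem_ofPred_eq, h2]
    exact ⟨fun h => h.2, fun h => ⟨hf, h⟩⟩
  have hcl : IsClosed (meanZeroL2 π : Set (Lp ℝ 2 π)) := by
    rw [hset]
    exact isClosed_eq (by fun_prop) continuous_const
  exact hcl.completeSpace_coe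

/-- The operator `T* T` of a Hilbert–Schmidt kernel `κ` on the mean zero functions. -/
theorem exists_isPositiveTraceClass_kernel {π : Measure E} {ν : Measure F} [IsFiniteMeasure π]
    [SFinite ν] {κ : E → F → ℝ} (hm : Measurable (Function.uncurry κ))
    (hκ : MemLp (Function.uncurry κ) 2 (π.prod ν)) {c : ℝ}
    (hc : ∀ᵐ x ∂π, ∫ z, κ x z * ∫ x', κ x' z ∂π ∂ν = c) :
    ∃ K : meanZeroL2 π →L[ℝ] meanZeroL2 π, IsPositiveTraceClass K ∧
      ∀ f : meanZeroL2 π, ∀ᵐ x ∂π,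
        Integrable (fun x' => (f : Lp ℝ 2 π) x' * ∫ z, κ x z * κ x' z ∂ν) π ∧
        (K f : Lp ℝ 2 π) x = ∫ x', (f : Lp ℝ 2 π) x' * ∫ z, κ x z * κ x' z ∂ν ∂π := by
  have hm' : Measurable (Function.uncurry fun z x => κ x z) := hm.comp measurable_swap
  have hκ' : MemLp (Function.uncurry fun z x => κ x z) 2 (ν.prod π) :=
    hκ.comp_measurePreserving Measure.measurePreserving_swap
  obtain ⟨T, hT⟩ := exists_kernel_operator hm hκ
  obtain ⟨S, hS⟩ := exists_kernel_operator hm' hκ'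
  -- S is the adjoint of T: Fubini applies because κ and f ⊗ g are both square integrable on the
  -- product.
  have hadj : ∀ (f : Lp ℝ 2 π) (g : Lp ℝ 2 ν), inner ℝ (S g) f = inner ℝ g (T f) := by
    intro f g
    have hint := integrable_kernel_mul_mul hκ (Lp.memLp f) (Lp.memLp g)
    have hl : inner ℝ (S g) f = ∫ x, ∫ z, κ x z * (f x * g z) ∂ν ∂π := by
      rw [L2.inner_def]
      refine integral_congr_ae ?_
      filter_upwards [hS g] with x hx
      simp only [RCLike.inner_apply, conj_trivial]
      rw [hx, ← integral_const_mul]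
      exact integral_congr_ae (.of_forall fun z => by ring_nf)
    have hr : inner ℝ g (T f) = ∫ z, ∫ x, κ x z * (f x * g z) ∂π ∂ν := by
      rw [L2.inner_def]
      refine integral_congr_ae ?_
      filter_upwards [hT f] with z hz
      simp only [RCLike.inner_apply, conj_trivial]
      rw [hz, ← integral_mul_const]
      exact integral_congr_ae (.of_forall fun x => by ring_nf)
    rw [hl, hr]
    exact integral_integral_swap hint
  have hsec' := ae_memLp_section hm' hκ'
  have hform : ∀ f : Lp ℝ 2 π, ∀ᵐ x ∂π, Integrable (fun x' => f x' * ∫ z, κ x z * κ x' z ∂ν) π ∧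
      S (T f) x = ∫ x', f x' * ∫ z, κ x z * κ x' z ∂ν ∂π := by
    intro f
    filter_upwards [hS (T f), hsec'] with x hx hsx
    have hint := integrable_kernel_mul_mul hκ (Lp.memLp f) hsx
    have hrw : ∀ x', ∫ z, κ x' z * (f x' * κ x z) ∂ν = f x' * ∫ z, κ x z * κ x' z ∂ν := by
      intro x'
      rw [← integral_const_mul]
      exact integral_congr_ae (.of_forall fun z => by ring_nf)
    refine ⟨?_, ?_⟩
    · refine hint.integral_prod_left.congr (.of_forall fun x' => hrw x')
    · rw [hx]
      calc ∫ z, κ x z * T f z ∂ν = ∫ z, ∫ x', κ x' z * (f x' * κ x z) ∂π ∂ν := by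
            refine integral_congr_ae ?_
            filter_upwards [hT f] with z hz
            rw [hz, ← integral_const_mul]
            exact integral_congr_ae (.of_forall fun x => by ring_nf)
        _ = ∫ x', ∫ z, κ x' z * (f x' * κ x z) ∂ν ∂π := (integral_integral_swap hint).symm
        _ = _ := integral_congr_ae (.of_forall fun x' => hrw x')
  have h1 : MemLp (fun _ : E => (1 : ℝ)) 2 π := memLp_const 1
  -- The hypothesis `hc` says that 1 is an eigenvector of S T. Its eigenvalue c need not be 1.
  have hone : S (T (h1.toLp _)) = c • h1.toLp _ := by
    refine Lp.ext ?_
    filter_upwards [hS (T (h1.toLp _)), hc, Lp.coeFn_smul c (h1.toLp _), h1.coeFn_toLp]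
      with x hx hcx hsm h1x
    rw [hx, hsm, Pi.smul_apply, h1x, ← hcx, smul_eq_mul, mul_one]
    refine integral_congr_ae ?_
    filter_upwards [hT (h1.toLp _)] with z hz
    rw [hz]
    congr 1
    refine integral_congr_ae ?_
    filter_upwards [h1.coeFn_toLp] with x' hx'
    rw [hx', mul_one]
  -- S T is symmetric, so ⟨1, S T f⟩ = ⟨S T 1, f⟩ = c ⟨1, f⟩ = 0.
  have hmaps : ∀ f ∈ meanZeroL2 π, (S ∘L T) f ∈ meanZeroL2 π := by
    intro f hf
    refine ⟨(Lp.memLp _).integrable (by norm_num), ?_⟩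
    have e1 : ∀ g : Lp ℝ 2 π, inner ℝ (h1.toLp _) g = ∫ x, g x ∂π := fun g => by
      rw [inner_toLp_left h1]; simp
    rw [ContinuousLinearMap.comp_apply, ← e1, real_inner_comm, hadj, ← real_inner_comm, ← hadj,
      hone, inner_smul_left, e1, hf.2, mul_zero]
  set K : meanZeroL2 π →L[ℝ] meanZeroL2 π := (S ∘L T).restrict hmaps with hK
  have hKc : ∀ f : meanZeroL2 π, (K f : Lp ℝ 2 π) = S (T f) := fun f => rfl
  have hKT : ∀ f g : meanZeroL2 π, inner ℝ (K f) g = inner ℝ (T f) (T g) := by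
    intro f g
    rw [Submodule.coe_inner, hKc, hadj]
  have hpos : K.IsPositive := by
    refine ⟨fun f g => ?_, fun f => ?_⟩
    · change inner ℝ (K f) g = inner ℝ f (K g)
      rw [hKT f g, real_inner_comm, ← hKT g f]
      exact real_inner_comm _ _
    · change 0 ≤ inner ℝ (K f) f
      rw [hKT]; exact real_inner_self_nonneg
  have := meanZeroL2_completeSpace π
  refine ⟨K, isPositiveTraceClass_of_sum_inner_le hpos (B := ∫ z, ∫ x, κ x z ^ 2 ∂π ∂ν) ?_,
    fun f => hform f⟩
  intro ι _ e he
  have hoe : Orthonormal ℝ fun i => (e i : Lp ℝ 2 π) := he.comp_linearIsometry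
    (meanZeroL2 π).subtypeₗᵢ
  have h2 : ∀ i, inner ℝ (K (e i)) (e i) = ∫ z, (∫ x, κ x z * (e i : Lp ℝ 2 π) x ∂π) ^ 2 ∂ν := by
    intro i
    rw [hKT, L2.inner_def]
    refine integral_congr_ae ?_
    filter_upwards [hT (e i)] with z hz
    simp [hz, sq]
  simp only [h2]
  rw [← integral_finsetSum _ fun i _ => (memLp_integral_mul hm hκ _).integrable_sq]
  refine integral_mono_ae
    (integrable_finsetSum _ fun i _ => (memLp_integral_mul hm hκ _).integrable_sq)
    hκ.integrable_sq.integral_prod_right ?_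
  filter_upwards [ae_memLp_section hm hκ] with z hz
  -- Bessel's inequality for the section κ(·, z); integrating it over z bounds the trace sums by
  -- ‖κ‖².
  have hb := hoe.sum_inner_products_le (hz.toLp _) (s := Finset.univ)
  rw [norm_toLp_sq] at hb
  refine le_trans (le_of_eq (Finset.sum_congr rfl fun i _ => ?_)) hb
  rw [← inner_toLp_left hz, real_inner_comm, Real.norm_eq_abs, sq_abs]

end KernelOperator


/-! ### Jacobians of matrix actions -/

section DetAction

open Matrix

variable {ι : Type*} [Fintype ι] [DecidableEq ι]

/-- Conjugation by the diagonal matrix E with 2 in place i turns the transvection t into t². As φ is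
multiplicative and nonzero on E and t, φ(t) = φ(t)². -/
theorem monoidHom_transvection_eq_one (φ : Matrix ι ι ℝ →* ℝ) {i j : ι} (hij : i ≠ j) (c : ℝ) :
    φ (transvection i j c) = 1 := by
  set E : Matrix ι ι ℝ := diagonal (Function.update 1 i 2) with hE
  have h1 : E * transvection i j c = transvection i j c * transvection i j c * E := by
    rw [transvection_mul_transvection_same _ _ hij]
    ext a b
    rw [hE, diagonal_mul, mul_diagonal]
    simp only [transvection, Matrix.add_apply, Matrix.one_apply, Matrix.single_apply,
      Function.update_apply, Pi.one_apply]
    split_ifs <;> grind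
  have hEdet : E * diagonal (Function.update 1 i (1 / 2)) = 1 := by
    rw [hE, diagonal_mul_diagonal, ← diagonal_one]
    congr 1
    ext a
    by_cases h : a = i <;> simp [h]
  have h2 : φ E ≠ 0 := by
    intro h
    have := congrArg φ hEdet
    rw [map_mul, h, zero_mul, map_one] at this
    exact zero_ne_one this
  have h3 : φ (transvection i j c) ≠ 0 := by
    intro h
    have h4 : transvection i j c * transvection i j (-c) = (1 : Matrix ι ι ℝ) := by
      rw [transvection_mul_transvection_same _ _ hij]; simp
    have := congrArg φ h4
    rw [map_mul, h, zero_mul, map_one] at this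
    exact zero_ne_one this
  have h4 := congrArg φ h1
  simp only [map_mul] at h4
  have h5 : φ (transvection i j c) * φ E * (φ (transvection i j c) - 1) = 0 := by linarith
  rcases mul_eq_zero.1 h5 with h | h
  · exact absurd h (mul_ne_zero h3 h2)
  · linarith

/-- Diagonal matrices and transvections generate all matrices. This reduces each Jacobian below to
diagonal matrices, which act diagonally on a basis of matrix units. -/
theorem monoidHom_eq_det_pow (φ : Matrix ι ι ℝ →* ℝ) (k : ℕ)
    (hφ : ∀ D : ι → ℝ, φ (diagonal D) = (∏ i, D i) ^ k) (A : Matrix ι ι ℝ) :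
    φ A = A.det ^ k := by
  refine diagonal_transvection_induction (fun A => φ A = A.det ^ k) A ?_ ?_ ?_
  · intro D _
    rw [hφ, det_diagonal]
  · intro t
    rw [TransvectionStruct.toMatrix, monoidHom_transvection_eq_one φ t.hij, det_transvection_of_ne _ _ t.hij,
      one_pow]
  · intro A B hA hB
    rw [map_mul, hA, hB, det_mul, mul_pow]

theorem det_of_apply_basis_eq_smul {V κ : Type*} [AddCommGroup V] [Module ℝ V] [Fintype κ]
    [DecidableEq κ] (b : Module.Basis κ ℝ V) (f : V →ₗ[ℝ] V) (a : κ → ℝ)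
    (h : ∀ k, f (b k) = a k • b k) : LinearMap.det f = ∏ k, a k := by
  rw [← LinearMap.det_toMatrix b, ← det_diagonal]
  congr 1
  ext k l
  rw [LinearMap.toMatrix_apply, h, map_smul, Finsupp.smul_apply, Module.Basis.repr_self,
    Finsupp.single_apply, diagonal_apply]
  by_cases hkl : k = l
  · subst hkl; simp
  · simp [hkl, Ne.symm hkl]

/-- Left multiplication of `p × d` matrices, as a linear map on arrays. -/
def mulLeftArray (p d : ℕ) : Matrix (Fin p) (Fin p) ℝ →* ((Fin p → Fin d → ℝ) →ₗ[ℝ] Fin p → Fin d → ℝ)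
    where
  toFun A :=
    { toFun := fun B => A * (Matrix.of B)
      map_add' := fun B C => Matrix.mul_add A (Matrix.of B) (Matrix.of C)
      map_smul' := fun c B => Matrix.mul_smul A c (Matrix.of B) }
  map_one' := LinearMap.ext fun B => Matrix.one_mul (Matrix.of B)
  map_mul' A A' := LinearMap.ext fun B => Matrix.mul_assoc A A' (Matrix.of B)

/-- Right multiplication of `p × d` matrices by the transpose, as a linear map on arrays. -/
def mulRightArray (p d : ℕ) : Matrix (Fin d) (Fin d) ℝ →* ((Fin p → Fin d → ℝ) →ₗ[ℝ] Fin p → Fin d → ℝ)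
    where
  toFun A :=
    { toFun := fun B => (Matrix.of B) * Aᵀ
      map_add' := fun B C => Matrix.add_mul (Matrix.of B) (Matrix.of C) Aᵀ
      map_smul' := fun c B => Matrix.smul_mul c (Matrix.of B) Aᵀ }
  map_one' := LinearMap.ext fun B => by
    change (Matrix.of B) * (1 : Matrix (Fin d) (Fin d) ℝ)ᵀ = _
    rw [Matrix.transpose_one, Matrix.mul_one]; rfl
  map_mul' A A' := LinearMap.ext fun B => by
    change (Matrix.of B) * (A * A')ᵀ = (Matrix.of B) * A'ᵀ * Aᵀ
    rw [Matrix.transpose_mul, Matrix.mul_assoc]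

theorem det_mulLeftArray {p d : ℕ} (A : Matrix (Fin p) (Fin p) ℝ) :
    LinearMap.det (mulLeftArray p d A) = A.det ^ d := by
  refine monoidHom_eq_det_pow (LinearMap.det.comp (mulLeftArray p d)) d (fun D => ?_) A
  rw [MonoidHom.comp_apply]
  refine (det_of_apply_basis_eq_smul (V := Fin p → Fin d → ℝ)
    (Matrix.stdBasis ℝ (Fin p) (Fin d)) _ (fun k => D k.1) fun k => ?_).trans ?_
  · change (diagonal D) * (Matrix.stdBasis ℝ (Fin p) (Fin d) k) =
      D k.1 • (Matrix.stdBasis ℝ (Fin p) (Fin d) k)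
    obtain ⟨k, l⟩ := k
    rw [Matrix.stdBasis_eq_single]
    ext a b
    rw [diagonal_mul, Matrix.smul_apply, Matrix.single_apply]
    split_ifs with h
    · rw [h.1]; rfl
    · simp
  · rw [Fintype.prod_prod_type]
    simp [Finset.prod_pow]

theorem det_mulRightArray {p d : ℕ} (A : Matrix (Fin d) (Fin d) ℝ) :
    LinearMap.det (mulRightArray p d A) = A.det ^ p := by
  refine monoidHom_eq_det_pow (LinearMap.det.comp (mulRightArray p d)) p (fun D => ?_) A
  rw [MonoidHom.comp_apply]
  refine (det_of_apply_basis_eq_smul (V := Fin p → Fin d → ℝ)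
    (Matrix.stdBasis ℝ (Fin p) (Fin d)) _ (fun k => D k.2) fun k => ?_).trans ?_
  · change (Matrix.stdBasis ℝ (Fin p) (Fin d) k) * (diagonal D)ᵀ =
      D k.2 • (Matrix.stdBasis ℝ (Fin p) (Fin d) k)
    obtain ⟨k, l⟩ := k
    rw [Matrix.stdBasis_eq_single, diagonal_transpose]
    ext a b
    rw [mul_diagonal, Matrix.smul_apply, Matrix.single_apply]
    split_ifs with h
    · rw [h.2, smul_eq_mul, mul_comm]
    · simp
  · rw [Fintype.prod_prod_type]
    simp

theorem symMatrix_transpose {d : ℕ} (v : SymIndex d → ℝ) : (symMatrix v)ᵀ = symMatrix v := by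
  ext i j
  simp only [symMatrix, transpose_apply, of_apply]
  congr 2
  rw [min_comm, max_comm]

theorem symMatrix_isHermitian {d : ℕ} (v : SymIndex d → ℝ) : (symMatrix v).IsHermitian := by
  rw [IsHermitian, conjTranspose_eq_transpose_of_trivial, symMatrix_transpose]

/-- The entries on and above the diagonal of a matrix. -/
def symEntries {d : ℕ} (A : Matrix (Fin d) (Fin d) ℝ) : SymIndex d → ℝ := fun k => A k.1.1 k.1.2

theorem symMatrix_symEntries {d : ℕ} {A : Matrix (Fin d) (Fin d) ℝ} (hA : Aᵀ = A) :
    symMatrix (symEntries A) = A := by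
  ext i j
  simp only [symMatrix, symEntries, of_apply]
  rcases le_total i j with h | h
  · rw [min_eq_left h, max_eq_right h]
  · rw [min_eq_right h, max_eq_left h, ← transpose_apply A, hA]

/-- The congruence action `S ↦ A S Aᵀ` on symmetric matrices. -/
def congruenceAction (d : ℕ) :
    Matrix (Fin d) (Fin d) ℝ →* ((SymIndex d → ℝ) →ₗ[ℝ] (SymIndex d → ℝ)) where
  toFun A :=
    { toFun := fun v => symEntries (A * symMatrix v * Aᵀ)
      map_add' := fun v w => by
        have : symMatrix (v + w) = symMatrix v + symMatrix w := rfl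
        rw [this, Matrix.mul_add, Matrix.add_mul]; rfl
      map_smul' := fun c v => by
        have : symMatrix (c • v) = c • symMatrix v := rfl
        rw [this, Matrix.mul_smul, Matrix.smul_mul]; rfl }
  map_one' := LinearMap.ext fun v => by
    change symEntries (1 * symMatrix v * 1ᵀ) = v
    rw [Matrix.one_mul, Matrix.transpose_one, Matrix.mul_one]
    ext ⟨⟨i, j⟩, h⟩
    simp only [symEntries, symMatrix, of_apply]
    congr 2
    rw [min_eq_left h, max_eq_right h]
  map_mul' A B := LinearMap.ext fun v => by
    change symEntries (A * B * symMatrix v * (A * B)ᵀ) =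
      symEntries (A * symMatrix (symEntries (B * symMatrix v * Bᵀ)) * Aᵀ)
    rw [symMatrix_symEntries, transpose_mul]
    · simp only [Matrix.mul_assoc]
    · rw [transpose_mul, transpose_mul, transpose_transpose, symMatrix_transpose,
        Matrix.mul_assoc]

theorem symMatrix_congruenceAction {d : ℕ} (A : Matrix (Fin d) (Fin d) ℝ) (v : SymIndex d → ℝ) :
    symMatrix (congruenceAction d A v) = A * symMatrix v * Aᵀ :=
  symMatrix_symEntries (A := A * symMatrix v * Aᵀ) (by
    rw [transpose_mul, transpose_mul, transpose_transpose, symMatrix_transpose, Matrix.mul_assoc])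

/-- The factor D i occurs d - i times as a first and i + 1 times as a second coordinate, hence d + 1
times in all. -/
theorem prod_symIndex {d : ℕ} (D : Fin d → ℝ) :
    ∏ k : SymIndex d, (D k.1.1 * D k.1.2) = (∏ i, D i) ^ (d + 1) := by
  have h1 : ∏ k : SymIndex d, (D k.1.1 * D k.1.2) =
      ∏ q ∈ (Finset.univ : Finset (Fin d × Fin d)).filter (fun q => q.1 ≤ q.2), D q.1 * D q.2 := by
    rw [← Finset.prod_subtype (f := fun q : Fin d × Fin d => D q.1 * D q.2)]
    simp
  rw [h1, Finset.prod_mul_distrib, Finset.prod_filter, Finset.prod_filter,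
    Fintype.prod_prod_type, Fintype.prod_prod_type_right, ← Finset.prod_mul_distrib,
    ← Finset.prod_pow]
  refine Finset.prod_congr rfl fun i _ => ?_
  simp only [← Finset.prod_filter, Finset.prod_const, ← pow_add]
  congr 1
  have e1 : (Finset.univ.filter fun j : Fin d => i ≤ j) = Finset.Ici i := by ext; simp
  have e2 : (Finset.univ.filter fun j : Fin d => j ≤ i) = Finset.Iic i := by ext; simp
  rw [e1, e2, Fin.card_Ici, Fin.card_Iic]
  omega

theorem det_congruenceAction {d : ℕ} (A : Matrix (Fin d) (Fin d) ℝ) :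
    LinearMap.det (congruenceAction d A) = A.det ^ (d + 1) := by
  refine monoidHom_eq_det_pow (LinearMap.det.comp (congruenceAction d)) (d + 1) (fun D => ?_) A
  rw [MonoidHom.comp_apply, ← prod_symIndex]
  refine det_of_apply_basis_eq_smul (Pi.basisFun ℝ (SymIndex d)) _ _ fun k => ?_
  ext l
  change (diagonal D * symMatrix (Pi.basisFun ℝ (SymIndex d) k) * (diagonal D)ᵀ) l.1.1 l.1.2 = _
  rw [diagonal_transpose, mul_diagonal, diagonal_mul, Pi.smul_apply, Pi.basisFun_apply]
  have h1 : symMatrix (Pi.single k (1 : ℝ)) l.1.1 l.1.2 = (Pi.single k (1 : ℝ) : SymIndex d → ℝ) l := by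
    simp only [symMatrix, of_apply]
    congr 2
    rw [min_eq_left l.2, max_eq_right l.2]
  rw [h1, smul_eq_mul]
  by_cases h : l = k
  · subst h; ring
  · simp [h]

/-- Linear change of variables in a Lebesgue integral. -/
theorem lintegral_comp_linearMap {V : Type*} [NormedAddCommGroup V] [NormedSpace ℝ V]
    [MeasurableSpace V] [BorelSpace V] [FiniteDimensional ℝ V] (μ : Measure V)
    [μ.IsAddHaarMeasure] {f : V →ₗ[ℝ] V} (hf : LinearMap.det f ≠ 0) (g : V → ENNReal) :
    ∫⁻ x, g x ∂μ = ENNReal.ofReal |LinearMap.det f| * ∫⁻ x, g (f x) ∂μ := by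
  have hemb : MeasurableEmbedding f :=
    (LinearEquiv.ofIsUnitDet (v := Module.finBasis ℝ V) (v' := Module.finBasis ℝ V) (f := f) (by
      rw [LinearMap.det_toMatrix]; exact hf.isUnit)).toContinuousLinearEquiv.toHomeomorph.measurableEmbedding
  rw [← hemb.lintegral_map, Measure.map_linearMap_addHaar_eq_smul_addHaar μ hf,
    lintegral_smul_measure, smul_eq_mul, ← mul_assoc, ← ENNReal.ofReal_mul (abs_nonneg _), abs_inv,
    mul_inv_cancel₀ (abs_ne_zero.2 hf), ENNReal.ofReal_one, one_mul]

end DetAction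


/-! ### Decay of exp(-c/u) at the origin -/

section ExpDecay

open Filter Topology Asymptotics

/-- The inversion u ↦ 1/u carries the decay of exp(-c u) at infinity to the origin. -/
theorem exp_neg_div_isBigO_nhdsGT_zero {c : ℝ} (hc : 0 < c) (b : ℝ) :
    (fun u : ℝ => Real.exp (-(c / u))) =O[𝓝[>] 0] fun u => u ^ b := by
  have h := (isLittleO_exp_neg_mul_rpow_atTop hc (-b)).isBigO.comp_tendsto
    (tendsto_inv_nhdsGT_zero (𝕜 := ℝ))
  refine h.congr' ?_ ?_
  · filter_upwards with u
    simp [div_eq_mul_inv]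
  · filter_upwards [self_mem_nhdsWithin] with u (hu : 0 < u)
    simp [Real.inv_rpow hu.le, Real.rpow_neg hu.le]

theorem integrableOn_rpow_mul_exp_neg_div {s c : ℝ} (hs : s < -1) (hc : 0 < c) :
    IntegrableOn (fun u : ℝ => u ^ s * Real.exp (-(c / u))) (Ioi 0) := by
  have h := mellin_convergent_of_isBigO_scalar (a := 0) (b := s) (s := s + 1)
    (f := fun u : ℝ => Real.exp (-(c / u))) ?_ ?_ (by linarith)
    (exp_neg_div_isBigO_nhdsGT_zero hc _) (by linarith)
  · simpa using h
  · refine ContinuousOn.locallyIntegrableOn ?_ measurableSet_Ioi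
    exact Real.continuous_exp.comp_continuousOn
      (continuousOn_const.div continuousOn_id fun u hu => (ne_of_gt hu)).neg
  · refine IsBigO.of_bound 1 ?_
    filter_upwards [eventually_gt_atTop 0] with u hu
    rw [neg_zero, Real.rpow_zero, Real.norm_eq_abs, Real.abs_exp, norm_one, mul_one,
      Real.exp_le_one_iff]
    have : 0 < c / u := by positivity
    linarith

end ExpDecay

/-! ### Gaussian integrals over rectangular matrices -/

section Gaussian

open Matrix

theorem lintegral_ofReal_ne_zero {E : Type*} [MeasurableSpace E] {μ : Measure E} {s : Set E}
    (hs : MeasurableSet s) (hμ : μ s ≠ 0) {f : E → ℝ} (hf : Measurable f)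
    (hpos : ∀ x ∈ s, 0 < f x) : ∫⁻ x in s, ENNReal.ofReal (f x) ∂μ ≠ 0 := by
  rw [Ne, setLIntegral_eq_zero_iff hs (by fun_prop)]
  intro h
  refine hμ (measure_mono_null (fun x hx => ?_) h)
  simpa [hx] using hpos x hx

open scoped MatrixOrder in
theorem Matrix.PosSemidef.exists_eq_transpose_mul_self {ι : Type*} [Fintype ι] [DecidableEq ι]
    {A : Matrix ι ι ℝ} (hA : A.PosSemidef) : ∃ B : Matrix ι ι ℝ, A = Bᵀ * B := by
  obtain ⟨B, hB⟩ := CStarAlgebra.nonneg_iff_eq_star_mul_self.mp hA.nonneg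
  exact ⟨B, by rw [hB, star_eq_conjTranspose, conjTranspose_eq_transpose_of_trivial]⟩

theorem trace_mul_transpose_self {m n : Type*} [Fintype m] [Fintype n] (B : Matrix m n ℝ) :
    (B * Bᵀ).trace = ∑ i, ∑ j, B i j ^ 2 := by
  simp [trace, mul_apply, sq]

/-- The Gaussian integral over `p × d` matrices. -/
def gaussianConst (p d : ℕ) : ENNReal :=
  ∫⁻ B : Fin p → Fin d → ℝ, ENNReal.ofReal (Real.exp (-(1 / 2) * (of B * (of B)ᵀ).trace))

theorem gaussianConst_ne_zero (p d : ℕ) : gaussianConst p d ≠ 0 := by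
  unfold gaussianConst
  rw [← setLIntegral_univ]
  refine lintegral_ofReal_ne_zero MeasurableSet.univ ?_ ?_ fun x _ => Real.exp_pos _
  · exact (isOpen_univ.measure_pos _ univ_nonempty).ne'
  · simp only [trace_mul_transpose_self, of_apply]
    fun_prop

theorem gaussianConst_ne_top (p d : ℕ) : gaussianConst p d ≠ ⊤ := by
  have h0 : Integrable (fun x : ℝ => Real.exp (-(1 / 2) * x ^ 2)) :=
    integrable_exp_neg_mul_sq (by norm_num)
  have h1 : Integrable (fun b : Fin d → ℝ => ∏ j, Real.exp (-(1 / 2) * b j ^ 2)) :=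
    Integrable.fintype_prod fun _ => h0
  have h2 : Integrable (fun B : Fin p → Fin d → ℝ => ∏ i, ∏ j, Real.exp (-(1 / 2) * B i j ^ 2)) :=
    Integrable.fintype_prod fun _ => h1
  refine ((lintegral_congr fun B => ?_).trans_lt h2.lintegral_lt_top).ne
  simp only [trace_mul_transpose_self, of_apply, Finset.mul_sum, Real.exp_sum]

/-- After translating M away, factor A = PᵀP and S = QᵀQ; the substitution B ↦ P B Qᵀ reduces to the
standard Gaussian, with Jacobian |P|^d |Q|^p. -/
theorem lintegral_matrixGaussian {p d : ℕ} {A : Matrix (Fin p) (Fin p) ℝ}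
    {S : Matrix (Fin d) (Fin d) ℝ} (hA : A.PosDef) (hS : S.PosDef) (M : Matrix (Fin p) (Fin d) ℝ) :
    ∫⁻ B : Fin p → Fin d → ℝ,
        ENNReal.ofReal (Real.exp (-(1 / 2) * (A * (of B - M) * S * (of B - M)ᵀ).trace)) =
      ENNReal.ofReal (A.det ^ (-(d : ℝ) / 2) * S.det ^ (-(p : ℝ) / 2)) * gaussianConst p d := by
  obtain ⟨P, rfl⟩ := hA.posSemidef.exists_eq_transpose_mul_self
  obtain ⟨Q, rfl⟩ := hS.posSemidef.exists_eq_transpose_mul_self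
  have hP : 0 < |P.det| := by
    have := hA.det_pos
    rw [det_mul, det_transpose] at this
    exact abs_pos.2 fun h => by simp [h] at this
  have hQ : 0 < |Q.det| := by
    have := hS.det_pos
    rw [det_mul, det_transpose] at this
    exact abs_pos.2 fun h => by simp [h] at this
  have h1 : ∫⁻ B : Fin p → Fin d → ℝ,
        ENNReal.ofReal (Real.exp (-(1 / 2) * (Pᵀ * P * (of B - M) * (Qᵀ * Q) * (of B - M)ᵀ).trace)) =
      ∫⁻ B : Fin p → Fin d → ℝ,
        ENNReal.ofReal (Real.exp (-(1 / 2) * (Pᵀ * P * of B * (Qᵀ * Q) * (of B)ᵀ).trace)) :=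
    lintegral_sub_right_eq_self (μ := (volume : Measure (Fin p → Fin d → ℝ)))
      (fun B => ENNReal.ofReal (Real.exp (-(1 / 2) * (Pᵀ * P * of B * (Qᵀ * Q) * (of B)ᵀ).trace))) (of.symm M)
  set f := mulLeftArray p d P * mulRightArray p d Q with hf
  have hdet : LinearMap.det f = P.det ^ d * Q.det ^ p := by
    rw [hf, map_mul, det_mulLeftArray, det_mulRightArray]
  have hdet0 : LinearMap.det f ≠ 0 := by
    rw [hdet]
    exact mul_ne_zero (pow_ne_zero _ (abs_pos.1 hP)) (pow_ne_zero _ (abs_pos.1 hQ))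
  have h2 : ∀ B, Real.exp (-(1 / 2) * (Pᵀ * P * of B * (Qᵀ * Q) * (of B)ᵀ).trace) =
      Real.exp (-(1 / 2) * (of (f B) * (of (f B))ᵀ).trace) := by
    intro B
    have h3 : of (f B) = P * (of B * Qᵀ) := rfl
    rw [h3, transpose_mul, transpose_mul, transpose_transpose]
    simp only [Matrix.mul_assoc]
    rw [trace_mul_comm]
    simp only [Matrix.mul_assoc]
  rw [h1, gaussianConst, lintegral_comp_linearMap volume hdet0
    (fun B => ENNReal.ofReal (Real.exp (-(1 / 2) * (of B * (of B)ᵀ).trace))), ← mul_assoc, ← ENNReal.ofReal_mul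
    (mul_nonneg (Real.rpow_nonneg hA.det_pos.le _) (Real.rpow_nonneg hS.det_pos.le _)), hdet, abs_mul, abs_pow, abs_pow]
  simp only [h2]
  have h4 : (Pᵀ * P).det ^ (-(d : ℝ) / 2) * (Qᵀ * Q).det ^ (-(p : ℝ) / 2) *
      (|P.det| ^ d * |Q.det| ^ p) = 1 := by
    rw [det_mul, det_mul, det_transpose, det_transpose, ← sq, ← sq, ← sq_abs P.det,
      ← sq_abs Q.det, ← Real.rpow_natCast, ← Real.rpow_natCast, ← Real.rpow_natCast,
      ← Real.rpow_natCast, ← Real.rpow_mul hP.le, ← Real.rpow_mul hQ.le, mul_mul_mul_comm,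
      ← Real.rpow_add hP, ← Real.rpow_add hQ]
    push_cast
    ring_nf
    simp
  rw [h4, ENNReal.ofReal_one, one_mul]

end Gaussian


/-! ### Inverse Wishart integrals: reduction to the identity parameter -/

section InverseWishart

open Matrix

/-- The arrays of entries of positive definite matrices. -/
def posDefEntries (d : ℕ) : Set (SymIndex d → ℝ) := {v | (symMatrix v).PosDef}

theorem continuous_symMatrix (d : ℕ) : Continuous (symMatrix : (SymIndex d → ℝ) → _) := by
  refine continuous_matrix fun i j => ?_
  simp only [symMatrix, of_apply]
  fun_prop

theorem continuous_det_symMatrix (d : ℕ) :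
    Continuous fun v : SymIndex d → ℝ => (symMatrix v).det :=
  (continuous_symMatrix d).matrix_det

theorem measurable_inv_symMatrix_apply {d : ℕ} (i j : Fin d) :
    Measurable fun v : SymIndex d → ℝ => (symMatrix v)⁻¹ i j := by
  simp only [Matrix.inv_def, Ring.inverse_eq_inv', Matrix.smul_apply, smul_eq_mul]
  exact (continuous_det_symMatrix d).measurable.inv.mul
    ((continuous_symMatrix d).matrix_adjugate.matrix_elem i j).measurable

theorem measurable_trace_mul_inv_symMatrix {d : ℕ} (A : Matrix (Fin d) (Fin d) ℝ) :
    Measurable fun v : SymIndex d → ℝ => (A * (symMatrix v)⁻¹).trace := by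
  simp only [trace, diag_apply, mul_apply]
  exact Finset.measurable_sum _ fun i _ => Finset.measurable_sum _ fun j _ =>
    (measurable_inv_symMatrix_apply j i).const_mul _

theorem measurableSet_posDefEntries (d : ℕ) : MeasurableSet (posDefEntries d) := by
  -- Positive definite means positive semidefinite (a closed condition) and invertible (an open
  -- one).
  have h : posDefEntries d = {v | ∀ x : Fin d → ℝ, 0 ≤ x ⬝ᵥ symMatrix v *ᵥ x} ∩
      {v | (symMatrix v).det ≠ 0} := by
    ext v
    constructor
    · intro hv
      have hv' : (symMatrix v).PosDef := hv
      exact ⟨fun x => by simpa using hv'.posSemidef.dotProduct_mulVec_nonneg x, hv'.det_pos.ne'⟩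
    · rintro ⟨h1, h2⟩
      have h3 : (symMatrix v).PosSemidef :=
        .of_dotProduct_mulVec_nonneg (symMatrix_isHermitian v) fun x => by simpa using h1 x
      exact h3.posDef_iff_det_ne_zero.2 h2
  rw [h]
  refine MeasurableSet.inter (IsClosed.measurableSet ?_) (IsOpen.measurableSet ?_)
  · rw [Set.ofPred_forall]
    refine isClosed_iInter fun x => isClosed_le continuous_const ?_
    exact continuous_const.dotProduct ((continuous_symMatrix d).matrix_mulVec continuous_const)
  · exact isOpen_ne_fun (continuous_det_symMatrix d) continuous_const

/-- The unnormalized inverse Wishart density. -/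
def invWishartKernel {d : ℕ} (κ : ℝ) (A : Matrix (Fin d) (Fin d) ℝ) (v : SymIndex d → ℝ) : ℝ :=
  (symMatrix v).det ^ (-κ) * Real.exp (-(1 / 2) * (A * (symMatrix v)⁻¹).trace)

theorem measurable_invWishartKernel {d : ℕ} (κ : ℝ) (A : Matrix (Fin d) (Fin d) ℝ) :
    Measurable (invWishartKernel κ A) :=
  ((continuous_det_symMatrix d).measurable.pow_const _).mul
    ((measurable_trace_mul_inv_symMatrix A).const_mul _).exp

/-- With A = BᵀB, the congruence W ↦ BᵀWB preserves the cone and turns tr(A W⁻¹) into tr(W⁻¹). The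
determinant contributes |B|^(-2κ) and the Jacobian |B|^(d+1). -/
theorem lintegral_invWishartKernel {d : ℕ} (κ : ℝ) {A : Matrix (Fin d) (Fin d) ℝ} (hA : A.PosDef) :
    ∫⁻ v in posDefEntries d, ENNReal.ofReal (invWishartKernel κ A v) =
      ENNReal.ofReal (A.det ^ (-(κ - (d + 1) / 2))) *
        ∫⁻ v in posDefEntries d, ENNReal.ofReal (invWishartKernel κ 1 v) := by
  obtain ⟨B, rfl⟩ := hA.posSemidef.exists_eq_transpose_mul_self
  have hB0 : B.det ≠ 0 := fun h => by
    have := hA.det_pos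
    rw [det_mul, h, mul_zero] at this
    exact lt_irrefl _ this
  have hB : 0 < |B.det| := abs_pos.2 hB0
  have hBu : IsUnit B.det := hB0.isUnit
  rw [← lintegral_indicator (measurableSet_posDefEntries d),
    ← lintegral_indicator (measurableSet_posDefEntries d)]
  have hdet : LinearMap.det (congruenceAction d Bᵀ) = B.det ^ (d + 1) := by
    rw [det_congruenceAction, det_transpose]
  rw [lintegral_comp_linearMap volume (f := congruenceAction d Bᵀ) (by
    rw [hdet]; exact pow_ne_zero _ hB0), hdet, abs_pow]
  have key : ∀ v, (posDefEntries d).indicator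
      (fun v => ENNReal.ofReal (invWishartKernel κ (Bᵀ * B) v)) (congruenceAction d Bᵀ v) =
      ENNReal.ofReal (|B.det| ^ (-(2 * κ))) *
        (posDefEntries d).indicator (fun v => ENNReal.ofReal (invWishartKernel κ 1 v)) v := by
    intro v
    have hiff : congruenceAction d Bᵀ v ∈ posDefEntries d ↔ v ∈ posDefEntries d := by
      change (symMatrix _).PosDef ↔ (symMatrix v).PosDef
      rw [symMatrix_congruenceAction, transpose_transpose]
      have := Matrix.IsUnit.posDef_star_left_conjugate_iff (x := symMatrix v)
        ((Matrix.isUnit_iff_isUnit_det B).2 hBu)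
      rwa [star_eq_conjTranspose, conjTranspose_eq_transpose_of_trivial] at this
    by_cases hv : v ∈ posDefEntries d
    · rw [indicator_of_mem hv, indicator_of_mem (hiff.2 hv), ← ENNReal.ofReal_mul (by positivity)]
      congr 1
      have hv' : (symMatrix v).PosDef := hv
      have htr : (Bᵀ * B * (Bᵀ * symMatrix v * B)⁻¹).trace = ((symMatrix v)⁻¹).trace := by
        rw [Matrix.mul_inv_rev, Matrix.mul_inv_rev, Matrix.mul_assoc, mul_nonsing_inv_cancel_left _ _ hBu,
          trace_mul_comm, Matrix.mul_assoc, nonsing_inv_mul _ (by rwa [det_transpose]),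
          Matrix.mul_one]
      unfold invWishartKernel
      rw [symMatrix_congruenceAction, transpose_transpose, htr, Matrix.one_mul, det_mul, det_mul,
        det_transpose, ← mul_assoc]
      congr 1
      rw [show B.det * (symMatrix v).det * B.det = |B.det| ^ (2 : ℝ) * (symMatrix v).det by
        rw [Real.rpow_two, sq_abs]; ring, Real.mul_rpow (by positivity) hv'.det_pos.le,
        ← Real.rpow_mul hB.le, mul_neg]
    · rw [indicator_of_notMem hv, indicator_of_notMem (fun h => hv (hiff.1 h)), mul_zero]
  simp only [key]
  rw [lintegral_const_mul' _ _ ENNReal.ofReal_ne_top, ← mul_assoc, ← ENNReal.ofReal_mul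
    (by positivity)]
  congr 2
  rw [det_mul, det_transpose, ← sq, ← sq_abs, ← Real.rpow_natCast, ← Real.rpow_natCast,
    ← Real.rpow_mul hB.le, ← Real.rpow_add hB]
  congr 1
  push_cast
  ring

/-- The integral of `s ^ (-κ) exp (- (1 + |c|²) / (2 s))` over `s > 0` and `c ∈ ℝᵈ`. -/
def invWishartStepConst (d : ℕ) (κ : ℝ) : ENNReal :=
  ∫⁻ c : Fin d → ℝ, ∫⁻ s in Ioi (0 : ℝ),
    ENNReal.ofReal (s ^ (-κ) * Real.exp (-(1 / 2) * (s⁻¹ + s⁻¹ * ∑ j, c j ^ 2)))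

theorem measurable_stepIntegrand (d : ℕ) (κ : ℝ) :
    Measurable fun q : (Fin d → ℝ) × ℝ =>
      q.2 ^ (-κ) * Real.exp (-(1 / 2) * (q.2⁻¹ + q.2⁻¹ * ∑ j, q.1 j ^ 2)) := by
  fun_prop

theorem invWishartStepConst_ne_zero (d : ℕ) (κ : ℝ) : invWishartStepConst d κ ≠ 0 := by
  unfold invWishartStepConst
  have h := lintegral_prod (μ := (volume : Measure (Fin d → ℝ)).restrict univ)
    (ν := volume.restrict (Ioi (0 : ℝ))) _
    (measurable_stepIntegrand d κ).ennreal_ofReal.aemeasurable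
  rw [Measure.prod_restrict, setLIntegral_univ] at h
  rw [← h]
  refine lintegral_ofReal_ne_zero (MeasurableSet.univ.prod measurableSet_Ioi) ?_
    (measurable_stepIntegrand d κ) fun q hq => ?_
  · rw [Measure.prod_prod, Real.volume_Ioi]
    refine mul_ne_zero (isOpen_univ.measure_pos _ univ_nonempty).ne' (by simp)
  · have : 0 < q.2 := hq.2
    positivity

/-- Integrating over c first gives (2πs)^(d/2) and leaves an inverse gamma integral in s, whose
power -κ + d/2 is below -1. -/
theorem invWishartStepConst_ne_top {d : ℕ} {κ : ℝ} (hκ : (d : ℝ) + 1 < κ) :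
    invWishartStepConst d κ ≠ ⊤ := by
  unfold invWishartStepConst
  rw [lintegral_lintegral_swap (measurable_stepIntegrand d κ).ennreal_ofReal.aemeasurable]
  have h1 : ∀ s ∈ Ioi (0 : ℝ), ∫⁻ c : Fin d → ℝ,
      ENNReal.ofReal (s ^ (-κ) * Real.exp (-(1 / 2) * (s⁻¹ + s⁻¹ * ∑ j, c j ^ 2))) =
      ENNReal.ofReal ((2 * Real.pi) ^ ((d : ℝ) / 2) *
        (s ^ (-κ + (d : ℝ) / 2) * Real.exp (-((1 / 2) / s)))) := by
    intro s (hs : 0 < s)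
    have h2 : ∀ c : Fin d → ℝ, s ^ (-κ) * Real.exp (-(1 / 2) * (s⁻¹ + s⁻¹ * ∑ j, c j ^ 2)) =
        s ^ (-κ) * Real.exp (-((1 / 2) / s)) * ∏ j, Real.exp (-(1 / (2 * s)) * c j ^ 2) := by
      intro c
      rw [← Real.exp_sum, mul_assoc, ← Real.exp_add, ← Finset.mul_sum]
      congr 2
      field_simp
      ring
    have h3 : Integrable fun x : ℝ => Real.exp (-(1 / (2 * s)) * x ^ 2) :=
      integrable_exp_neg_mul_sq (by positivity)
    have h4 : Integrable (fun c : Fin d → ℝ => ∏ j, Real.exp (-(1 / (2 * s)) * c j ^ 2)) :=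
      Integrable.fintype_prod fun _ => h3
    simp only [h2]
    rw [← ofReal_integral_eq_lintegral_ofReal (h4.const_mul _)
      (.of_forall fun c => by positivity), integral_const_mul,
      integral_fintype_prod_volume_eq_pow (fun x : ℝ => Real.exp (-(1 / (2 * s)) * x ^ 2)),
      integral_gaussian, Fintype.card_fin]
    congr 1
    rw [show Real.pi / (1 / (2 * s)) = 2 * Real.pi * s by field_simp, Real.sqrt_eq_rpow,
      ← Real.rpow_natCast, ← Real.rpow_mul (by positivity),
      Real.mul_rpow (by positivity) hs.le, Real.rpow_add hs]
    ring_nf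
  rw [setLIntegral_congr_fun measurableSet_Ioi h1]
  exact ((integrableOn_rpow_mul_exp_neg_div (by
    have : (0 : ℝ) ≤ d := Nat.cast_nonneg d
    linarith) (by norm_num)).const_mul _).lintegral_lt_top.ne

end InverseWishart


/-! ### Inverse Wishart integrals: induction on the size by bordering -/

section InverseWishartInduction

open Matrix

/-- The matrix with Schur complement `s`, parametrized so that its factorization is explicit. -/
def schurBlock {d : ℕ} (W : Matrix (Fin d) (Fin d) ℝ) (C : Matrix (Fin d) Unit ℝ) (s : ℝ) :
    Matrix (Fin d ⊕ Unit) (Fin d ⊕ Unit) ℝ :=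
  fromBlocks W (W * C) (W * C)ᵀ (Cᵀ * W * C + s • 1)

variable {d : ℕ} {W : Matrix (Fin d) (Fin d) ℝ} {C : Matrix (Fin d) Unit ℝ} {s : ℝ}

theorem schurComplement_schurBlock (hW : IsUnit W.det) (hsymm : Wᵀ = W) :
    (Cᵀ * W * C + s • 1) - (W * C)ᵀ * W⁻¹ * (W * C) = s • (1 : Matrix Unit Unit ℝ) := by
  rw [transpose_mul, hsymm, mul_nonsing_inv_cancel_right _ _ hW, Matrix.mul_assoc,
    add_sub_cancel_left]

theorem det_schurBlock (hW : IsUnit W.det) (hsymm : Wᵀ = W) :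
    (schurBlock W C s).det = s * W.det := by
  have := W.invertibleOfIsUnitDet hW
  rw [schurBlock, det_fromBlocks₁₁, invOf_eq_nonsing_inv, schurComplement_schurBlock hW hsymm]
  simp [mul_comm]

theorem inv_schurBlock (hW : IsUnit W.det) (hsymm : Wᵀ = W) (hs : s ≠ 0) :
    (schurBlock W C s)⁻¹ =
      fromBlocks (W⁻¹ + s⁻¹ • (C * Cᵀ)) (-(s⁻¹ • C)) (-(s⁻¹ • Cᵀ)) (s⁻¹ • 1) := by
  refine inv_eq_right_inv ?_
  rw [schurBlock, fromBlocks_multiply, ← fromBlocks_one, transpose_mul, hsymm]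
  congr 1
  · rw [Matrix.mul_add, mul_nonsing_inv _ hW]
    simp [Matrix.mul_assoc]
  · simp
  · rw [Matrix.mul_add, mul_nonsing_inv_cancel_right _ _ hW]
    simp [Matrix.mul_assoc, Matrix.add_mul, smul_smul, hs]
    abel
  · simp [smul_smul, hs, Matrix.mul_assoc]

theorem trace_inv_schurBlock (hW : IsUnit W.det) (hsymm : Wᵀ = W) (hs : s ≠ 0) :
    (schurBlock W C s)⁻¹.trace = (W⁻¹).trace + (s⁻¹ + s⁻¹ * ∑ j, C j () ^ 2) := by
  have h : ∀ (P : Matrix (Fin d) (Fin d) ℝ) (Q : Matrix (Fin d) Unit ℝ) (R : Matrix Unit (Fin d) ℝ)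
      (S : Matrix Unit Unit ℝ), (fromBlocks P Q R S).trace = P.trace + S.trace := fun P Q R S => by
    simp [trace, Fintype.sum_sum_type]
  rw [inv_schurBlock hW hsymm hs, h, trace_add, trace_smul, trace_mul_transpose_self, trace_smul]
  simp
  ring

theorem posDef_schurBlock_iff (hW : W.PosDef) : (schurBlock W C s).PosDef ↔ 0 < s := by
  have hsymm : Wᵀ = W := by
    have := hW.isHermitian
    rwa [IsHermitian, conjTranspose_eq_transpose_of_trivial] at this
  have hu : IsUnit W.det := hW.det_pos.ne'.isUnit
  have := W.invertibleOfIsUnitDet hu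
  constructor
  · intro h
    have h1 := h.det_pos
    rw [det_schurBlock hu hsymm] at h1
    exact pos_of_mul_pos_left h1 hW.det_pos.le
  · intro hs
    have h1 : (schurBlock W C s).PosSemidef := by
      rw [schurBlock, ← conjTranspose_eq_transpose_of_trivial (W * C),
        PosDef.fromBlocks₁₁ (W * C) _ hW, conjTranspose_eq_transpose_of_trivial,
        schurComplement_schurBlock hu hsymm]
      exact PosSemidef.one.smul hs.le
    refine h1.posDef_iff_det_ne_zero.2 ?_
    rw [det_schurBlock hu hsymm]
    exact mul_ne_zero hs.ne' hW.det_pos.ne'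

/-- The free entries of a symmetric matrix of size `d + 1`: the corner, the rest of the first row,
and the free entries of the remaining block. -/
def symIndexSuccEquiv (d : ℕ) : Unit ⊕ (Fin d ⊕ SymIndex d) ≃ SymIndex (d + 1) :=
  Equiv.ofBijective
    (Sum.elim (fun _ => ⟨(0, 0), le_rfl⟩) (Sum.elim (fun j => ⟨(0, j.succ), Fin.zero_le _⟩)
      fun k => ⟨(k.1.1.succ, k.1.2.succ), Fin.succ_le_succ_iff.2 k.2⟩)) (by
    constructor
    · rintro (x | x | ⟨⟨i, j⟩, h⟩) (x' | x' | ⟨⟨i', j'⟩, h'⟩) <;>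
        simp [Subtype.ext_iff, Prod.ext_iff, Fin.ext_iff]
    · rintro ⟨⟨i, j⟩, h⟩
      refine Fin.cases (fun h => ?_) (fun i h => ?_) i h
      · refine Fin.cases (fun _ => ?_) (fun j _ => ?_) j h
        · exact ⟨Sum.inl (), rfl⟩
        · exact ⟨Sum.inr (Sum.inl j), rfl⟩
      · revert h
        refine Fin.cases (fun h => ?_) (fun j h => ?_) j
        · exact absurd h (by simp)
        · exact ⟨Sum.inr (Sum.inr ⟨(i, j), Fin.succ_le_succ_iff.1 h⟩), rfl⟩)

/-- Assemble the entries of a symmetric matrix of size `d + 1`. -/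
def borderEntries (d : ℕ) (q : ℝ × (Fin d → ℝ) × (SymIndex d → ℝ)) : SymIndex (d + 1) → ℝ :=
  fun k => Sum.elim (fun _ => q.1) (Sum.elim q.2.1 q.2.2) ((symIndexSuccEquiv d).symm k)

theorem measurePreserving_borderEntries (d : ℕ) : MeasurePreserving (borderEntries d) := by
  have h1 := (volume_preserving_funUnique Unit ℝ).symm _
  have h2 := volume_measurePreserving_sumPiEquivProdPi_symm (fun _ : Fin d ⊕ SymIndex d => ℝ)
  have h3 := volume_measurePreserving_sumPiEquivProdPi_symm
    (fun _ : Unit ⊕ (Fin d ⊕ SymIndex d) => ℝ)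
  have h4 := volume_measurePreserving_piCongrLeft (fun _ : SymIndex (d + 1) => ℝ)
    (symIndexSuccEquiv d)
  have h5 := h4.comp (h3.comp (h1.prod h2))
  convert! h5 using 1
  ext q k
  obtain ⟨k, rfl⟩ := (symIndexSuccEquiv d).surjective k
  simp only [borderEntries, Equiv.symm_apply_apply, Function.comp_apply,
    MeasurableEquiv.coe_piCongrLeft]
  rw [Equiv.piCongrLeft_apply_apply]
  rcases k with k | k | k <;> rfl

theorem submatrix_symMatrix_borderEntries (a : ℝ) (b : Fin d → ℝ) (v : SymIndex d → ℝ) :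
    (symMatrix (borderEntries d (a, b, v))).submatrix (Sum.elim Fin.succ fun _ => 0)
      (Sum.elim Fin.succ fun _ => 0) =
      fromBlocks (symMatrix v) (replicateCol Unit b) (replicateCol Unit b)ᵀ (a • 1) := by
  have e1 : (symIndexSuccEquiv d).symm ⟨(0, 0), le_rfl⟩ = Sum.inl () :=
    (symIndexSuccEquiv d).symm_apply_apply (Sum.inl ())
  have e2 : ∀ j : Fin d, (symIndexSuccEquiv d).symm ⟨(0, j.succ), Fin.zero_le _⟩ =
      Sum.inr (Sum.inl j) :=
    fun j => (symIndexSuccEquiv d).symm_apply_apply (Sum.inr (Sum.inl j))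
  have e3 : ∀ k : SymIndex d, (symIndexSuccEquiv d).symm
      ⟨(k.1.1.succ, k.1.2.succ), Fin.succ_le_succ_iff.2 k.2⟩ = Sum.inr (Sum.inr k) :=
    fun k => (symIndexSuccEquiv d).symm_apply_apply (Sum.inr (Sum.inr k))
  have hval : ∀ (k k' : SymIndex (d + 1)), k.1 = k'.1 →
      borderEntries d (a, b, v) k = borderEntries d (a, b, v) k' :=
    fun k k' h => by rw [Subtype.ext h]
  ext (i | i) (j | j)
  · simp only [submatrix_apply, Sum.elim_inl, fromBlocks_apply₁₁, symMatrix, of_apply]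
    rw [hval _ ⟨((min i j).succ, (max i j).succ), Fin.succ_le_succ_iff.2 min_le_max⟩]
    · exact congrArg (Sum.elim (fun _ => a) (Sum.elim b v)) (e3 ⟨(min i j, max i j), min_le_max⟩)
    · have hmono : Monotone (Fin.succ : Fin d → Fin (d + 1)) := (Fin.strictMono_succ).monotone
      exact Prod.ext hmono.map_min.symm hmono.map_max.symm
  · simp only [submatrix_apply, Sum.elim_inl, Sum.elim_inr, fromBlocks_apply₁₂, symMatrix, of_apply,
      replicateCol_apply]
    rw [hval _ ⟨(0, i.succ), Fin.zero_le _⟩ (by simp)]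
    exact congrArg (Sum.elim (fun _ => a) (Sum.elim b v)) (e2 i)
  · simp only [submatrix_apply, Sum.elim_inl, Sum.elim_inr, fromBlocks_apply₂₁, symMatrix, of_apply,
      replicateCol_apply, transpose_apply]
    rw [hval _ ⟨(0, j.succ), Fin.zero_le _⟩ (by simp)]
    exact congrArg (Sum.elim (fun _ => a) (Sum.elim b v)) (e2 j)
  · simp only [submatrix_apply, Sum.elim_inr, fromBlocks_apply₂₂, symMatrix, of_apply]
    rw [hval _ ⟨(0, 0), le_rfl⟩ (by simp)]
    exact (congrArg (Sum.elim (fun _ => a) (Sum.elim b v)) e1).trans (by simp)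

/-- The reindexing that turns a bordered matrix into a block matrix. -/
def borderEquiv (d : ℕ) : Fin d ⊕ Unit ≃ Fin (d + 1) :=
  Equiv.ofBijective (Sum.elim Fin.succ fun _ => 0) (by
    constructor
    · rintro (i | i) (j | j) <;> simp [Fin.ext_iff]
    · intro i
      refine Fin.cases ⟨Sum.inr (), rfl⟩ (fun i => ⟨Sum.inl i, rfl⟩) i)

/-- With border Wc and corner s + cᵀWc, the Schur complement of W is s. In the coordinates (s, c, W)
the determinant, the trace of the inverse and positive definiteness all separate. -/
theorem submatrix_symMatrix_border_schur (c : Fin d → ℝ) (v : SymIndex d → ℝ) :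
    (symMatrix (borderEntries d (s + c ⬝ᵥ symMatrix v *ᵥ c, symMatrix v *ᵥ c, v))).submatrix
      (borderEquiv d) (borderEquiv d) = schurBlock (symMatrix v) (replicateCol Unit c) s := by
  refine (submatrix_symMatrix_borderEntries _ _ v).trans ?_
  rw [schurBlock, replicateCol_mulVec]
  congr 1
  ext i j
  simp [add_comm s, Matrix.mul_assoc, mul_apply, dotProduct, mulVec]

theorem invWishartKernel_border (κ : ℝ) {v : SymIndex d → ℝ} (hv : v ∈ posDefEntries d)
    (c : Fin d → ℝ) :
    (posDefEntries (d + 1)).indicator (fun v => ENNReal.ofReal (invWishartKernel κ 1 v))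
      (borderEntries d (s + c ⬝ᵥ symMatrix v *ᵥ c, symMatrix v *ᵥ c, v)) =
    ENNReal.ofReal (invWishartKernel κ 1 v) * (Ioi (0 : ℝ)).indicator (fun s =>
      ENNReal.ofReal (s ^ (-κ) * Real.exp (-(1 / 2) * (s⁻¹ + s⁻¹ * ∑ j, c j ^ 2)))) s := by
  have hW : (symMatrix v).PosDef := hv
  have hu : IsUnit (symMatrix v).det := hW.det_pos.ne'.isUnit
  set w := borderEntries d (s + c ⬝ᵥ symMatrix v *ᵥ c, symMatrix v *ᵥ c, v) with hw
  have hsub : (symMatrix w).submatrix (borderEquiv d) (borderEquiv d) =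
      schurBlock (symMatrix v) (replicateCol Unit c) s := submatrix_symMatrix_border_schur c v
  have hiff : w ∈ posDefEntries (d + 1) ↔ 0 < s := by
    rw [← posDef_schurBlock_iff hW (C := replicateCol Unit c), ← hsub]
    refine ⟨fun h => h.submatrix (borderEquiv d).injective, fun h => ?_⟩
    have h2 := h.submatrix (borderEquiv d).symm.injective
    rwa [submatrix_submatrix, Equiv.self_comp_symm, submatrix_id_id] at h2
  by_cases hs : 0 < s
  · rw [indicator_of_mem (hiff.2 hs), indicator_of_mem (mem_Ioi.2 hs), ← ENNReal.ofReal_mul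
      (by exact mul_nonneg (Real.rpow_nonneg hW.det_pos.le _) (Real.exp_nonneg _))]
    congr 1
    have hdet : (symMatrix w).det = s * (symMatrix v).det := by
      rw [← det_submatrix_equiv_self (borderEquiv d), hsub,
        det_schurBlock hu (symMatrix_transpose v)]
    have htr : ((symMatrix w)⁻¹).trace = ((symMatrix v)⁻¹).trace + (s⁻¹ + s⁻¹ * ∑ j, c j ^ 2) := by
      have h3 := trace_inv_schurBlock (C := replicateCol Unit c) hu (symMatrix_transpose v) hs.ne'
      rw [← hsub, inv_submatrix_equiv] at h3
      rw [← show ((symMatrix w)⁻¹.submatrix (borderEquiv d) (borderEquiv d)).trace =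
        ((symMatrix w)⁻¹).trace from
          (borderEquiv d).sum_comp fun i => (symMatrix w)⁻¹ i i, h3]
      simp
    unfold invWishartKernel
    rw [Matrix.one_mul, Matrix.one_mul, hdet, htr, Real.mul_rpow hs.le hW.det_pos.le, mul_add,
      Real.exp_add]
    ring
  · rw [indicator_of_notMem (fun h => hs (hiff.1 h)), indicator_of_notMem (s := Ioi (0 : ℝ)) hs, mul_zero]

theorem mem_posDefEntries_of_border {a : ℝ} {b : Fin d → ℝ} {v : SymIndex d → ℝ}
    (h : borderEntries d (a, b, v) ∈ posDefEntries (d + 1)) : v ∈ posDefEntries d := by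
  have h1 : (symMatrix (borderEntries d (a, b, v))).PosDef := h
  have h2 := (h1.submatrix (borderEquiv d).injective).submatrix (Sum.inl_injective)
  have h3 := submatrix_symMatrix_borderEntries a b v
  change ((symMatrix (borderEntries d (a, b, v))).submatrix (borderEquiv d) (borderEquiv d)) = _
    at h3
  rw [h3] at h2
  exact h2

/-- The map c ↦ Wc has Jacobian det W and s ↦ s + cᵀWc is a translation. The extra det W lowers the
exponent κ of the remaining block by one. Blocks W outside the cone contribute nothing, since
principal blocks of positive definite matrices are positive definite. -/
theorem lintegral_invWishartKernel_succ (d : ℕ) (κ : ℝ) :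
    ∫⁻ v in posDefEntries (d + 1), ENNReal.ofReal (invWishartKernel κ 1 v) =
      (∫⁻ v in posDefEntries d, ENNReal.ofReal (invWishartKernel (κ - 1) 1 v)) *
        invWishartStepConst d κ := by
  set F : (SymIndex (d + 1) → ℝ) → ENNReal := (posDefEntries (d + 1)).indicator
    (fun v => ENNReal.ofReal (invWishartKernel κ 1 v)) with hF
  have hFm : Measurable F :=
    (measurable_invWishartKernel κ 1).ennreal_ofReal.indicator (measurableSet_posDefEntries _)
  have hmp := measurePreserving_borderEntries d
  have hFb : Measurable fun q => F (borderEntries d q) := hFm.comp hmp.measurable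
  rw [← lintegral_indicator (measurableSet_posDefEntries _), ← hF, ← hmp.lintegral_comp hFm,
    Measure.volume_eq_prod, lintegral_prod_symm _ hFb.aemeasurable, Measure.volume_eq_prod,
    lintegral_prod_symm _ (Measurable.lintegral_prod_left' hFb).aemeasurable]
  rw [← lintegral_mul_const _ (measurable_invWishartKernel _ 1).ennreal_ofReal,
    ← lintegral_indicator (measurableSet_posDefEntries _)]
  refine lintegral_congr fun v => ?_
  by_cases hv : v ∈ posDefEntries d
  · rw [indicator_of_mem hv]
    have hW : (symMatrix v).PosDef := hv
    have hdet : LinearMap.det (Matrix.toLin' (symMatrix v)) ≠ 0 := by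
      rw [LinearMap.det_toLin']; exact hW.det_pos.ne'
    rw [lintegral_comp_linearMap volume hdet, LinearMap.det_toLin', abs_of_pos hW.det_pos]
    have h1 : ∀ c : Fin d → ℝ, ∫⁻ a : ℝ, F (borderEntries d (a, Matrix.toLin' (symMatrix v) c, v)) =
        ENNReal.ofReal (invWishartKernel κ 1 v) * ∫⁻ s in Ioi (0 : ℝ),
          ENNReal.ofReal (s ^ (-κ) * Real.exp (-(1 / 2) * (s⁻¹ + s⁻¹ * ∑ j, c j ^ 2))) := by
      intro c
      rw [← lintegral_add_right_eq_self _ (c ⬝ᵥ symMatrix v *ᵥ c),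
        ← lintegral_indicator measurableSet_Ioi, ← lintegral_const_mul' _ _ ENNReal.ofReal_ne_top]
      exact lintegral_congr fun s => invWishartKernel_border κ hv c
    simp only [h1]
    rw [lintegral_const_mul' _ _ ENNReal.ofReal_ne_top, ← mul_assoc,
      ← ENNReal.ofReal_mul hW.det_pos.le]
    unfold invWishartStepConst invWishartKernel
    rw [← mul_assoc, neg_sub, sub_eq_add_neg, Real.rpow_add hW.det_pos, Real.rpow_one]
  · rw [indicator_of_notMem hv]
    have h0 : ∀ (b : Fin d → ℝ) (a : ℝ), F (borderEntries d (a, b, v)) = 0 := fun b a =>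
      indicator_of_notMem (fun h => hv (mem_posDefEntries_of_border h)) _
    simp [h0]

theorem lintegral_invWishartKernel_ne_zero (d : ℕ) (κ : ℝ) :
    ∫⁻ v in posDefEntries d, ENNReal.ofReal (invWishartKernel κ 1 v) ≠ 0 := by
  induction d generalizing κ with
  | zero =>
    have h : posDefEntries 0 = univ := by
      ext v
      simp only [posDefEntries, mem_univ, iff_true]
      refine .of_dotProduct_mulVec_pos (symMatrix_isHermitian v) fun x hx => ?_
      exact absurd (Subsingleton.elim x 0) hx
    rw [h]
    refine lintegral_ofReal_ne_zero MeasurableSet.univ ?_ (measurable_invWishartKernel κ 1)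
      fun v _ => ?_
    · exact (isOpen_univ.measure_pos _ univ_nonempty).ne'
    · simp [invWishartKernel]
  | succ d ih =>
    rw [lintegral_invWishartKernel_succ]
    exact mul_ne_zero (ih _) (invWishartStepConst_ne_zero d κ)

/-- Each bordering step lowers both d and κ by one, so the condition d < κ is inherited. -/
theorem lintegral_invWishartKernel_ne_top {d : ℕ} {κ : ℝ} (hκ : (d : ℝ) < κ) :
    ∫⁻ v in posDefEntries d, ENNReal.ofReal (invWishartKernel κ 1 v) ≠ ⊤ := by
  induction d generalizing κ with
  | zero =>
    refine ne_top_of_le_ne_top ?_ (setLIntegral_le_lintegral _ _)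
    simp [invWishartKernel, lintegral_unique]
  | succ d ih =>
    rw [lintegral_invWishartKernel_succ]
    push_cast at hκ
    exact ENNReal.mul_ne_top (ih (by linarith)) (invWishartStepConst_ne_top hκ)

end InverseWishartInduction


/-! ### Weighted least squares and the law of (β, Σ) given the latent variables -/

section Model

open Matrix

variable {n p d : ℕ} {X : Matrix (Fin n) (Fin p) ℝ} {y : Matrix (Fin n) (Fin d) ℝ}

theorem mulVec_injective_of_rank_eq {m k : Type*} [Fintype m] [Fintype k] [DecidableEq k]
    {A : Matrix m k ℝ} (h : A.rank = Fintype.card k) : Function.Injective A.mulVec := by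
  change Function.Injective A.mulVecLin
  rw [← LinearMap.ker_eq_bot]
  have h1 := LinearMap.finrank_range_add_finrank_ker A.mulVecLin
  rw [Module.finrank_fintype_fun_eq_card, ← h] at h1
  have h2 : A.rank = Module.finrank ℝ (LinearMap.range A.mulVecLin) := rfl
  exact Submodule.finrank_eq_zero.1 (by omega)

theorem eq_zero_of_mulVec_add_mulVec_eq_zero (h : (fromCols X y).rank = p + d)
    {u : Fin p → ℝ} {v : Fin d → ℝ} (huv : X *ᵥ u + y *ᵥ v = 0) : u = 0 ∧ v = 0 := by
  have hinj := mulVec_injective_of_rank_eq (A := fromCols X y) (by simp [h])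
  have h1 : fromCols X y *ᵥ Sum.elim u v = fromCols X y *ᵥ 0 := by
    rw [fromCols_mulVec_sumElim, huv, mulVec_zero]
  have h2 := hinj h1
  exact ⟨funext fun i => congrFun h2 (Sum.inl i), funext fun i => congrFun h2 (Sum.inr i)⟩

/-- The weighted Gram matrix `Xᵀ D X`. -/
def gramMatrix (X : Matrix (Fin n) (Fin p) ℝ) (z : Fin n → ℝ) : Matrix (Fin p) (Fin p) ℝ :=
  Xᵀ * diagonal z * X

/-- The residual matrix `yᵀ D y - μᵀ Xᵀ D X μ` of the weighted regression. -/
def residMatrix (X : Matrix (Fin n) (Fin p) ℝ) (y : Matrix (Fin n) (Fin d) ℝ) (z : Fin n → ℝ) :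
    Matrix (Fin d) (Fin d) ℝ :=
  yᵀ * diagonal z * y - (muMatrix X y z)ᵀ * gramMatrix X z * muMatrix X y z

theorem posDef_transpose_diagonal_mul {m k : Type*} [Fintype m] [Fintype k] [DecidableEq m]
    {B : Matrix m k ℝ} (hB : Function.Injective B.mulVec) {z : m → ℝ} (hz : ∀ i, 0 < z i) :
    (Bᵀ * diagonal z * B).PosDef := by
  have h := (PosDef.diagonal hz).conjTranspose_mul_mul_same hB
  rwa [conjTranspose_eq_transpose_of_trivial] at h

theorem posDef_gramMatrix (h : (fromCols X y).rank = p + d) {z : Fin n → ℝ}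
    (hz : ∀ i, 0 < z i) : (gramMatrix X z).PosDef := by
  refine posDef_transpose_diagonal_mul (fun u v huv => ?_) hz
  have h1 : X *ᵥ (u - v) + y *ᵥ 0 = 0 := by
    have : X *ᵥ u = X *ᵥ v := huv
    rw [mulVec_sub, this, sub_self, mulVec_zero, add_zero]
  exact sub_eq_zero.1 (eq_zero_of_mulVec_add_mulVec_eq_zero h h1).1

theorem gramMatrix_transpose (X : Matrix (Fin n) (Fin p) ℝ) (z : Fin n → ℝ) :
    (gramMatrix X z)ᵀ = gramMatrix X z := by
  simp [gramMatrix, Matrix.mul_assoc]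

theorem gramMatrix_mul_muMatrix {z : Fin n → ℝ} (hA : IsUnit (gramMatrix X z).det) :
    gramMatrix X z * muMatrix X y z = Xᵀ * diagonal z * y := by
  have h : muMatrix X y z = (gramMatrix X z)⁻¹ * (Xᵀ * diagonal z * y) := by
    simp only [muMatrix, gramMatrix, Matrix.mul_assoc]
  rw [h, mul_nonsing_inv_cancel_left _ _ hA]

/-- Completing the square: the normal equations `gramMatrix_mul_muMatrix` make the cross terms
match. -/
theorem transpose_diagonal_mul_sub {z : Fin n → ℝ} (hA : IsUnit (gramMatrix X z).det)
    (B : Matrix (Fin p) (Fin d) ℝ) :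
    (X * B - y)ᵀ * diagonal z * (X * B - y) =
      (B - muMatrix X y z)ᵀ * gramMatrix X z * (B - muMatrix X y z) + residMatrix X y z := by
  have h1 := gramMatrix_mul_muMatrix (y := y) hA
  have h2 : (muMatrix X y z)ᵀ * gramMatrix X z = yᵀ * diagonal z * X := by
    have := congrArg transpose h1
    rw [transpose_mul, gramMatrix_transpose] at this
    rw [this]
    simp [Matrix.mul_assoc]
  have h3 : Xᵀ * diagonal z * X = gramMatrix X z := rfl
  rw [residMatrix]
  simp only [transpose_sub, transpose_mul, Matrix.sub_mul, Matrix.mul_sub]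
  have e1 : Bᵀ * Xᵀ * diagonal z * (X * B) = Bᵀ * gramMatrix X z * B := by
    simp only [gramMatrix, Matrix.mul_assoc]
  have e2 : yᵀ * diagonal z * (X * B) = (muMatrix X y z)ᵀ * gramMatrix X z * B := by
    rw [h2, Matrix.mul_assoc _ X B]
  have e3 : Bᵀ * Xᵀ * diagonal z * y = Bᵀ * gramMatrix X z * muMatrix X y z := by
    rw [Matrix.mul_assoc, Matrix.mul_assoc, ← Matrix.mul_assoc Xᵀ, ← h1, Matrix.mul_assoc]
  rw [e1, e2, e3]
  abel

theorem residMatrix_eq {z : Fin n → ℝ} (hA : IsUnit (gramMatrix X z).det) :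
    residMatrix X y z =
      (X * muMatrix X y z - y)ᵀ * diagonal z * (X * muMatrix X y z - y) := by
  rw [transpose_diagonal_mul_sub hA]
  simp

/-- This is a weighted Gram matrix of Xμ - y, and a vector in the kernel of Xμ - y would give a
linear relation between the columns of (X:y). -/
theorem posDef_residMatrix (h : (fromCols X y).rank = p + d) {z : Fin n → ℝ}
    (hz : ∀ i, 0 < z i) : (residMatrix X y z).PosDef := by
  rw [residMatrix_eq (posDef_gramMatrix h hz).det_pos.ne'.isUnit]
  refine posDef_transpose_diagonal_mul (fun u v huv => ?_) hz
  have huv' : (X * muMatrix X y z - y) *ᵥ (u - v) = 0 := by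
    rw [mulVec_sub, sub_eq_zero]; exact huv
  have h1 : X *ᵥ (muMatrix X y z *ᵥ (u - v)) + y *ᵥ (-(u - v)) = 0 := by
    rw [mulVec_mulVec, mulVec_neg, ← sub_eq_add_neg, ← sub_mulVec, huv']
  exact sub_eq_zero.1 (neg_eq_zero.1 (eq_zero_of_mulVec_add_mulVec_eq_zero h h1).2)

theorem sqResidual_eq (x : Param p d) (i : Fin n) :
    sqResidual X y x i = ((X * x.beta - y) * x.sigma⁻¹ * (X * x.beta - y)ᵀ) i i := by
  have h1 : x.betaᵀ *ᵥ X i - y i = (X * x.beta - y) i := by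
    ext j
    simp [mulVec, mul_apply, dotProduct, mul_comm]
  rw [sqResidual, h1, Matrix.mul_assoc, mul_apply]
  simp only [dotProduct, mulVec, mul_apply, transpose_apply]

theorem sqResidual_nonneg {x : Param p d} (hx : x ∈ stateSpace p d) (i : Fin n) :
    0 ≤ sqResidual X y x i := by
  have h : x.sigma.PosDef := hx
  have := h.inv.posSemidef.dotProduct_mulVec_nonneg (x.betaᵀ *ᵥ X i - y i)
  simpa [sqResidual] using this

/-- This splits the exponent of `condKernel` into a Gaussian part in β and an inverse Wishart part
in Σ. -/
theorem sum_mul_sqResidual {z : Fin n → ℝ} (hA : IsUnit (gramMatrix X z).det) (x : Param p d) :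
    ∑ i, z i * sqResidual X y x i =
      (gramMatrix X z * (x.beta - muMatrix X y z) * x.sigma⁻¹ * (x.beta - muMatrix X y z)ᵀ).trace +
        (residMatrix X y z * x.sigma⁻¹).trace := by
  have h1 : ∑ i, z i * sqResidual X y x i =
      (diagonal z * ((X * x.beta - y) * x.sigma⁻¹ * (X * x.beta - y)ᵀ)).trace := by
    simp [trace, diagonal_mul, sqResidual_eq]
  have h2 : (diagonal z * ((X * x.beta - y) * x.sigma⁻¹ * (X * x.beta - y)ᵀ)).trace =
      ((X * x.beta - y)ᵀ * diagonal z * (X * x.beta - y) * x.sigma⁻¹).trace := by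
    rw [← Matrix.mul_assoc, trace_mul_comm]
    simp only [Matrix.mul_assoc]
  rw [h1, h2, transpose_diagonal_mul_sub hA, Matrix.add_mul, trace_add]
  congr 1
  rw [Matrix.mul_assoc, Matrix.mul_assoc, trace_mul_comm]
  simp only [Matrix.mul_assoc]

/-- The posterior density of `(β, Σ)` given the latent variables, up to normalization. -/
def condKernel (X : Matrix (Fin n) (Fin p) ℝ) (y : Matrix (Fin n) (Fin d) ℝ) (a : ℝ)
    (z : Fin n → ℝ) (x : Param p d) : ℝ :=
  x.sigma.det ^ (-((n : ℝ) / 2 + a)) * Real.exp (-(1 / 2) * ∑ i, z i * sqResidual X y x i)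

theorem stateSpace_eq_prod (p d : ℕ) : stateSpace p d = univ ×ˢ posDefEntries d := by
  ext x
  simp only [stateSpace, posDefEntries, Param.sigma, mem_prod, mem_univ, true_and]
  rfl

theorem measurableSet_stateSpace (p d : ℕ) : MeasurableSet (stateSpace p d) := by
  rw [stateSpace_eq_prod]
  exact MeasurableSet.univ.prod (measurableSet_posDefEntries d)

theorem measurable_det_sigma : Measurable fun x : Param p d => x.sigma.det :=
  (continuous_det_symMatrix d).measurable.comp measurable_snd

theorem measurable_sqResidual (X : Matrix (Fin n) (Fin p) ℝ) (y : Matrix (Fin n) (Fin d) ℝ)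
    (i : Fin n) : Measurable fun x : Param p d => sqResidual X y x i := by
  have h1 : ∀ j, Measurable fun x : Param p d => (x.betaᵀ *ᵥ X i - y i) j := by
    intro j
    simp only [Pi.sub_apply, mulVec, dotProduct, transpose_apply, Param.beta, of_apply]
    fun_prop
  have h2 : ∀ j k, Measurable fun x : Param p d => x.sigma⁻¹ j k := fun j k =>
    (measurable_inv_symMatrix_apply j k).comp measurable_snd
  simp only [sqResidual, dotProduct]
  exact Finset.measurable_sum _ fun j _ => (h1 j).mul (by
    simp only [mulVec, dotProduct]
    exact Finset.measurable_sum _ fun k _ => (h2 j k).mul (h1 k))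

theorem measurable_condKernel (X : Matrix (Fin n) (Fin p) ℝ) (y : Matrix (Fin n) (Fin d) ℝ)
    (a : ℝ) : Measurable fun q : (Fin n → ℝ) × Param p d => condKernel X y a q.1 q.2 := by
  unfold condKernel
  refine ((measurable_det_sigma.comp measurable_snd).pow_const _).mul
    (Measurable.exp (Measurable.const_mul ?_ _))
  exact Finset.measurable_sum _ fun i _ => ((measurable_pi_apply i).comp measurable_fst).mul
    ((measurable_sqResidual X y i).comp measurable_snd)

theorem condKernel_pos (X : Matrix (Fin n) (Fin p) ℝ) (y : Matrix (Fin n) (Fin d) ℝ) (a : ℝ)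
    (z : Fin n → ℝ) {x : Param p d} (hx : x ∈ stateSpace p d) : 0 < condKernel X y a z x := by
  have h : x.sigma.PosDef := hx
  exact mul_pos (Real.rpow_pos_of_pos h.det_pos _) (Real.exp_pos _)

/-- The constant in the normalization of `condKernel`. -/
def condConst (n p d : ℕ) (a : ℝ) : ENNReal :=
  (∫⁻ v in posDefEntries d, ENNReal.ofReal (invWishartKernel (((n : ℝ) - p) / 2 + a) 1 v)) *
    gaussianConst p d

theorem condConst_ne_zero (n p d : ℕ) (a : ℝ) : condConst n p d a ≠ 0 :=
  mul_ne_zero (lintegral_invWishartKernel_ne_zero _ _) (gaussianConst_ne_zero p d)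

theorem condConst_ne_top {a : ℝ} (h : (p : ℝ) + 2 * d - 2 * a < n) : condConst n p d a ≠ ⊤ :=
  ENNReal.mul_ne_top (lintegral_invWishartKernel_ne_top (by linarith)) (gaussianConst_ne_top p d)

/-- The normalization of `condKernel`. -/
def condNorm (X : Matrix (Fin n) (Fin p) ℝ) (y : Matrix (Fin n) (Fin d) ℝ) (a : ℝ)
    (z : Fin n → ℝ) : ℝ :=
  (gramMatrix X z).det ^ (-(d : ℝ) / 2) *
    (residMatrix X y z).det ^ (-(((n : ℝ) - p + 2 * a - d - 1) / 2)) * (condConst n p d a).toReal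

theorem condNorm_pos (h : (fromCols X y).rank = p + d) {a : ℝ}
    (ha : (p : ℝ) + 2 * d - 2 * a < n) {z : Fin n → ℝ} (hz : ∀ i, 0 < z i) :
    0 < condNorm X y a z :=
  mul_pos (mul_pos (Real.rpow_pos_of_pos (posDef_gramMatrix h hz).det_pos _)
    (Real.rpow_pos_of_pos (posDef_residMatrix h hz).det_pos _))
    (ENNReal.toReal_pos (condConst_ne_zero n p d a) (condConst_ne_top ha))

/-- The Gaussian integral over β yields |Σ|^(p/2), which turns the power -(n/2 + a) into the inverse
Wishart exponent -((n - p)/2 + a); that integral is finite exactly through n > p + 2d - 2a. -/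
theorem lintegral_condKernel (h : (fromCols X y).rank = p + d) {a : ℝ}
    (ha : (p : ℝ) + 2 * d - 2 * a < n) {z : Fin n → ℝ} (hz : ∀ i, 0 < z i) :
    ∫⁻ x, ENNReal.ofReal (condKernel X y a z x) ∂(stateMeasure p d) =
      ENNReal.ofReal (condNorm X y a z) := by
  have hA := posDef_gramMatrix h hz
  have hR := posDef_residMatrix h hz
  have hm : Measurable fun x : Param p d => ENNReal.ofReal (condKernel X y a z x) :=
    ((measurable_condKernel X y a).comp measurable_prodMk_left).ennreal_ofReal
  rw [stateMeasure, stateSpace_eq_prod, Measure.volume_eq_prod, ← Measure.prod_restrict,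
    lintegral_prod_symm _ hm.aemeasurable, Measure.restrict_univ]
  have key : ∀ v ∈ posDefEntries d, ∫⁻ B : Fin p → Fin d → ℝ,
      ENNReal.ofReal (condKernel X y a z (B, v)) =
      ENNReal.ofReal ((gramMatrix X z).det ^ (-(d : ℝ) / 2)) * gaussianConst p d *
        ENNReal.ofReal (invWishartKernel (((n : ℝ) - p) / 2 + a) (residMatrix X y z) v) := by
    intro v hv
    have hW : (symMatrix v).PosDef := hv
    have hS := hW.inv
    have h1 : ∀ B : Fin p → Fin d → ℝ, ENNReal.ofReal (condKernel X y a z (B, v)) =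
        ENNReal.ofReal ((symMatrix v).det ^ (-((n : ℝ) / 2 + a)) *
          Real.exp (-(1 / 2) * (residMatrix X y z * (symMatrix v)⁻¹).trace)) *
        ENNReal.ofReal (Real.exp (-(1 / 2) * (gramMatrix X z * (of B - muMatrix X y z) *
          (symMatrix v)⁻¹ * (of B - muMatrix X y z)ᵀ).trace)) := by
      intro B
      rw [← ENNReal.ofReal_mul (mul_nonneg (Real.rpow_nonneg hW.det_pos.le _) (Real.exp_nonneg _)),
        mul_assoc, ← Real.exp_add, condKernel, sum_mul_sqResidual hA.det_pos.ne'.isUnit, mul_add,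
        add_comm (-(1 / 2) * trace _)]
      rfl
    simp only [h1]
    rw [lintegral_const_mul' _ _ ENNReal.ofReal_ne_top, lintegral_matrixGaussian hA hS,
      ← mul_assoc, mul_right_comm _ (gaussianConst p d),
      ← ENNReal.ofReal_mul (Real.rpow_nonneg hA.det_pos.le _), ← ENNReal.ofReal_mul
      (mul_nonneg (Real.rpow_nonneg hW.det_pos.le _) (Real.exp_nonneg _))]
    congr 2
    unfold invWishartKernel
    have h2 : (symMatrix v)⁻¹.det ^ (-(p : ℝ) / 2) = (symMatrix v).det ^ ((p : ℝ) / 2) := by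
      rw [det_nonsing_inv, Ring.inverse_eq_inv', Real.inv_rpow hW.det_pos.le,
        ← Real.rpow_neg hW.det_pos.le]
      congr 1; ring
    have h3 : (symMatrix v).det ^ (-(((n : ℝ) - p) / 2 + a)) =
        (symMatrix v).det ^ (-((n : ℝ) / 2 + a)) * (symMatrix v).det ^ ((p : ℝ) / 2) := by
      rw [← Real.rpow_add hW.det_pos]
      congr 1; ring
    rw [h2, h3]
    ring
  rw [setLIntegral_congr_fun (measurableSet_posDefEntries d) key,
    lintegral_const_mul _ (measurable_invWishartKernel _ _).ennreal_ofReal,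
    lintegral_invWishartKernel _ hR, condNorm, ENNReal.ofReal_mul (mul_nonneg
      (Real.rpow_nonneg hA.det_pos.le _) (Real.rpow_nonneg hR.det_pos.le _)),
    ENNReal.ofReal_toReal (condConst_ne_top ha), ENNReal.ofReal_mul
      (Real.rpow_nonneg hA.det_pos.le _), condConst,
    show -(((n : ℝ) - p) / 2 + a - (d + 1) / 2) = -(((n : ℝ) - p + 2 * a - d - 1) / 2) by ring]
  ring

theorem gramMatrix_smul (t : ℝ) (z : Fin n → ℝ) :
    gramMatrix X (t • z) = t • gramMatrix X z := by
  rw [gramMatrix, gramMatrix, diagonal_smul, Matrix.mul_smul, Matrix.smul_mul]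

theorem muMatrix_smul (h : (fromCols X y).rank = p + d) {t : ℝ} (ht : 0 < t) {z : Fin n → ℝ}
    (hz : ∀ i, 0 < z i) : muMatrix X y (t • z) = muMatrix X y z := by
  have h1 : IsUnit (gramMatrix X z).det := (posDef_gramMatrix h hz).det_pos.ne'.isUnit
  have h2 : IsUnit (gramMatrix X (t • z)).det :=
    (posDef_gramMatrix h (z := t • z) fun i => mul_pos ht (hz i)).det_pos.ne'.isUnit
  have e1 := gramMatrix_mul_muMatrix (y := y) h1
  have e2 := gramMatrix_mul_muMatrix (y := y) h2
  rw [diagonal_smul, Matrix.mul_smul, Matrix.smul_mul, ← e1, gramMatrix_smul,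
    Matrix.smul_mul] at e2
  have e3 := smul_right_injective _ ht.ne' e2
  have e4 := congrArg (fun B => (gramMatrix X z)⁻¹ * B) e3
  simpa only [nonsing_inv_mul_cancel_left _ _ h1] using e4

theorem residMatrix_smul (h : (fromCols X y).rank = p + d) {t : ℝ} (ht : 0 < t) {z : Fin n → ℝ}
    (hz : ∀ i, 0 < z i) : residMatrix X y (t • z) = t • residMatrix X y z := by
  rw [residMatrix, residMatrix, muMatrix_smul h ht hz, gramMatrix_smul, diagonal_smul]
  simp only [Matrix.mul_smul, Matrix.smul_mul, smul_sub]

/-- The degree of homogeneity of `condNorm`. -/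
def condDegree (n p d : ℕ) (a : ℝ) : ℝ :=
  p * (d / 2) + d * (((n : ℝ) - p + 2 * a - d - 1) / 2)

/-- Rescaling all weights leaves the least squares solution μ unchanged, so the Gram and residual
matrices scale linearly. Used to compare z with z/2, and a constant vector with the vector of ones.
-/
theorem condNorm_smul (h : (fromCols X y).rank = p + d) (a : ℝ) {t : ℝ} (ht : 0 < t)
    {z : Fin n → ℝ} (hz : ∀ i, 0 < z i) :
    condNorm X y a (t • z) = t ^ (-condDegree n p d a) * condNorm X y a z := by
  rw [condNorm, condNorm, gramMatrix_smul, residMatrix_smul h ht hz, det_smul, det_smul,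
    Fintype.card_fin, Fintype.card_fin, Real.mul_rpow (by positivity)
    (posDef_gramMatrix h hz).det_pos.le, Real.mul_rpow (by positivity)
    (posDef_residMatrix h hz).det_pos.le, ← Real.rpow_natCast, ← Real.rpow_natCast,
    ← Real.rpow_mul ht.le, ← Real.rpow_mul ht.le, condDegree]
  rw [show -((p : ℝ) * (d / 2) + d * (((n : ℝ) - p + 2 * a - d - 1) / 2)) =
    p * (-d / 2) + d * (-(((n : ℝ) - p + 2 * a - d - 1) / 2)) by ring, Real.rpow_add ht]
  ring

/-- Immediate from the integral formula, since exp(-½ Σ zᵢ rᵢ) decreases in every zᵢ; no comparison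
of determinants is needed. -/
theorem condNorm_anti (h : (fromCols X y).rank = p + d) {a : ℝ}
    (ha : (p : ℝ) + 2 * d - 2 * a < n) {z w : Fin n → ℝ} (hz : ∀ i, 0 < z i) (hzw : z ≤ w) :
    condNorm X y a w ≤ condNorm X y a z := by
  have hw : ∀ i, 0 < w i := fun i => (hz i).trans_le (hzw i)
  rw [← ENNReal.ofReal_le_ofReal_iff (condNorm_pos h ha hz).le, ← lintegral_condKernel h ha hz,
    ← lintegral_condKernel h ha hw]
  refine setLIntegral_mono' (measurableSet_stateSpace p d) fun x hx => ENNReal.ofReal_le_ofReal ?_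
  have hx' : x.sigma.PosDef := hx
  unfold condKernel
  refine mul_le_mul_of_nonneg_left (Real.exp_le_exp.2 ?_) (Real.rpow_nonneg hx'.det_pos.le _)
  have : ∑ i, z i * sqResidual X y x i ≤ ∑ i, w i * sqResidual X y x i :=
    Finset.sum_le_sum fun i _ => mul_le_mul_of_nonneg_right (hzw i) (sqResidual_nonneg hx i)
  linarith

/-- The normalizing constant shared by the matrix normal and inverse Wishart densities. -/
def stepConst (n p d : ℕ) (a : ℝ) : ℝ :=
  (2 * Real.pi) ^ ((p : ℝ) * d / 2) * ((2 : ℝ) ^ (((n : ℝ) - p + 2 * a - d - 1) * d / 2) *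
    Real.pi ^ ((d : ℝ) * (d - 1) / 4) *
      ∏ i ∈ Finset.Icc 1 d, Real.Gamma (1 / 2 * (((n : ℝ) - p + 2 * a - d - 1) + 1 - i)))

theorem stepConst_pos {a : ℝ} (ha : (p : ℝ) + 2 * d - 2 * a < n) : 0 < stepConst n p d a := by
  unfold stepConst
  have : 0 < ∏ i ∈ Finset.Icc 1 d,
      Real.Gamma (1 / 2 * (((n : ℝ) - p + 2 * a - d - 1) + 1 - i)) := by
    refine Finset.prod_pos fun i hi => Real.Gamma_pos_of_pos ?_
    have : (i : ℝ) ≤ d := by exact_mod_cast (Finset.mem_Icc.1 hi).2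
    linarith
  positivity

theorem omegaMatrix_eq (X : Matrix (Fin n) (Fin p) ℝ) (z : Fin n → ℝ) :
    omegaMatrix X z = (gramMatrix X z)⁻¹ := rfl

theorem thetaMatrix_eq {z : Fin n → ℝ} (hA : IsUnit (gramMatrix X z).det) :
    thetaMatrix X y z = (residMatrix X y z)⁻¹ := by
  rw [thetaMatrix, omegaMatrix_eq, nonsing_inv_nonsing_inv _ hA, residMatrix]

/-- The constant in front is left unevaluated: later steps use only that it is positive and
independent of z. -/
theorem matrixNormalDensity_mul_inverseWishartDensity (h : (fromCols X y).rank = p + d) {a : ℝ}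
    (ha : (p : ℝ) + 2 * d - 2 * a < n) {z : Fin n → ℝ} (hz : ∀ i, 0 < z i) {x : Param p d}
    (hx : x ∈ stateSpace p d) :
    matrixNormalDensity (muMatrix X y z) (omegaMatrix X z) x.sigma x.beta *
      inverseWishartDensity ((n : ℝ) - p + 2 * a - d - 1) (thetaMatrix X y z) x.sigma =
    (condConst n p d a).toReal / stepConst n p d a * (condKernel X y a z x / condNorm X y a z) := by
  have hA := posDef_gramMatrix h hz
  have hR := posDef_residMatrix h hz
  have hx' : x.sigma.PosDef := hx
  have hAu := hA.det_pos.ne'.isUnit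
  have hRu := hR.det_pos.ne'.isUnit
  have hC : 0 < (condConst n p d a).toReal :=
    ENNReal.toReal_pos (condConst_ne_zero n p d a) (condConst_ne_top ha)
  have hK := stepConst_pos ha
  rw [thetaMatrix_eq hAu, omegaMatrix_eq, matrixNormalDensity, inverseWishartDensity, condKernel,
    sum_mul_sqResidual hAu, nonsing_inv_nonsing_inv _ hAu, nonsing_inv_nonsing_inv _ hRu,
    mul_add, Real.exp_add, condNorm, det_nonsing_inv, det_nonsing_inv, Ring.inverse_eq_inv',
    Real.inv_rpow hA.det_pos.le, Real.inv_rpow hR.det_pos.le,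
    show -(d : ℝ) / 2 = -((d : ℝ) / 2) by ring, Real.rpow_neg hA.det_pos.le,
    Real.rpow_neg hR.det_pos.le]
  have h1 : x.sigma.det ^ (-(((n : ℝ) - p + 2 * a - d - 1 + d + 1) / 2)) =
      x.sigma.det ^ (-((n : ℝ) / 2 + a)) * x.sigma.det ^ ((p : ℝ) / 2) := by
    rw [← Real.rpow_add hx'.det_pos]
    congr 1; ring
  rw [h1]
  have e1 : 0 < x.sigma.det ^ ((p : ℝ) / 2) := Real.rpow_pos_of_pos hx'.det_pos _
  have e2 : 0 < (gramMatrix X z).det ^ ((d : ℝ) / 2) := Real.rpow_pos_of_pos hA.det_pos _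
  have e3 : 0 < (residMatrix X y z).det ^ (((n : ℝ) - p + 2 * a - d - 1) / 2) :=
    Real.rpow_pos_of_pos hR.det_pos _
  unfold stepConst at hK ⊢
  have e4 := ((mul_pos_iff_of_pos_left (by positivity)).1 ((mul_pos_iff_of_pos_left
    (by positivity)).1 hK))
  field_simp

end Model


/-! ### Bounds for regular mixing densities -/

section Mixing

open Filter Topology Asymptotics

/-- Unnormalized mixing densities that vanish rapidly at the origin, have a moment of order `d / 2`,
and do not decrease too slowly towards the origin. -/
structure IsRegularMixingKernel (d : ℕ) (g : ℝ → ℝ) : Prop where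
  measurable : Measurable g
  pos : ∀ u, 0 < u → 0 < g u
  continuousOn : ContinuousOn g (Ioi 0)
  isBigO_zero : ∀ b : ℝ, g =O[𝓝[>] 0] fun u => u ^ b
  isBigO_top : ∃ b : ℝ, (d : ℝ) / 2 + 1 < b ∧ g =O[atTop] fun u => u ^ (-b)
  ratio : ∃ ε : ℝ, 0 < ε ∧ ∃ C : ℝ, ∀ u t : ℝ, 0 < u → u ≤ 1 → 5 / 4 ≤ t → t ≤ 3 / 2 →
    g u ≤ C * u ^ ε * g (u * t)

namespace IsRegularMixingKernel

variable {d : ℕ} {g : ℝ → ℝ}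

/-- Rapid vanishing at 0 allows every negative power; only the tail restricts s. -/
theorem integrableOn_rpow_mul (hg : IsRegularMixingKernel d g) {s : ℝ} (hs : s ≤ (d : ℝ) / 2) :
    IntegrableOn (fun u => u ^ s * g u) (Ioi 0) := by
  obtain ⟨b, hb, hO⟩ := hg.isBigO_top
  have h := mellin_convergent_of_isBigO_scalar (s := s + 1) (b := s)
    (hg.continuousOn.locallyIntegrableOn measurableSet_Ioi) hO (by linarith)
    (hg.isBigO_zero (-s)) (by linarith)
  simpa using h

theorem integrableOn (hg : IsRegularMixingKernel d g) : IntegrableOn g (Ioi 0) := by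
  have h := hg.integrableOn_rpow_mul (s := 0) (by positivity)
  simpa using h

theorem integral_pos (hg : IsRegularMixingKernel d g) : 0 < ∫ u in Ioi (0 : ℝ), g u := by
  rw [setIntegral_pos_iff_support_of_nonneg_ae]
  · have : Function.support g ∩ Ioi 0 = Ioi 0 :=
      inter_eq_right.2 fun u hu => (hg.pos u hu).ne'
    rw [this]; simp
  · filter_upwards [ae_restrict_mem measurableSet_Ioi] with u hu using (hg.pos u hu).le
  · exact hg.integrableOn

theorem isMixingDensity_normalized (hg : IsRegularMixingKernel d g) :
    IsMixingDensity (normalized g) where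
  nonneg u hu := mul_nonneg (inv_nonneg.2 hg.integral_pos.le) (hg.pos u hu).le
  integrable := hg.integrableOn.const_mul _
  integral_eq_one := by
    simp only [normalized]
    rw [integral_const_mul, inv_mul_cancel₀ hg.integral_pos.ne']

theorem normalized (hg : IsRegularMixingKernel d g) : IsRegularMixingKernel d (normalized g) where
  measurable := hg.measurable.const_mul _
  pos u hu := mul_pos (inv_pos.2 hg.integral_pos) (hg.pos u hu)
  continuousOn := continuousOn_const.mul hg.continuousOn
  isBigO_zero b := (hg.isBigO_zero b).const_mul_left _
  isBigO_top := by
    obtain ⟨b, hb, hO⟩ := hg.isBigO_top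
    exact ⟨b, hb, hO.const_mul_left _⟩
  ratio := by
    obtain ⟨ε, hε, C, h⟩ := hg.ratio
    refine ⟨ε, hε, C, fun u t hu hu1 ht ht' => ?_⟩
    have := mul_le_mul_of_nonneg_left (h u t hu hu1 ht ht') (inv_nonneg.2 hg.integral_pos.le)
    simp only [_root_.normalized]
    linarith

theorem integrableOn_tilted (hg : IsRegularMixingKernel d g) {r : ℝ} (hr : 0 ≤ r) :
    IntegrableOn (fun u => u ^ ((d : ℝ) / 2) * Real.exp (-(r * u / 2)) * g u) (Ioi 0) := by
  refine (hg.integrableOn_rpow_mul le_rfl).mono'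
    (((measurable_id.pow_const _).mul (by fun_prop)).mul hg.measurable).aestronglyMeasurable ?_
  filter_upwards [ae_restrict_mem measurableSet_Ioi] with u (hu : 0 < u)
  have h0 := hg.pos u hu
  rw [Real.norm_of_nonneg (by positivity)]
  have : Real.exp (-(r * u / 2)) ≤ 1 := Real.exp_le_one_iff.2 (by
    have : 0 ≤ r * u / 2 := by positivity
    linarith)
  calc u ^ ((d : ℝ) / 2) * Real.exp (-(r * u / 2)) * g u ≤ u ^ ((d : ℝ) / 2) * 1 * g u := by gcongr
    _ = _ := by ring

theorem integral_tilted_pos (hg : IsRegularMixingKernel d g) {r : ℝ} (hr : 0 ≤ r) :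
    0 < ∫ u in Ioi (0 : ℝ), u ^ ((d : ℝ) / 2) * Real.exp (-(r * u / 2)) * g u := by
  rw [setIntegral_pos_iff_support_of_nonneg_ae]
  · have : (Function.support fun u => u ^ ((d : ℝ) / 2) * Real.exp (-(r * u / 2)) * g u) ∩ Ioi 0 =
        Ioi 0 := inter_eq_right.2 fun u (hu : 0 < u) => by
      have := hg.pos u hu
      exact (show (0 : ℝ) < u ^ ((d : ℝ) / 2) * Real.exp (-(r * u / 2)) * g u by positivity).ne'
    rw [this]; simp
  · filter_upwards [ae_restrict_mem measurableSet_Ioi] with u (hu : 0 < u)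
    have := hg.pos u hu
    change (0 : ℝ) ≤ u ^ ((d : ℝ) / 2) * Real.exp (-(r * u / 2)) * g u
    positivity
  · exact hg.integrableOn_tilted hr

theorem truncatedMoment_pos (hg : IsRegularMixingKernel d g) {u : ℝ} (hu : 0 < u) :
    0 < ∫ v in Ioc 0 u, v ^ ((d : ℝ) / 2) * g v := by
  rw [setIntegral_pos_iff_support_of_nonneg_ae]
  · have : (Function.support fun v => v ^ ((d : ℝ) / 2) * g v) ∩ Ioc 0 u =
        Ioc 0 u := inter_eq_right.2 fun v hv =>
      (mul_pos (Real.rpow_pos_of_pos hv.1 _) (hg.pos v hv.1)).ne'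
    rw [this]; simp [hu]
  · filter_upwards [ae_restrict_mem measurableSet_Ioc] with v hv
    exact mul_nonneg (Real.rpow_nonneg hv.1.le _) (hg.pos v hv.1).le
  · exact (hg.integrableOn_rpow_mul le_rfl).mono_set Ioc_subset_Ioi_self

/-- For u ≤ 1, averaging the ratio condition over v = ut, an interval of length u/4, gives B(u) = 4C
u^(ε-1), integrable at 0 because ε > 0. For u > 1 the truncated moment is at least its value at 1.
-/
theorem exists_truncatedMoment_bound (hg : IsRegularMixingKernel d g) :
    ∃ B : ℝ → ℝ, Measurable B ∧ IntegrableOn B (Ioi 0) ∧ (∀ u, 0 < u → 0 ≤ B u) ∧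
      ∀ u, 0 < u → u ^ ((d : ℝ) / 2) * g u ≤
        B u * ∫ v in Ioc 0 (3 / 2 * u), v ^ ((d : ℝ) / 2) * g v := by
  obtain ⟨ε, hε, C, hC⟩ := hg.ratio
  have hC0 : 0 < C := by
    have h1 := hC 1 (5 / 4) one_pos le_rfl le_rfl (by norm_num)
    have h2 := hg.pos 1 one_pos
    have h3 := hg.pos (1 * (5 / 4)) (by norm_num)
    rw [Real.one_rpow, mul_one] at h1
    exact pos_of_mul_pos_left (h2.trans_le h1) h3.le
  set H : ℝ → ℝ := fun u => ∫ v in Ioc 0 u, v ^ ((d : ℝ) / 2) * g v with hH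
  have hInt := hg.integrableOn_rpow_mul (le_refl ((d : ℝ) / 2))
  have hmono : ∀ u w, u ≤ w → H u ≤ H w := fun u w huw =>
    setIntegral_mono_set (hInt.mono_set Ioc_subset_Ioi_self)
      (by
        filter_upwards [ae_restrict_mem measurableSet_Ioc] with v hv
        exact mul_nonneg (Real.rpow_nonneg hv.1.le _) (hg.pos v hv.1).le)
      (Ioc_subset_Ioc_right huw).eventuallyLE
  have hH1 : 0 < H 1 := hg.truncatedMoment_pos one_pos
  refine ⟨(Iic 1).piecewise (fun u => 4 * C * u ^ (ε - 1))
    (fun u => (H 1)⁻¹ * (u ^ ((d : ℝ) / 2) * g u)), ?_, ?_, ?_, ?_⟩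
  · exact Measurable.piecewise measurableSet_Iic (by fun_prop)
      (((measurable_id.pow_const _).mul hg.measurable).const_mul _)
  · rw [← Ioc_union_Ioi_eq_Ioi (zero_le_one' ℝ)]
    refine IntegrableOn.union ?_ ?_
    · have h1 : IntegrableOn (fun u : ℝ => 4 * C * u ^ (ε - 1)) (Ioc 0 1) := by
        have := (intervalIntegral.intervalIntegrable_rpow' (a := 0) (b := 1)
          (show -1 < ε - 1 by linarith))
        rw [intervalIntegrable_iff_integrableOn_Ioc_of_le zero_le_one] at this
        exact this.const_mul _
      refine h1.congr_fun (fun u hu => ?_) measurableSet_Ioc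
      rw [piecewise_eq_of_mem _ _ _ (show u ∈ Iic 1 from hu.2)]
    · have h1 : IntegrableOn (fun u : ℝ => (H 1)⁻¹ * (u ^ ((d : ℝ) / 2) * g u)) (Ioi 1) :=
        (hInt.mono_set (Ioi_subset_Ioi zero_le_one)).const_mul _
      refine h1.congr_fun (fun u hu => ?_) measurableSet_Ioi
      rw [piecewise_eq_of_notMem _ _ _ (show u ∉ Iic 1 from fun h => absurd (mem_Iic.1 h) (not_le.2 (mem_Ioi.1 hu)))]
  · intro u hu
    have := hg.pos u hu
    by_cases h1 : u ∈ Iic 1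
    · rw [piecewise_eq_of_mem _ _ _ h1]
      positivity
    · rw [piecewise_eq_of_notMem _ _ _ h1]
      positivity
  · intro u hu
    by_cases h1 : u ∈ Iic 1
    · rw [piecewise_eq_of_mem _ _ _ h1]
      have hue : 0 < u ^ ε := Real.rpow_pos_of_pos hu _
      -- The integrand on the left is constant: it bounds v^(d/2) g(v) from below on the whole
      -- interval.
      have hle : ∫ _ in Ioc (5 / 4 * u) (3 / 2 * u), (C * u ^ ε)⁻¹ * (u ^ ((d : ℝ) / 2) * g u) ≤
          H (3 / 2 * u) := by
        calc ∫ _ in Ioc (5 / 4 * u) (3 / 2 * u), (C * u ^ ε)⁻¹ * (u ^ ((d : ℝ) / 2) * g u) ≤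
            ∫ v in Ioc (5 / 4 * u) (3 / 2 * u), v ^ ((d : ℝ) / 2) * g v := by
              refine setIntegral_mono_on (integrableOn_const (by simp)) (hInt.mono_set fun v hv => ?_)
                measurableSet_Ioc fun v hv => ?_
              · exact lt_of_le_of_lt (by positivity) hv.1
              · have hv0 : u < v := lt_of_le_of_lt (by linarith) hv.1
                have h2 := hC u (v / u) hu h1 ((le_div_iff₀ hu).2 hv.1.le)
                  ((div_le_iff₀ hu).2 hv.2)
                rw [mul_div_cancel₀ _ hu.ne'] at h2
                have h3 : (C * u ^ ε)⁻¹ * g u ≤ g v := by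
                  rw [inv_mul_le_iff₀ (by positivity)]; exact h2
                have h4 : u ^ ((d : ℝ) / 2) ≤ v ^ ((d : ℝ) / 2) :=
                  Real.rpow_le_rpow hu.le hv0.le (by positivity)
                have h5 := hg.pos u hu
                have h6 : 0 ≤ v ^ ((d : ℝ) / 2) := Real.rpow_nonneg (hu.trans hv0).le _
                calc (C * u ^ ε)⁻¹ * (u ^ ((d : ℝ) / 2) * g u) =
                    u ^ ((d : ℝ) / 2) * ((C * u ^ ε)⁻¹ * g u) := by ring
                  _ ≤ v ^ ((d : ℝ) / 2) * g v := by gcongr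
          _ ≤ H (3 / 2 * u) := by
              refine setIntegral_mono_set (hInt.mono_set Ioc_subset_Ioi_self) ?_
                (Ioc_subset_Ioc_left (by positivity)).eventuallyLE
              filter_upwards [ae_restrict_mem measurableSet_Ioc] with v hv
              exact mul_nonneg (Real.rpow_nonneg hv.1.le _) (hg.pos v hv.1).le
      rw [setIntegral_const, Measure.real, Real.volume_Ioc, ENNReal.toReal_ofReal (by linarith),
        smul_eq_mul] at hle
      have h6 : u ^ (ε - 1) = u ^ ε / u := by rw [Real.rpow_sub hu, Real.rpow_one]
      calc u ^ ((d : ℝ) / 2) * g u = 4 * C * u ^ (ε - 1) *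
          ((3 / 2 * u - 5 / 4 * u) * ((C * u ^ ε)⁻¹ * (u ^ ((d : ℝ) / 2) * g u))) := by
            rw [h6]; field_simp; ring
        _ ≤ 4 * C * u ^ (ε - 1) * H (3 / 2 * u) := by gcongr
    · rw [piecewise_eq_of_notMem _ _ _ h1]
      have h2 : H 1 ≤ H (3 / 2 * u) := hmono _ _ (by
        have : 1 < u := not_le.1 h1
        linarith)
      have h3 : 0 ≤ (H 1)⁻¹ * (u ^ ((d : ℝ) / 2) * g u) := by
        have := hg.pos u hu
        positivity
      calc u ^ ((d : ℝ) / 2) * g u = (H 1)⁻¹ * (u ^ ((d : ℝ) / 2) * g u) * H 1 := by field_simp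
        _ ≤ _ := by gcongr

/-- The truncation at 3u/2 keeps exp(-rv/2) ≥ exp(-3ru/4), so dividing by the tilted moment costs
only exp(ru/4). The cut-off must stay below 2u: the loss then remains smaller than the decay
exp(-ru/2) available in `condKernel`. -/
theorem exists_tilted_bound (hg : IsRegularMixingKernel d g) :
    ∃ B : ℝ → ℝ, Measurable B ∧ IntegrableOn B (Ioi 0) ∧ (∀ u, 0 < u → 0 ≤ B u) ∧
      ∀ r u, 0 ≤ r → 0 < u → u ^ ((d : ℝ) / 2) * Real.exp (-(r * u / 2)) * g u ≤
        B u * Real.exp (r * u / 4) *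
          ∫ v in Ioi (0 : ℝ), v ^ ((d : ℝ) / 2) * Real.exp (-(r * v / 2)) * g v := by
  obtain ⟨B, hBm, hBi, hB0, hB⟩ := hg.exists_truncatedMoment_bound
  refine ⟨B, hBm, hBi, hB0, fun r u hr hu => ?_⟩
  have h1 : Real.exp (-(3 / 4 * r * u)) * ∫ v in Ioc 0 (3 / 2 * u), v ^ ((d : ℝ) / 2) * g v ≤
      ∫ v in Ioi (0 : ℝ), v ^ ((d : ℝ) / 2) * Real.exp (-(r * v / 2)) * g v := by
    rw [← integral_const_mul]
    calc ∫ v in Ioc 0 (3 / 2 * u), Real.exp (-(3 / 4 * r * u)) * (v ^ ((d : ℝ) / 2) * g v) ≤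
        ∫ v in Ioc 0 (3 / 2 * u), v ^ ((d : ℝ) / 2) * Real.exp (-(r * v / 2)) * g v := by
          refine setIntegral_mono_on (((hg.integrableOn_rpow_mul le_rfl).mono_set
            Ioc_subset_Ioi_self).const_mul _) ((hg.integrableOn_tilted hr).mono_set
            Ioc_subset_Ioi_self) measurableSet_Ioc fun v hv => ?_
          have h2 := hg.pos v hv.1
          have h3 : Real.exp (-(3 / 4 * r * u)) ≤ Real.exp (-(r * v / 2)) :=
            Real.exp_le_exp.2 (by nlinarith [hv.2])
          have h4 : 0 ≤ v ^ ((d : ℝ) / 2) := Real.rpow_nonneg hv.1.le _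
          calc Real.exp (-(3 / 4 * r * u)) * (v ^ ((d : ℝ) / 2) * g v) =
              v ^ ((d : ℝ) / 2) * Real.exp (-(3 / 4 * r * u)) * g v := by ring
            _ ≤ _ := by gcongr
      _ ≤ _ := by
          refine setIntegral_mono_set (hg.integrableOn_tilted hr) ?_
            Ioc_subset_Ioi_self.eventuallyLE
          filter_upwards [ae_restrict_mem measurableSet_Ioi] with v (hv : 0 < v)
          have := hg.pos v hv
          change (0 : ℝ) ≤ v ^ ((d : ℝ) / 2) * Real.exp (-(r * v / 2)) * g v
          positivity
  have h5 : Real.exp (-(r * u / 2)) = Real.exp (r * u / 4) * Real.exp (-(3 / 4 * r * u)) := by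
    rw [← Real.exp_add]; congr 1; ring
  calc u ^ ((d : ℝ) / 2) * Real.exp (-(r * u / 2)) * g u =
      (u ^ ((d : ℝ) / 2) * g u) * (Real.exp (r * u / 4) * Real.exp (-(3 / 4 * r * u))) := by
        rw [h5]; ring
    _ ≤ (B u * ∫ v in Ioc 0 (3 / 2 * u), v ^ ((d : ℝ) / 2) * g v) *
        (Real.exp (r * u / 4) * Real.exp (-(3 / 4 * r * u))) := by
        exact mul_le_mul_of_nonneg_right (hB u hu) (by positivity)
    _ = B u * Real.exp (r * u / 4) *
        (Real.exp (-(3 / 4 * r * u)) * ∫ v in Ioc 0 (3 / 2 * u), v ^ ((d : ℝ) / 2) * g v) := by ring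
    _ ≤ _ := mul_le_mul_of_nonneg_left h1 (mul_nonneg (hB0 u hu) (Real.exp_nonneg _))

end IsRegularMixingKernel

end Mixing


/-! ### The four families of mixing densities are regular -/

section MixingFamilies

open Filter Topology Asymptotics

variable {d : ℕ}

/-- A power factor is harmless: it shifts the exponents at 0 and ∞, and t^s is bounded below for t
in [5/4, 3/2]. So only the exponential factor E has to be examined. -/
theorem isRegularMixingKernel_rpow_mul (s : ℝ) {E : ℝ → ℝ} (hm : Measurable E)
    (hpos : ∀ u, 0 < u → 0 < E u) (hc : ContinuousOn E (Ioi 0))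
    (h0 : ∀ b : ℝ, E =O[𝓝[>] 0] fun u => u ^ b)
    (htop : ∃ b : ℝ, (d : ℝ) / 2 + 1 < b ∧ E =O[atTop] fun u => u ^ (-b - s))
    (hratio : ∃ ε : ℝ, 0 < ε ∧ ∃ C : ℝ, ∀ u t : ℝ, 0 < u → u ≤ 1 → 5 / 4 ≤ t → t ≤ 3 / 2 →
      E u ≤ C * u ^ ε * E (u * t)) :
    IsRegularMixingKernel d fun u => u ^ s * E u where
  measurable := (measurable_id.pow_const _).mul hm
  pos u hu := mul_pos (Real.rpow_pos_of_pos hu _) (hpos u hu)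
  continuousOn := (continuousOn_id.rpow_const fun u hu => Or.inl (ne_of_gt hu)).mul hc
  isBigO_zero b := by
    refine ((isBigO_refl (fun u : ℝ => u ^ s) _).mul (h0 (b - s))).congr' EventuallyEq.rfl ?_
    filter_upwards [self_mem_nhdsWithin] with u (hu : 0 < u)
    rw [← Real.rpow_add hu]; congr 1; ring
  isBigO_top := by
    obtain ⟨b, hb, hO⟩ := htop
    refine ⟨b, hb, ((isBigO_refl (fun u : ℝ => u ^ s) _).mul hO).congr' EventuallyEq.rfl ?_⟩
    filter_upwards [eventually_gt_atTop 0] with u hu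
    rw [← Real.rpow_add hu]; congr 1; ring
  ratio := by
    obtain ⟨ε, hε, C, h⟩ := hratio
    refine ⟨ε, hε, (3 / 2) ^ |s| * C, fun u t hu hu1 ht ht' => ?_⟩
    have ht0 : 0 < t := by linarith
    have h1 : (1 : ℝ) ≤ (3 / 2) ^ |s| * t ^ s := by
      have h2 : t ^ (-s) ≤ (3 / 2) ^ |s| :=
        (Real.rpow_le_rpow_of_exponent_le (by linarith) (neg_le_abs s)).trans
          (Real.rpow_le_rpow ht0.le ht' (abs_nonneg s))
      calc (1 : ℝ) = t ^ (-s) * t ^ s := by rw [← Real.rpow_add ht0]; simp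
        _ ≤ _ := by gcongr
    have h3 := h u t hu hu1 ht ht'
    have h4 : 0 ≤ C * u ^ ε * E (u * t) := (hpos u hu).le.trans h3
    calc u ^ s * E u ≤ u ^ s * (C * u ^ ε * E (u * t)) := by gcongr
      _ ≤ ((3 / 2) ^ |s| * t ^ s) * (u ^ s * (C * u ^ ε * E (u * t))) :=
          le_mul_of_one_le_left (by positivity) h1
      _ = _ := by rw [Real.mul_rpow hu.le ht0.le]; ring

/-- Converts the exponential gain between u and ut into the power u^ε of the ratio condition. -/
theorem exp_neg_le_inv {x : ℝ} (hx : 0 < x) : Real.exp (-x) ≤ x⁻¹ := by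
  rw [Real.exp_neg]
  exact inv_anti₀ hx (by linarith [Real.add_one_le_exp x])

theorem exp_neg_div_isBigO_one {c : ℝ} (hc : 0 ≤ c) {f : ℝ → ℝ} (hf : ∀ u, 0 < u → 0 < f u) :
    (fun u : ℝ => Real.exp (-(c / f u))) =O[atTop] fun _ => (1 : ℝ) := by
  refine IsBigO.of_bound 1 ?_
  filter_upwards [eventually_gt_atTop 0] with u hu
  rw [Real.norm_eq_abs, Real.abs_exp, norm_one, mul_one, Real.exp_le_one_iff]
  have := hf u hu
  have : 0 ≤ c / f u := by positivity
  linarith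

theorem isRegularMixingKernel_frechet {α γ : ℝ} (hα : (d : ℝ) / 2 < α) (hγ : 0 < γ) :
    IsRegularMixingKernel d fun u => u ^ (-(α + 1)) * Real.exp (-(γ ^ α / u ^ α)) := by
  have hα0 : 0 < α := lt_of_le_of_lt (by positivity) hα
  have hc : 0 < γ ^ α := Real.rpow_pos_of_pos hγ _
  refine isRegularMixingKernel_rpow_mul _ (by fun_prop) (fun u _ => Real.exp_pos _) ?_ ?_ ?_ ?_
  · refine Real.continuous_exp.comp_continuousOn (ContinuousOn.neg
      (continuousOn_const.div (continuousOn_id.rpow_const fun u hu => Or.inl (ne_of_gt hu))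
        fun u hu => (Real.rpow_pos_of_pos hu _).ne'))
  · intro b
    have ht : Tendsto (fun u : ℝ => u ^ α) (𝓝[>] 0) (𝓝[>] 0) := by
      refine tendsto_nhdsWithin_iff.2 ⟨?_, ?_⟩
      · have := (Real.continuousAt_rpow_const 0 α (Or.inr hα0.le)).tendsto
        rw [Real.zero_rpow hα0.ne'] at this
        exact this.mono_left nhdsWithin_le_nhds
      · filter_upwards [self_mem_nhdsWithin] with u hu using Real.rpow_pos_of_pos hu _
    refine ((exp_neg_div_isBigO_nhdsGT_zero hc (b / α)).comp_tendsto ht).congr' EventuallyEq.rfl ?_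
    filter_upwards [self_mem_nhdsWithin] with u (hu : 0 < u)
    rw [Function.comp_apply, ← Real.rpow_mul hu.le, mul_div_cancel₀ _ hα0.ne']
  -- The exponential factor tends to 1, so the tail is u^(-(α+1)); here α > d/2 is essential.
  · refine ⟨α + 1, by linarith, ?_⟩
    simpa using exp_neg_div_isBigO_one hc.le (f := fun u => u ^ α)
      fun u hu => Real.rpow_pos_of_pos hu _
  -- q is the least fraction of the exponent gained: 1 - t^(-α) ≥ q for t ≥ 5/4.
  · set q : ℝ := 1 - ((5 / 4 : ℝ) ^ α)⁻¹ with hq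
    have hq0 : 0 < q := by
      have := inv_lt_one_of_one_lt₀ (Real.one_lt_rpow (by norm_num : (1 : ℝ) < 5 / 4) hα0)
      linarith
    refine ⟨α, hα0, (γ ^ α * q)⁻¹, fun u t hu hu1 ht ht' => ?_⟩
    have ht0 : 0 < t := by linarith
    have hua : 0 < u ^ α := Real.rpow_pos_of_pos hu _
    have hta : 0 < t ^ α := Real.rpow_pos_of_pos ht0 _
    have h1 : q ≤ 1 - (t ^ α)⁻¹ := by
      have := inv_anti₀ (Real.rpow_pos_of_pos (by norm_num : (0 : ℝ) < 5 / 4) α)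
        (Real.rpow_le_rpow (by norm_num) ht hα0.le)
      linarith
    have h2 : -(γ ^ α / u ^ α) ≤ -(γ ^ α * q / u ^ α) + -(γ ^ α / (u * t) ^ α) := by
      rw [Real.mul_rpow hu.le ht0.le]
      have h3 : γ ^ α * q / u ^ α ≤ γ ^ α * (1 - (t ^ α)⁻¹) / u ^ α := by gcongr
      have h4 : γ ^ α * (1 - (t ^ α)⁻¹) / u ^ α = γ ^ α / u ^ α - γ ^ α / (u ^ α * t ^ α) := by
        field_simp
      linarith
    calc Real.exp (-(γ ^ α / u ^ α)) ≤
        Real.exp (-(γ ^ α * q / u ^ α)) * Real.exp (-(γ ^ α / (u * t) ^ α)) := by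
          rw [← Real.exp_add]; exact Real.exp_le_exp.2 h2
      _ ≤ (γ ^ α * q / u ^ α)⁻¹ * Real.exp (-(γ ^ α / (u * t) ^ α)) := by
          gcongr; exact exp_neg_le_inv (by positivity)
      _ = _ := by rw [inv_div, div_eq_inv_mul]

theorem isRegularMixingKernel_gig (v : ℝ) {α γ : ℝ} (hα : 0 < α) (hγ : 0 < γ) :
    IsRegularMixingKernel d fun u =>
      u ^ (v - 1) * Real.exp (-(1 / 2) * (α * u + γ / u)) := by
  refine isRegularMixingKernel_rpow_mul _ (by fun_prop) (fun u _ => Real.exp_pos _) ?_ ?_ ?_ ?_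
  · refine Real.continuous_exp.comp_continuousOn (continuousOn_const.mul
      ((continuousOn_const.mul continuousOn_id).add
        (continuousOn_const.div continuousOn_id fun u hu => ne_of_gt hu)))
  · intro b
    refine IsBigO.trans (IsBigO.of_bound 1 ?_)
      (exp_neg_div_isBigO_nhdsGT_zero (half_pos hγ) b)
    filter_upwards [self_mem_nhdsWithin] with u (hu : 0 < u)
    rw [one_mul, Real.norm_eq_abs, Real.norm_eq_abs, Real.abs_exp, Real.abs_exp, Real.exp_le_exp]
    have : 0 < α * u := by positivity
    rw [show γ / 2 / u = γ / u / 2 by ring]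
    linarith
  · refine ⟨(d : ℝ) / 2 + 2, by linarith, ?_⟩
    refine IsBigO.trans (IsBigO.of_bound 1 ?_)
      (isLittleO_exp_neg_mul_rpow_atTop (half_pos hα) _).isBigO
    filter_upwards [eventually_gt_atTop 0] with u hu
    rw [one_mul, Real.norm_eq_abs, Real.norm_eq_abs, Real.abs_exp, Real.abs_exp, Real.exp_le_exp]
    have : 0 < γ / u := by positivity
    linarith
  -- From t ≥ 5/4, half of γ/u drops by at least γ/(10u); from t ≤ 3/2 and u ≤ 1, half of αu grows
  -- by at most α/4.
  · refine ⟨1, one_pos, Real.exp (α / 4) * (γ / 10)⁻¹, fun u t hu hu1 ht ht' => ?_⟩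
    have ht0 : 0 < t := by linarith
    have h1 : γ / (u * t) ≤ 4 / 5 * (γ / u) := by
      rw [div_le_iff₀ (by positivity)]
      have : γ = γ / u * u := by field_simp
      have h0 : 0 < γ := hγ
      calc γ = 4 / 5 * (γ / u) * (u * (5 / 4)) := by field_simp
        _ ≤ 4 / 5 * (γ / u) * (u * t) := by gcongr
    have h2 : α * (u * t) ≤ α * u + α / 2 := by nlinarith [mul_pos hα hu, mul_le_mul_of_nonneg_left hu1 hα.le]
    have h3 : -(1 / 2) * (α * u + γ / u) ≤
        α / 4 + (-(γ / 10 / u) + -(1 / 2) * (α * (u * t) + γ / (u * t))) := by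
      rw [show γ / 10 / u = γ / u / 10 by ring]
      linarith
    calc Real.exp (-(1 / 2) * (α * u + γ / u)) ≤ Real.exp (α / 4) * (Real.exp (-(γ / 10 / u)) *
          Real.exp (-(1 / 2) * (α * (u * t) + γ / (u * t)))) := by
          rw [← Real.exp_add, ← Real.exp_add]; exact Real.exp_le_exp.2 h3
      _ ≤ Real.exp (α / 4) * ((γ / 10 / u)⁻¹ *
          Real.exp (-(1 / 2) * (α * (u * t) + γ / (u * t)))) := by
          gcongr; exact exp_neg_le_inv (by positivity)
      _ = _ := by rw [inv_div, Real.rpow_one]; ring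

theorem isRegularMixingKernel_invGamma {α γ : ℝ} (hα : (d : ℝ) / 2 < α) (hγ : 0 < γ) :
    IsRegularMixingKernel d fun u => u ^ (-α - 1) * Real.exp (-(γ / u)) := by
  refine isRegularMixingKernel_rpow_mul _ (by fun_prop) (fun u _ => Real.exp_pos _) ?_
    (exp_neg_div_isBigO_nhdsGT_zero hγ) ?_ ?_
  · exact Real.continuous_exp.comp_continuousOn (continuousOn_const.div continuousOn_id
      fun u hu => ne_of_gt hu).neg
  · refine ⟨α + 1, by linarith, ?_⟩
    have := exp_neg_div_isBigO_one hγ.le (f := fun u => u) fun u hu => hu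
    refine this.congr_right fun u => ?_
    rw [show -(α + 1) - (-α - 1) = 0 by ring, Real.rpow_zero]
  -- The exponent gains the fraction 1 - 4/5 of γ/u, since t ≥ 5/4.
  · refine ⟨1, one_pos, (γ / 5)⁻¹, fun u t hu hu1 ht ht' => ?_⟩
    have ht0 : 0 < t := by linarith
    have h1 : γ / (u * t) ≤ 4 / 5 * (γ / u) := by
      rw [div_le_iff₀ (by positivity)]
      calc γ = 4 / 5 * (γ / u) * (u * (5 / 4)) := by field_simp
        _ ≤ 4 / 5 * (γ / u) * (u * t) := by gcongr
    calc Real.exp (-(γ / u)) ≤ Real.exp (-(γ / 5 / u)) * Real.exp (-(γ / (u * t))) := by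
          rw [← Real.exp_add, Real.exp_le_exp, show γ / 5 / u = γ / u / 5 by ring]
          linarith
      _ ≤ (γ / 5 / u)⁻¹ * Real.exp (-(γ / (u * t))) := by
          gcongr; exact exp_neg_le_inv (by positivity)
      _ = _ := by rw [inv_div, Real.rpow_one]; ring

/-- Completing the square in log u. As b is arbitrary, this controls both ends of the half-line. -/
theorem exp_neg_sq_log_le (μ : ℝ) {γ : ℝ} (hγ : 0 < γ) (b : ℝ) {u : ℝ} (hu : 0 < u) :
    Real.exp (-(1 / (2 * γ)) * (Real.log u - μ) ^ 2) ≤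
      Real.exp (γ * b ^ 2 / 2 - b * μ) * u ^ b := by
  rw [Real.rpow_def_of_pos hu, ← Real.exp_add, Real.exp_le_exp]
  have h : γ * b ^ 2 / 2 - b * μ + Real.log u * b + 1 / (2 * γ) * (Real.log u - μ) ^ 2 =
      1 / (2 * γ) * (Real.log u - μ + γ * b) ^ 2 := by
    field_simp; ring
  have : 0 ≤ 1 / (2 * γ) * (Real.log u - μ + γ * b) ^ 2 := by positivity
  linarith

theorem isRegularMixingKernel_logNormal (μ : ℝ) {γ : ℝ} (hγ : 0 < γ) :
    IsRegularMixingKernel d fun u =>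
      1 / u * Real.exp (-(1 / (2 * γ)) * (Real.log u - μ) ^ 2) := by
  have hO : ∀ (b u : ℝ), 0 < u → ‖Real.exp (-(1 / (2 * γ)) * (Real.log u - μ) ^ 2)‖ ≤
      Real.exp (γ * b ^ 2 / 2 - b * μ) * ‖u ^ b‖ := fun b u hu => by
    rw [Real.norm_eq_abs, Real.abs_exp, Real.norm_of_nonneg (Real.rpow_nonneg hu.le _)]
    exact exp_neg_sq_log_le μ hγ b hu
  have key := isRegularMixingKernel_rpow_mul (d := d) (-1)
    (E := fun u => Real.exp (-(1 / (2 * γ)) * (Real.log u - μ) ^ 2)) (by fun_prop)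
    (fun u _ => Real.exp_pos _) ?_ ?_ ?_ ?_
  · simpa only [Real.rpow_neg_one, one_div] using key
  · exact Real.continuous_exp.comp_continuousOn (continuousOn_const.mul
      (((Real.continuousOn_log.mono fun u hu => ne_of_gt hu).sub continuousOn_const).pow 2))
  · intro b
    refine IsBigO.of_bound (Real.exp (γ * b ^ 2 / 2 - b * μ)) ?_
    filter_upwards [self_mem_nhdsWithin] with u hu using hO b u hu
  · refine ⟨(d : ℝ) / 2 + 2, by linarith,
      IsBigO.of_bound (Real.exp (γ * (-((d : ℝ) / 2 + 2) - -1) ^ 2 / 2 -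
        (-((d : ℝ) / 2 + 2) - -1) * μ)) ?_⟩
    filter_upwards [eventually_gt_atTop 0] with u hu using hO _ u hu
  · set ℓ := Real.log (5 / 4) with hℓ
    have hℓ0 : 0 < ℓ := Real.log_pos (by norm_num)
    set L := Real.log (3 / 2) with hL
    -- Replacing log u by log u + log t adds the cross term 2 log t log u ≤ 2ℓ log u to the square,
    -- as log u ≤ 0; divided by 2γ it gives u^(ℓ/γ). The other new terms are bounded by L² + 2L|μ|.
    refine ⟨ℓ / γ, by positivity, Real.exp (1 / (2 * γ) * (L ^ 2 + 2 * L * |μ|)),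
      fun u t hu hu1 ht ht' => ?_⟩
    have ht0 : 0 < t := by linarith
    rw [Real.rpow_def_of_pos hu, ← Real.exp_add, ← Real.exp_add, Real.exp_le_exp,
      Real.log_mul hu.ne' ht0.ne']
    have h1 : ℓ ≤ Real.log t := Real.log_le_log (by norm_num) ht
    have h2 : Real.log t ≤ L := Real.log_le_log ht0 ht'
    have h3 : Real.log u ≤ 0 := Real.log_nonpos hu.le hu1
    have h4 : 2 * Real.log t * Real.log u ≤ 2 * ℓ * Real.log u := by nlinarith
    have h5 : Real.log t ^ 2 ≤ L ^ 2 := by nlinarith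
    have h6 : -(2 * Real.log t * μ) ≤ 2 * L * |μ| := by
      nlinarith [neg_abs_le μ, abs_nonneg μ]
    have h7 : 0 < 1 / (2 * γ) := by positivity
    have h8 : Real.log u * (ℓ / γ) = 1 / (2 * γ) * (2 * ℓ * Real.log u) := by field_simp
    rw [h8]
    nlinarith [mul_le_mul_of_nonneg_left
      (show (Real.log u + Real.log t - μ) ^ 2 - (Real.log u - μ) ^ 2 ≤
        L ^ 2 + 2 * L * |μ| + 2 * ℓ * Real.log u by nlinarith) h7.le]

end MixingFamilies


/-! ### Joint density with the latent variables and propriety of the posterior -/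

section Chain

variable {n p d : ℕ} {X : Matrix (Fin n) (Fin p) ℝ} {y : Matrix (Fin n) (Fin d) ℝ} {a : ℝ}
  {h : ℝ → ℝ}

/-- Lebesgue measure on the latent variables. -/
def latentMeasure (n : ℕ) : Measure (Fin n → ℝ) := volume.restrict {z | ∀ i, 0 < z i}

/-- The normalizing constant of the density of a latent variable. -/
def tiltedMoment (d : ℕ) (h : ℝ → ℝ) (r : ℝ) : ℝ :=
  ∫ u in Ioi (0 : ℝ), u ^ ((d : ℝ) / 2) * Real.exp (-(r * u / 2)) * h u

/-- The product of the normalizing constants of the latent variables. -/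
def tiltedProd (X : Matrix (Fin n) (Fin p) ℝ) (y : Matrix (Fin n) (Fin d) ℝ) (h : ℝ → ℝ)
    (x : Param p d) : ℝ := ∏ i, tiltedMoment d h (sqResidual X y x i)

/-- The factor of the joint density that depends on the latent variables only. -/
def latentWeight (d : ℕ) (h : ℝ → ℝ) (z : Fin n → ℝ) : ℝ := ∏ i, z i ^ ((d : ℝ) / 2) * h (z i)

/-- The exponential factor of the joint density. -/
def expKernel (X : Matrix (Fin n) (Fin p) ℝ) (y : Matrix (Fin n) (Fin d) ℝ) (z : Fin n → ℝ)
    (x : Param p d) : ℝ := Real.exp (-(1 / 2) * ∑ i, z i * sqResidual X y x i)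

/-- The integral of `condKernel` over the state space. -/
def condMass (X : Matrix (Fin n) (Fin p) ℝ) (y : Matrix (Fin n) (Fin d) ℝ) (a : ℝ)
    (z : Fin n → ℝ) : ℝ :=
  (∫⁻ x, ENNReal.ofReal (condKernel X y a z x) ∂(stateMeasure p d)).toReal

instance (n : ℕ) : SFinite (latentMeasure n) := by unfold latentMeasure; infer_instance

instance (p d : ℕ) : SFinite (stateMeasure p d) := by unfold stateMeasure; infer_instance

theorem latentMeasure_eq_pi (n : ℕ) :
    latentMeasure n = Measure.pi fun _ => volume.restrict (Ioi (0 : ℝ)) := by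
  rw [latentMeasure, ← Measure.restrict_pi_pi, volume_pi]
  congr 1
  ext z
  simp

theorem ae_latentMeasure (n : ℕ) : ∀ᵐ z ∂(latentMeasure n), ∀ i, 0 < z i := by
  have hs : MeasurableSet {z : Fin n → ℝ | ∀ i, 0 < z i} := by
    rw [Set.ofPred_forall]
    exact MeasurableSet.iInter fun i => measurableSet_lt measurable_const (measurable_pi_apply i)
  exact ae_restrict_mem hs

theorem ae_stateMeasure (p d : ℕ) : ∀ᵐ x ∂(stateMeasure p d), x ∈ stateSpace p d :=
  ae_restrict_mem (measurableSet_stateSpace p d)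

theorem condKernel_eq (z : Fin n → ℝ) (x : Param p d) :
    condKernel X y a z x = x.sigma.det ^ (-((n : ℝ) / 2 + a)) * expKernel X y z x := rfl

theorem prod_tilted_eq (z : Fin n → ℝ) (x : Param p d) :
    ∏ i, (z i ^ ((d : ℝ) / 2) * Real.exp (-(sqResidual X y x i * z i / 2)) * h (z i)) =
      latentWeight d h z * expKernel X y z x := by
  rw [latentWeight, expKernel, Finset.mul_sum, Real.exp_sum, ← Finset.prod_mul_distrib]
  refine Finset.prod_congr rfl fun i _ => ?_
  rw [show -(1 / 2) * (z i * sqResidual X y x i) = -(sqResidual X y x i * z i / 2) by ring]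
  ring

theorem latentWeight_pos (hh : IsRegularMixingKernel d h) {z : Fin n → ℝ} (hz : ∀ i, 0 < z i) :
    0 < latentWeight d h z :=
  Finset.prod_pos fun i _ => mul_pos (Real.rpow_pos_of_pos (hz i) _) (hh.pos _ (hz i))

theorem tiltedProd_pos (hh : IsRegularMixingKernel d h) {x : Param p d} (hx : x ∈ stateSpace p d) :
    0 < tiltedProd X y h x :=
  Finset.prod_pos fun i _ => hh.integral_tilted_pos (sqResidual_nonneg hx i)

theorem integrable_weight_mul_expKernel (hh : IsRegularMixingKernel d h) {x : Param p d}
    (hx : x ∈ stateSpace p d) :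
    Integrable (fun z => latentWeight d h z * expKernel X y z x) (latentMeasure n) := by
  rw [latentMeasure_eq_pi]
  simp only [← prod_tilted_eq]
  exact Integrable.fintype_prod_dep fun i => hh.integrableOn_tilted (sqResidual_nonneg hx i)

theorem integral_weight_mul_expKernel (x : Param p d) :
    ∫ z, latentWeight d h z * expKernel X y z x ∂(latentMeasure n) = tiltedProd X y h x := by
  rw [latentMeasure_eq_pi]
  simp only [← prod_tilted_eq]
  exact integral_fintype_prod_eq_prod
    (fun i u => u ^ ((d : ℝ) / 2) * Real.exp (-(sqResidual X y x i * u / 2)) * h u)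

theorem prod_latentDensity (z : Fin n → ℝ) (x : Param p d) :
    ∏ i, latentDensity d h (sqResidual X y x i) (z i) =
      latentWeight d h z * expKernel X y z x / tiltedProd X y h x := by
  simp only [latentDensity, normalized]
  rw [Finset.prod_mul_distrib, prod_tilted_eq, Finset.prod_inv_distrib]
  exact (div_eq_inv_mul _ _).symm

/-- The constant factor of the likelihood. -/
def likelihoodConst (n d : ℕ) : ℝ := (((2 * Real.pi) ^ ((d : ℝ) / 2)) ^ n)⁻¹

theorem likelihoodConst_pos (n d : ℕ) : 0 < likelihoodConst n d := by
  unfold likelihoodConst; positivity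

theorem likelihood_mul_priorDensity {x : Param p d} (hx : x ∈ stateSpace p d) :
    likelihood X y h x * priorDensity a x =
      likelihoodConst n d * (x.sigma.det ^ (-((n : ℝ) / 2 + a)) * tiltedProd X y h x) := by
  have hx' : x.sigma.PosDef := hx
  have h1 : ∀ i : Fin n, ∫ u in Ioi (0 : ℝ),
      u ^ ((d : ℝ) / 2) / ((2 * Real.pi) ^ ((d : ℝ) / 2) * x.sigma.det ^ (1 / 2 : ℝ)) *
      Real.exp (-(u / 2) * sqResidual X y x i) * h u =
      ((2 * Real.pi) ^ ((d : ℝ) / 2) * x.sigma.det ^ (1 / 2 : ℝ))⁻¹ *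
        tiltedMoment d h (sqResidual X y x i) := by
    intro i
    rw [tiltedMoment, ← integral_const_mul]
    refine integral_congr_ae (.of_forall fun u => ?_)
    simp only
    rw [show -(u / 2) * sqResidual X y x i = -(sqResidual X y x i * u / 2) by ring]
    ring
  rw [likelihood, Finset.prod_congr rfl fun i _ => h1 i, Finset.prod_mul_distrib,
    Finset.prod_const, Finset.card_univ, Fintype.card_fin, priorDensity, inv_pow, mul_pow, mul_inv,
    neg_add, Real.rpow_add hx'.det_pos]
  have h2 : ((x.sigma.det ^ (1 / 2 : ℝ)) ^ n)⁻¹ = x.sigma.det ^ (-((n : ℝ) / 2)) := by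
    rw [← Real.rpow_natCast, ← Real.rpow_mul hx'.det_pos.le, ← Real.rpow_neg hx'.det_pos.le]
    congr 1; ring
  rw [h2, likelihoodConst, tiltedProd]
  ring

theorem measurable_tiltedMoment (hh : Measurable h) : Measurable (tiltedMoment d h) := by
  have : StronglyMeasurable fun r : ℝ => ∫ u in Ioi (0 : ℝ),
      u ^ ((d : ℝ) / 2) * Real.exp (-(r * u / 2)) * h u := by
    refine StronglyMeasurable.integral_prod_right
      (f := fun r u : ℝ => u ^ ((d : ℝ) / 2) * Real.exp (-(r * u / 2)) * h u) ?_
    exact (((measurable_snd.pow_const _).mul (by fun_prop)).mul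
      (hh.comp measurable_snd)).stronglyMeasurable
  exact this.measurable

theorem measurable_tiltedProd (hh : Measurable h) : Measurable (tiltedProd (p := p) X y h) :=
  Finset.measurable_prod _ fun i _ => (measurable_tiltedMoment hh).comp (measurable_sqResidual X y i)

theorem measurable_latentWeight (hh : Measurable h) :
    Measurable (latentWeight d h : (Fin n → ℝ) → ℝ) :=
  Finset.measurable_prod _ fun i _ => ((measurable_pi_apply i).pow_const _).mul
    (hh.comp (measurable_pi_apply i))

theorem measurable_expKernel :
    Measurable fun q : (Fin n → ℝ) × Param p d => expKernel X y q.1 q.2 :=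
  Measurable.exp (Measurable.const_mul (Finset.measurable_sum _ fun i _ =>
    ((measurable_pi_apply i).comp measurable_fst).mul
      ((measurable_sqResidual X y i).comp measurable_snd)) _)

/-- Writing the normalization as an integral gives measurability in z from Tonelli, with no study of
the matrices in `condNorm`; the two agree for positive z. -/
theorem measurable_condMass : Measurable (condMass X y a) :=
  (Measurable.lintegral_prod_right' (measurable_condKernel X y a).ennreal_ofReal).ennreal_toReal

theorem condMass_eq (hr : (Matrix.fromCols X y).rank = p + d) (ha : (p : ℝ) + 2 * d - 2 * a < n)
    {z : Fin n → ℝ} (hz : ∀ i, 0 < z i) : condMass X y a z = condNorm X y a z := by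
  rw [condMass, lintegral_condKernel hr ha hz, ENNReal.toReal_ofReal (condNorm_pos hr ha hz).le]

theorem lintegral_condKernel_eq_condMass (hr : (Matrix.fromCols X y).rank = p + d)
    (ha : (p : ℝ) + 2 * d - 2 * a < n) {z : Fin n → ℝ} (hz : ∀ i, 0 < z i) :
    ∫⁻ x, ENNReal.ofReal (condKernel X y a z x) ∂(stateMeasure p d) =
      ENNReal.ofReal (condMass X y a z) := by
  rw [condMass_eq hr ha hz, lintegral_condKernel hr ha hz]

theorem condMass_pos (hr : (Matrix.fromCols X y).rank = p + d)
    (ha : (p : ℝ) + 2 * d - 2 * a < n) {z : Fin n → ℝ} (hz : ∀ i, 0 < z i) :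
    0 < condMass X y a z := by
  rw [condMass_eq hr ha hz]; exact condNorm_pos hr ha hz

theorem lintegral_weight_mul_condKernel (hh : IsRegularMixingKernel d h) {x : Param p d}
    (hx : x ∈ stateSpace p d) :
    ∫⁻ z, ENNReal.ofReal (latentWeight d h z * condKernel X y a z x) ∂(latentMeasure n) =
      ENNReal.ofReal (x.sigma.det ^ (-((n : ℝ) / 2 + a)) * tiltedProd X y h x) := by
  have hx' : x.sigma.PosDef := hx
  rw [← integral_weight_mul_expKernel, ← integral_const_mul, ofReal_integral_eq_lintegral_ofReal
    ((integrable_weight_mul_expKernel hh hx).const_mul _)]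
  · refine lintegral_congr fun z => ?_
    rw [condKernel_eq, mul_left_comm]
  · filter_upwards [ae_latentMeasure n] with z hz
    exact mul_nonneg (Real.rpow_nonneg hx'.det_pos.le _)
      (mul_nonneg (latentWeight_pos hh hz).le (Real.exp_nonneg _))

/-- Tonelli: the latent variables are restored and (β, Σ) is integrated out first. -/
theorem marginal_eq (hr : (Matrix.fromCols X y).rank = p + d) (ha : (p : ℝ) + 2 * d - 2 * a < n)
    (hh : IsRegularMixingKernel d h) :
    marginal X y a h = ENNReal.ofReal (likelihoodConst n d) *
      ∫⁻ z, ENNReal.ofReal (latentWeight d h z * condMass X y a z) ∂(latentMeasure n) := by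
  have h1 : marginal X y a h = ∫⁻ x, ENNReal.ofReal (likelihoodConst n d) *
      ∫⁻ z, ENNReal.ofReal (latentWeight d h z * condKernel X y a z x) ∂(latentMeasure n)
        ∂(stateMeasure p d) := by
    refine lintegral_congr_ae ?_
    filter_upwards [ae_stateMeasure p d] with x hx
    rw [lintegral_weight_mul_condKernel hh hx, likelihood_mul_priorDensity hx,
      ENNReal.ofReal_mul (likelihoodConst_pos n d).le]
  rw [h1, lintegral_const_mul' _ _ ENNReal.ofReal_ne_top, lintegral_lintegral_swap]
  · congr 1
    refine lintegral_congr_ae ?_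
    filter_upwards [ae_latentMeasure n] with z hz
    have hw := latentWeight_pos hh hz
    simp only [ENNReal.ofReal_mul hw.le]
    rw [lintegral_const_mul' _ _ ENNReal.ofReal_ne_top, lintegral_condKernel_eq_condMass hr ha hz]
  · exact (((measurable_latentWeight hh.measurable).comp measurable_snd).mul
      ((measurable_condKernel X y a).comp measurable_swap)).ennreal_ofReal.aemeasurable

theorem condDegree_nonneg (hd : 1 ≤ d) (ha : (p : ℝ) + 2 * d - 2 * a < n) :
    0 ≤ condDegree n p d a := by
  have h1 : (1 : ℝ) ≤ d := by exact_mod_cast hd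
  unfold condDegree
  have h2 : 0 ≤ ((n : ℝ) - p + 2 * a - d - 1) / 2 := by linarith
  positivity

/-- If zᵢ is the smallest weight, monotonicity and homogeneity bound the normalization by zᵢ^(-s)
times its value at the vector of ones. Summing over i removes the dependence on the minimizer and
leaves products of one-dimensional moments. -/
theorem lintegral_weight_mul_condMass_ne_top (hd : 1 ≤ d)
    (hr : (Matrix.fromCols X y).rank = p + d) (ha : (p : ℝ) + 2 * d - 2 * a < n)
    (hh : IsRegularMixingKernel d h) :
    ∫⁻ z, ENNReal.ofReal (latentWeight d h z * condMass X y a z) ∂(latentMeasure n) ≠ ⊤ := by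
  -- Needed for a smallest zᵢ to exist; it follows from p + d = rank ≤ n and d ≥ 1.
  have hn : 0 < n := by
    have := Matrix.rank_le_card_height (Matrix.fromCols X y)
    rw [Fintype.card_fin] at this
    omega
  have : Nonempty (Fin n) := ⟨⟨0, hn⟩⟩
  set s := condDegree n p d a with hs
  have hs0 : 0 ≤ s := condDegree_nonneg hd ha
  have hint : ∀ i : Fin n, Integrable (fun z : Fin n → ℝ =>
      latentWeight d h z * z i ^ (-s)) (latentMeasure n) := by
    intro i
    have h1 : Integrable (fun z : Fin n → ℝ =>
        ∏ j, (z j ^ ((d : ℝ) / 2 + if j = i then -s else 0) * h (z j))) (latentMeasure n) := by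
      rw [latentMeasure_eq_pi]
      refine Integrable.fintype_prod_dep fun j => hh.integrableOn_rpow_mul ?_
      split_ifs <;> linarith
    refine h1.congr ?_
    filter_upwards [ae_latentMeasure n] with z hz
    have h2 : ∀ j, z j ^ ((d : ℝ) / 2 + if j = i then -s else 0) * h (z j) =
        (z j ^ ((d : ℝ) / 2) * h (z j)) * if j = i then z i ^ (-s) else 1 := by
      intro j
      rw [Real.rpow_add (hz j)]
      split_ifs with hj
      · subst hj; ring
      · simp
    rw [Finset.prod_congr rfl fun j _ => h2 j, Finset.prod_mul_distrib, latentWeight]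
    simp
  have hbound : Integrable (fun z : Fin n → ℝ =>
      condNorm X y a (fun _ => 1) * ∑ i, latentWeight d h z * z i ^ (-s)) (latentMeasure n) :=
    (integrable_finsetSum _ fun i _ => hint i).const_mul _
  refine ne_top_of_le_ne_top hbound.lintegral_lt_top.ne (lintegral_mono_ae ?_)
  filter_upwards [ae_latentMeasure n] with z hz
  refine ENNReal.ofReal_le_ofReal ?_
  have hw := latentWeight_pos hh hz
  obtain ⟨i, hi⟩ := Finite.exists_min z
  have h1 : condNorm X y a z ≤ z i ^ (-s) * condNorm X y a (fun _ => 1) := by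
    rw [← condNorm_smul hr a (hz i) (z := fun _ => 1) fun _ => one_pos]
    refine condNorm_anti hr ha (fun j => by simpa using hz i) fun j => ?_
    simpa using hi j
  have h2 : latentWeight d h z * z i ^ (-s) ≤ ∑ j, latentWeight d h z * z j ^ (-s) :=
    Finset.single_le_sum (f := fun j => latentWeight d h z * z j ^ (-s))
      (fun j _ => mul_nonneg hw.le (Real.rpow_nonneg (hz j).le _)) (Finset.mem_univ i)
  have h3 : 0 < condNorm X y a (fun _ => 1) := condNorm_pos hr ha fun _ => one_pos
  rw [condMass_eq hr ha hz]
  calc latentWeight d h z * condNorm X y a z ≤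
      latentWeight d h z * (z i ^ (-s) * condNorm X y a (fun _ => 1)) := by gcongr
    _ = condNorm X y a (fun _ => 1) * (latentWeight d h z * z i ^ (-s)) := by ring
    _ ≤ _ := by gcongr

theorem marginal_ne_top (hd : 1 ≤ d) (hr : (Matrix.fromCols X y).rank = p + d)
    (ha : (p : ℝ) + 2 * d - 2 * a < n) (hh : IsRegularMixingKernel d h) :
    marginal X y a h ≠ ⊤ := by
  rw [marginal_eq hr ha hh]
  exact ENNReal.mul_ne_top ENNReal.ofReal_ne_top
    (lintegral_weight_mul_condMass_ne_top hd hr ha hh)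

theorem marginal_ne_zero (hr : (Matrix.fromCols X y).rank = p + d)
    (ha : (p : ℝ) + 2 * d - 2 * a < n) (hh : IsRegularMixingKernel d h) :
    marginal X y a h ≠ 0 := by
  rw [marginal_eq hr ha hh]
  refine mul_ne_zero (by simpa using likelihoodConst_pos n d) ?_
  have hs : MeasurableSet {z : Fin n → ℝ | ∀ i, 0 < z i} := by
    rw [Set.ofPred_forall]
    exact MeasurableSet.iInter fun i => measurableSet_lt measurable_const (measurable_pi_apply i)
  refine lintegral_ofReal_ne_zero hs ?_
    ((measurable_latentWeight hh.measurable).mul measurable_condMass)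
    fun z hz => mul_pos (latentWeight_pos hh hz) (condMass_pos hr ha hz)
  have hopen : IsOpen {z : Fin n → ℝ | ∀ i, 0 < z i} := by
    rw [Set.ofPred_forall]
    exact isOpen_iInter_of_finite fun i => isOpen_lt continuous_const (continuous_apply i)
  exact (hopen.measure_pos _ ⟨fun _ => 1, fun _ => one_pos⟩).ne'

end Chain


/-! ### The square root kernel and the Markov operator -/

section Operator

variable {n p d : ℕ} {X : Matrix (Fin n) (Fin p) ℝ} {y : Matrix (Fin n) (Fin d) ℝ} {a : ℝ}
  {h : ℝ → ℝ}

/-- The posterior density. -/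
def posteriorDensity (X : Matrix (Fin n) (Fin p) ℝ) (y : Matrix (Fin n) (Fin d) ℝ) (a : ℝ)
    (h : ℝ → ℝ) (x : Param p d) : ℝ :=
  likelihoodConst n d * (x.sigma.det ^ (-((n : ℝ) / 2 + a)) * tiltedProd X y h x) /
    (marginal X y a h).toReal

theorem measurable_posteriorDensity (hh : Measurable h) :
    Measurable (posteriorDensity (p := p) X y a h) :=
  (((measurable_det_sigma.pow_const _).mul (measurable_tiltedProd hh)).const_mul _).div_const _

theorem posteriorDensity_nonneg (hh : IsRegularMixingKernel d h) {x : Param p d}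
    (hx : x ∈ stateSpace p d) : 0 ≤ posteriorDensity X y a h x := by
  have hx' : x.sigma.PosDef := hx
  exact div_nonneg (mul_nonneg (likelihoodConst_pos n d).le (mul_nonneg
    (Real.rpow_nonneg hx'.det_pos.le _) (tiltedProd_pos hh hx).le)) ENNReal.toReal_nonneg

theorem marginal_toReal_pos (hd : 1 ≤ d) (hr : (Matrix.fromCols X y).rank = p + d)
    (ha : (p : ℝ) + 2 * d - 2 * a < n) (hh : IsRegularMixingKernel d h) :
    0 < (marginal X y a h).toReal :=
  ENNReal.toReal_pos (marginal_ne_zero hr ha hh) (marginal_ne_top hd hr ha hh)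

theorem posterior_eq (hd : 1 ≤ d) (hr : (Matrix.fromCols X y).rank = p + d)
    (ha : (p : ℝ) + 2 * d - 2 * a < n) (hh : IsRegularMixingKernel d h) :
    posterior X y a h = (stateMeasure p d).withDensity fun x =>
      ENNReal.ofReal (posteriorDensity X y a h x) := by
  refine withDensity_congr_ae ?_
  filter_upwards [ae_stateMeasure p d] with x hx
  rw [posteriorDensity, ENNReal.ofReal_div_of_pos (marginal_toReal_pos hd hr ha hh),
    ENNReal.ofReal_toReal (marginal_ne_top hd hr ha hh), likelihood_mul_priorDensity hx]

theorem isProbabilityMeasure_posterior (hd : 1 ≤ d) (hr : (Matrix.fromCols X y).rank = p + d)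
    (ha : (p : ℝ) + 2 * d - 2 * a < n) (hh : IsRegularMixingKernel d h) :
    IsProbabilityMeasure (posterior X y a h) := by
  refine ⟨?_⟩
  rw [posterior, withDensity_apply _ MeasurableSet.univ, Measure.restrict_univ]
  simp only [div_eq_mul_inv]
  rw [lintegral_mul_const' _ _ (ENNReal.inv_ne_top.2 (marginal_ne_zero hr ha hh))]
  exact ENNReal.mul_inv_cancel (marginal_ne_zero hr ha hh) (marginal_ne_top hd hr ha hh)

theorem ae_posterior : ∀ᵐ x ∂(posterior X y a h), x ∈ stateSpace p d :=
  (withDensity_absolutelyContinuous _ _).ae_le (ae_stateMeasure p d)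

theorem lintegral_posterior (hd : 1 ≤ d) (hr : (Matrix.fromCols X y).rank = p + d)
    (ha : (p : ℝ) + 2 * d - 2 * a < n) (hh : IsRegularMixingKernel d h) {f : Param p d → ENNReal}
    (hf : Measurable f) :
    ∫⁻ x, f x ∂(posterior X y a h) =
      ∫⁻ x, ENNReal.ofReal (posteriorDensity X y a h x) * f x ∂(stateMeasure p d) := by
  rw [posterior_eq hd hr ha hh, lintegral_withDensity_eq_lintegral_mul _
    (measurable_posteriorDensity hh.measurable).ennreal_ofReal hf]
  rfl

theorem integral_posterior (hd : 1 ≤ d) (hr : (Matrix.fromCols X y).rank = p + d)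
    (ha : (p : ℝ) + 2 * d - 2 * a < n) (hh : IsRegularMixingKernel d h) (f : Param p d → ℝ) :
    ∫ x, f x ∂(posterior X y a h) =
      ∫ x, posteriorDensity X y a h x * f x ∂(stateMeasure p d) := by
  rw [posterior_eq hd hr ha hh, integral_withDensity_eq_integral_toReal_smul
    (measurable_posteriorDensity hh.measurable).ennreal_ofReal
    (.of_forall fun x => ENNReal.ofReal_lt_top)]
  refine integral_congr_ae ?_
  filter_upwards [ae_stateMeasure p d] with x hx
  rw [ENNReal.toReal_ofReal (posteriorDensity_nonneg hh hx), smul_eq_mul]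

theorem integrable_posterior_iff (hd : 1 ≤ d) (hr : (Matrix.fromCols X y).rank = p + d)
    (ha : (p : ℝ) + 2 * d - 2 * a < n) (hh : IsRegularMixingKernel d h) (f : Param p d → ℝ) :
    Integrable f (posterior X y a h) ↔
      Integrable (fun x => posteriorDensity X y a h x * f x) (stateMeasure p d) := by
  rw [posterior_eq hd hr ha hh, integrable_withDensity_iff_integrable_smul'
    (measurable_posteriorDensity hh.measurable).ennreal_ofReal
    (.of_forall fun x => ENNReal.ofReal_lt_top)]
  refine integrable_congr ?_
  filter_upwards [ae_stateMeasure p d] with x hx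
  rw [ENNReal.toReal_ofReal (posteriorDensity_nonneg hh hx), smul_eq_mul]

/-- The ratio between the conditional density of `(β, Σ)` and `condKernel / condMass`. -/
def condScale (n p d : ℕ) (a : ℝ) : ℝ := (condConst n p d a).toReal / stepConst n p d a

theorem condScale_pos (ha : (p : ℝ) + 2 * d - 2 * a < n) : 0 < condScale n p d a :=
  div_pos (ENNReal.toReal_pos (condConst_ne_zero n p d a) (condConst_ne_top ha)) (stepConst_pos ha)

theorem transitionDensity_eq (hr : (Matrix.fromCols X y).rank = p + d)
    (ha : (p : ℝ) + 2 * d - 2 * a < n) {x x' : Param p d} (hx' : x' ∈ stateSpace p d) :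
    transitionDensity X y a h x' x =
      ∫ z, condScale n p d a * (condKernel X y a z x' / condMass X y a z) *
        (latentWeight d h z * expKernel X y z x / tiltedProd X y h x) ∂(latentMeasure n) := by
  refine integral_congr_ae ?_
  filter_upwards [ae_latentMeasure n] with z hz
  rw [matrixNormalDensity_mul_inverseWishartDensity hr ha hz hx', prod_latentDensity,
    condMass_eq hr ha hz]
  rfl

/-- The square integrable kernel `κ` such that the chain has kernel `∫ κ(x, z) κ(x', z) dz` with
respect to the posterior. -/
def rootKernel (X : Matrix (Fin n) (Fin p) ℝ) (y : Matrix (Fin n) (Fin d) ℝ) (a : ℝ)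
    (h : ℝ → ℝ) (x : Param p d) (z : Fin n → ℝ) : ℝ :=
  Real.sqrt (condScale n p d a * ((marginal X y a h).toReal / likelihoodConst n d) *
    latentWeight d h z / condMass X y a z) * (expKernel X y z x / tiltedProd X y h x)

theorem measurable_rootKernel (hh : Measurable h) :
    Measurable (Function.uncurry (rootKernel X y a h)) := by
  refine Measurable.mul (Measurable.sqrt ?_) ?_
  · exact (((measurable_latentWeight hh).const_mul _).div measurable_condMass).comp measurable_snd
  · exact (measurable_expKernel.comp measurable_swap).div
      ((measurable_tiltedProd hh).comp measurable_fst)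

theorem rootKernel_arg_nonneg (hr : (Matrix.fromCols X y).rank = p + d)
    (ha : (p : ℝ) + 2 * d - 2 * a < n) (hh : IsRegularMixingKernel d h) {z : Fin n → ℝ}
    (hz : ∀ i, 0 < z i) :
    0 ≤ condScale n p d a * ((marginal X y a h).toReal / likelihoodConst n d) *
      latentWeight d h z / condMass X y a z := by
  have h1 := condScale_pos ha
  have h2 := likelihoodConst_pos n d
  have h3 := latentWeight_pos hh hz
  have h4 := condMass_pos hr ha hz
  have h5 : 0 ≤ (marginal X y a h).toReal := ENNReal.toReal_nonneg
  positivity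

/-- The posterior density cancels T(x') and the constants under the root, leaving the conditional
density of x' given z times that of z given x. -/
theorem posteriorDensity_mul_rootKernel_mul (hd : 1 ≤ d)
    (hr : (Matrix.fromCols X y).rank = p + d) (ha : (p : ℝ) + 2 * d - 2 * a < n)
    (hh : IsRegularMixingKernel d h) {z : Fin n → ℝ} (hz : ∀ i, 0 < z i) (x : Param p d)
    {x' : Param p d} (hx' : x' ∈ stateSpace p d) :
    posteriorDensity X y a h x' * (rootKernel X y a h x z * rootKernel X y a h x' z) =
      condScale n p d a * (condKernel X y a z x' / condMass X y a z) *
        (latentWeight d h z * expKernel X y z x / tiltedProd X y h x) := by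
  have h1 := Real.mul_self_sqrt (rootKernel_arg_nonneg hr ha hh hz)
  have h2 := (likelihoodConst_pos n d).ne'
  have h3 := (marginal_toReal_pos hd hr ha hh).ne'
  have h4 := (tiltedProd_pos (X := X) (y := y) hh hx').ne'
  rw [rootKernel, rootKernel, mul_mul_mul_comm (Real.sqrt _), h1, posteriorDensity, condKernel_eq]
  field_simp

theorem posteriorDensity_mul_integral_rootKernel (hd : 1 ≤ d)
    (hr : (Matrix.fromCols X y).rank = p + d) (ha : (p : ℝ) + 2 * d - 2 * a < n)
    (hh : IsRegularMixingKernel d h) (x : Param p d) {x' : Param p d}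
    (hx' : x' ∈ stateSpace p d) :
    posteriorDensity X y a h x' *
      ∫ z, rootKernel X y a h x z * rootKernel X y a h x' z ∂(latentMeasure n) =
      transitionDensity X y a h x' x := by
  rw [transitionDensity_eq hr ha hx', ← integral_const_mul]
  refine integral_congr_ae ?_
  filter_upwards [ae_latentMeasure n] with z hz
  exact posteriorDensity_mul_rootKernel_mul hd hr ha hh hz x hx'

/-- Constants are eigenfunctions: integrating over x' cancels `condMass`, then integrating over z
cancels T(x). -/
theorem integral_rootKernel_posterior (hd : 1 ≤ d)
    (hr : (Matrix.fromCols X y).rank = p + d) (ha : (p : ℝ) + 2 * d - 2 * a < n)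
    (hh : IsRegularMixingKernel d h) {x : Param p d} (hx : x ∈ stateSpace p d) :
    ∫ z, rootKernel X y a h x z * ∫ x', rootKernel X y a h x' z ∂(posterior X y a h)
      ∂(latentMeasure n) = condScale n p d a := by
  have h1 : ∀ᵐ z ∂(latentMeasure n),
      rootKernel X y a h x z * ∫ x', rootKernel X y a h x' z ∂(posterior X y a h) =
        condScale n p d a * (tiltedProd X y h x)⁻¹ *
          (latentWeight d h z * expKernel X y z x) := by
    filter_upwards [ae_latentMeasure n] with z hz
    rw [← integral_const_mul, integral_posterior hd hr ha hh]
    have h2 : ∫ x', posteriorDensity X y a h x' * (rootKernel X y a h x z *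
        rootKernel X y a h x' z) ∂(stateMeasure p d) =
        ∫ x', (condScale n p d a * (tiltedProd X y h x)⁻¹ *
          (latentWeight d h z * expKernel X y z x)) / condMass X y a z * condKernel X y a z x'
          ∂(stateMeasure p d) := by
      refine integral_congr_ae ?_
      filter_upwards [ae_stateMeasure p d] with x' hx'
      rw [posteriorDensity_mul_rootKernel_mul hd hr ha hh hz x hx']
      ring
    have h3 : ∫ x', condKernel X y a z x' ∂(stateMeasure p d) = condMass X y a z := by
      rw [integral_eq_lintegral_of_nonneg_ae]
      · rfl
      · filter_upwards [ae_stateMeasure p d] with x' hx' using (condKernel_pos X y a z hx').le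
      · exact ((measurable_condKernel X y a).comp measurable_prodMk_left).aestronglyMeasurable
    rw [h2, integral_const_mul, h3, div_mul_cancel₀ _ (condMass_pos hr ha hz).ne']
  rw [integral_congr_ae h1, integral_const_mul, integral_weight_mul_expKernel, mul_assoc,
    inv_mul_cancel₀ (tiltedProd_pos hh hx).ne', mul_one]

/-- On the diagonal x = x', the bound of `exists_tilted_bound` replaces the latent density by ∏
B(zᵢ) exp(¼ Σ zᵢ rᵢ). The exponential is absorbed into `condKernel` at z/2, whose mass is a constant
multiple of the mass at z by homogeneity. -/
theorem memLp_rootKernel (hd : 1 ≤ d)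
    (hr : (Matrix.fromCols X y).rank = p + d) (ha : (p : ℝ) + 2 * d - 2 * a < n)
    (hh : IsRegularMixingKernel d h) :
    MemLp (Function.uncurry (rootKernel X y a h)) 2
      ((posterior X y a h).prod (latentMeasure n)) := by
  have := isProbabilityMeasure_posterior hd hr ha hh
  have hm := measurable_rootKernel (X := X) (y := y) (a := a) hh.measurable
  refine (memLp_two_iff_integrable_sq hm.aestronglyMeasurable).2
    ⟨(hm.pow_const 2).aestronglyMeasurable, ?_⟩
  rw [hasFiniteIntegral_iff_ofReal (.of_forall fun q => sq_nonneg _),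
    lintegral_prod_symm _ (hm.pow_const 2).ennreal_ofReal.aemeasurable]
  obtain ⟨B, hBm, hBi, hB0, hB⟩ := hh.exists_tilted_bound
  -- The power of 1/2 is the ratio of the normalizations at z/2 and at z.
  set c := condScale n p d a * (1 / 2 : ℝ) ^ (-condDegree n p d a) with hc
  have hc0 : 0 < condScale n p d a := condScale_pos ha
  have hint : Integrable (fun z : Fin n → ℝ => c * ∏ i, B (z i)) (latentMeasure n) := by
    rw [latentMeasure_eq_pi]
    exact (Integrable.fintype_prod_dep fun _ => hBi).const_mul _
  refine lt_of_le_of_lt (lintegral_mono_ae ?_) hint.lintegral_lt_top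
  filter_upwards [ae_latentMeasure n] with z hz
  have hz2 : ∀ i, 0 < ((1 / 2 : ℝ) • z) i := fun i => mul_pos (by norm_num) (hz i)
  have hBz : 0 ≤ ∏ i, B (z i) := Finset.prod_nonneg fun i _ => hB0 _ (hz i)
  have hN := condMass_pos hr ha hz
  rw [lintegral_posterior hd hr ha hh (f := fun x => ENNReal.ofReal
    (Function.uncurry (rootKernel X y a h) (x, z) ^ 2)) ((hm.comp measurable_prodMk_right).pow_const 2).ennreal_ofReal]
  calc ∫⁻ x, ENNReal.ofReal (posteriorDensity X y a h x) *
        ENNReal.ofReal (rootKernel X y a h x z ^ 2) ∂(stateMeasure p d) ≤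
      ∫⁻ x, ENNReal.ofReal (condScale n p d a * (∏ i, B (z i)) / condMass X y a z) *
        ENNReal.ofReal (condKernel X y a ((1 / 2 : ℝ) • z) x) ∂(stateMeasure p d) := by
        refine lintegral_mono_ae ?_
        filter_upwards [ae_stateMeasure p d] with x hx
        have hx' : x.sigma.PosDef := hx
        rw [← ENNReal.ofReal_mul (posteriorDensity_nonneg hh hx),
          ← ENNReal.ofReal_mul (by positivity)]
        refine ENNReal.ofReal_le_ofReal ?_
        rw [sq, posteriorDensity_mul_rootKernel_mul hd hr ha hh hz x hx]
        have h1 : latentWeight d h z * expKernel X y z x / tiltedProd X y h x ≤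
            (∏ i, B (z i)) * Real.exp (1 / 4 * ∑ i, z i * sqResidual X y x i) := by
          rw [div_le_iff₀ (tiltedProd_pos hh hx), ← prod_tilted_eq, Finset.mul_sum, Real.exp_sum,
            tiltedProd, ← Finset.prod_mul_distrib, ← Finset.prod_mul_distrib]
          refine Finset.prod_le_prod (fun i _ => ?_) fun i _ => ?_
          · have := hh.pos _ (hz i)
            have := hz i
            positivity
          · refine (hB _ _ (sqResidual_nonneg hx i) (hz i)).trans (le_of_eq ?_)
            rw [show 1 / 4 * (z i * sqResidual X y x i) = sqResidual X y x i * z i / 4 by ring]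
            rfl
        have h2 : condKernel X y a ((1 / 2 : ℝ) • z) x =
            condKernel X y a z x * Real.exp (1 / 4 * ∑ i, z i * sqResidual X y x i) := by
          rw [condKernel, condKernel, mul_assoc, ← Real.exp_add]
          congr 2
          simp only [Pi.smul_apply, smul_eq_mul, mul_assoc, ← Finset.mul_sum]
          ring
        have h3 := condKernel_pos X y a z hx
        calc condScale n p d a * (condKernel X y a z x / condMass X y a z) *
              (latentWeight d h z * expKernel X y z x / tiltedProd X y h x) ≤
            condScale n p d a * (condKernel X y a z x / condMass X y a z) *
              ((∏ i, B (z i)) * Real.exp (1 / 4 * ∑ i, z i * sqResidual X y x i)) := by gcongr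
          _ = _ := by rw [h2]; ring
    _ = ENNReal.ofReal (c * ∏ i, B (z i)) := by
        rw [lintegral_const_mul' _ _ ENNReal.ofReal_ne_top,
          lintegral_condKernel_eq_condMass hr ha hz2, ← ENNReal.ofReal_mul (by positivity),
          condMass_eq hr ha hz2, condNorm_smul hr a (by norm_num) hz, ← condMass_eq hr ha hz]
        congr 1
        rw [hc]
        field_simp

theorem exists_DAOperator (hd : 1 ≤ d)
    (hr : (Matrix.fromCols X y).rank = p + d) (ha : (p : ℝ) + 2 * d - 2 * a < n)
    (hh : IsRegularMixingKernel d h) :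
    ∃ K : meanZeroL2 (posterior X y a h) →L[ℝ] meanZeroL2 (posterior X y a h),
      IsDAOperator X y a h K ∧ IsPositiveTraceClass K := by
  have := isProbabilityMeasure_posterior hd hr ha hh
  have hc : ∀ᵐ x ∂(posterior X y a h), ∫ z, rootKernel X y a h x z *
      ∫ x', rootKernel X y a h x' z ∂(posterior X y a h) ∂(latentMeasure n) =
      condScale n p d a := by
    filter_upwards [ae_posterior] with x hx using integral_rootKernel_posterior hd hr ha hh hx
  obtain ⟨K, hK, hKf⟩ := exists_isPositiveTraceClass_kernel
    (measurable_rootKernel hh.measurable) (memLp_rootKernel hd hr ha hh) hc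
  refine ⟨K, fun f => ?_, hK⟩
  filter_upwards [hKf f] with x hx
  have heq : ∀ᵐ x' ∂(stateMeasure p d), posteriorDensity X y a h x' *
      ((f : Lp ℝ 2 (posterior X y a h)) x' *
        ∫ z, rootKernel X y a h x z * rootKernel X y a h x' z ∂(latentMeasure n)) =
      (f : Lp ℝ 2 (posterior X y a h)) x' * transitionDensity X y a h x' x := by
    filter_upwards [ae_stateMeasure p d] with x' hx'
    rw [← posteriorDensity_mul_integral_rootKernel hd hr ha hh x hx']
    ring
  refine ⟨((integrable_posterior_iff hd hr ha hh _).1 hx.1).congr heq, ?_⟩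
  rw [hx.2, integral_posterior hd hr ha hh]
  exact integral_congr_ae heq

end Operator

end

/-! ### Conclusion -/

theorem mainTheorem7 (n p d : ℕ) (hd : 1 ≤ d)
    (X : Matrix (Fin n) (Fin p) ℝ) (y : Matrix (Fin n) (Fin d) ℝ) (a : ℝ)
    (hS1 : (Matrix.fromCols X y).rank = p + d)
    (hS2 : (p : ℝ) + 2 * d - 2 * a < n)
    (h : ℝ → ℝ)
    (hh : (∃ v α γ : ℝ, 0 < α ∧ 0 < γ ∧ h = gigDensity v α γ) ∨
      (∃ μ γ : ℝ, 0 < γ ∧ h = logNormalDensity μ γ) ∨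
      (∃ α γ : ℝ, (d : ℝ) / 2 < α ∧ 0 < γ ∧ h = frechetDensity α γ) ∨
      (∃ α γ : ℝ, (d : ℝ) / 2 < α ∧ 0 < γ ∧ h = invGammaDensity α γ)) :
    IsMixingDensity h ∧
    IntegrableOn (fun u : ℝ => u ^ ((d : ℝ) / 2) * h u) (Set.Ioi 0) ∧
    IntegrableOn (fun u : ℝ => u ^ (-(((n : ℝ) - p + 2 * a - 2 * d - 1) / 2)) * h u)
      (Set.Ioi 0) ∧
    IsProbabilityMeasure (posterior X y a h) ∧
    ∃ K : meanZeroL2 (posterior X y a h) →L[ℝ] meanZeroL2 (posterior X y a h),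
      IsDAOperator X y a h K ∧ IsPositiveTraceClass K := by
  obtain ⟨g, hg, rfl⟩ : ∃ g, IsRegularMixingKernel d g ∧ h = normalized g := by
    rcases hh with ⟨v, α, γ, hα, hγ, rfl⟩ | ⟨μ, γ, hγ, rfl⟩ | ⟨α, γ, hα, hγ, rfl⟩ |
      ⟨α, γ, hα, hγ, rfl⟩
    · exact ⟨_, isRegularMixingKernel_gig v hα hγ, rfl⟩
    · exact ⟨_, isRegularMixingKernel_logNormal μ hγ, rfl⟩
    · exact ⟨_, isRegularMixingKernel_frechet hα hγ, rfl⟩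
    · exact ⟨_, isRegularMixingKernel_invGamma hα hγ, rfl⟩
  have hd' : (1 : ℝ) ≤ d := by exact_mod_cast hd
  exact ⟨hg.isMixingDensity_normalized, hg.normalized.integrableOn_rpow_mul le_rfl,
    -- The exponent is below 1/2 because n > p + 2d - 2a, and 1/2 ≤ d/2.
    hg.normalized.integrableOn_rpow_mul (by linarith),
    isProbabilityMeasure_posterior hd hS1 hS2 hg.normalized,
    exists_DAOperator hd hS1 hS2 hg.normalized⟩
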